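/- Work in $\mathbb H^2\times\mathbb R$, using the Poincaré disk $\mathbb D$ and the half-plane $\mathfrak H=\{z=x+iy:\ y>0\}$, with metrics $4|dz|^2/(1-|z|^2)^2+dt^2$ and $|dz|^2/y^2+dt^2$ respectively, identified through $g(z)=i\,\frac{1-z}{1+z}$. For $\kappa>0$ let $r_0=\sqrt{\kappa+1}-\sqrt\kappa$, let $r_\kappa$ be the positive solution of $4rr''-4r'^2+r^4-1=0$ with $\kappa=\frac{(1-r^2)^2}{4r^2}+\left(\frac{r'}{r}\right)^2$ and $r(0)=r_0$, and let $h_\kappa>0$ be such that $r_\kappa(\pm h_\kappa/2)=1$ and $r_\kappa<1$ on $(-h_\kappa/2,h_\kappa/2)$. Let $C_\kappa=\{(r_\kappa(t)e^{i\sqrt\kappa\,\theta},t):\theta\in\mathbb R,\ |t|<h_\kappa/2\}\subset\mathbb D\times\mathbb R$ be the catenoid of revolution, put $\mu_0=-i\,g(r_0)$, and let $\widehat C_\kappa\subset\mathfrak H\times\mathbb R$ be the dilated catenoid, the image of $C_\kappa$ under $(z,t)\mapsto(g(z)/\mu_0,t)$. Let $\Omega_\kappa$ be the complement in $\mathfrak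 H$ of the open disk with centre $i(\mu_0+\mu_0^{-1})/2$ and radius $(\mu_0^{-1}-\mu_0)/2$, and set $$t_\kappa(r)=\int_{r_0}^r\frac{2\,du}{\sqrt{4\kappa u^2-(1-u^2)^2}},\qquad t_\kappa(x,y)=t_\kappa\big(|g^{-1}(\mu_0(x+iy))|\big),\qquad \Phi_\kappa(x,y)=(x,y,t_\kappa(x,y)).$$ For a smooth immersed minimal surface $F:U\to\mathfrak H\times\mathbb R$ with unit normal $\nu$, a smooth deformation of $F$ into a family of surfaces $S_\kappa$ ($\kappa>0$) is a map $G(\kappa,q)$, smooth near $\{0\}\times U$, with $G(0,\cdot)=F$ and $G(\kappa,\cdot)\in S_\kappa$ for $\kappa>0$, such that for small $\kappa$ the sheet $G(\kappa,\cdot)$ is all of $S_\kappa$ near each point of $F(U)$. The function $w$ on $U$ is called the Jacobi field resulting from the deformation of $F$ into $S_\kappa$ if such a $G$ exists, if $w=\langle\nu,\partial_\kappa G|_{\kappa=0}\rangle$ for every such $G$, and if $Lw=0$, where $L=-(\Delta_g+\mathrm{Ric}(\nu,\nu)+|A|^2)$ is the Jacobi operator of $F$. Then the following hold. 1. For every $\kappa>0$,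 $\widehat C_\kappa=\{(x,y,t):\ x+iy\in\mu_0^{-1}\Omega_\kappa,\ |t|=t_\kappa(x,y)\}$, the set $\mu_0^{-1}\Omega_\kappa$ contains $\{0<y\le1\}$, and $\Phi_\kappa$ is a smooth minimal immersion of the interior of $\mu_0^{-1}\Omega_\kappa$. Every $z$ with $\operatorname{Im}z>1$ lies outside $\mu_0^{-1}\Omega_\kappa$ for all small $\kappa$. 2. As $\kappa\searrow0$, $\widehat C_\kappa$ converges to the parabolic catenoid $\{(x,\cos t,t):\ x\in\mathbb R,\ |t|<\pi/2\}$: for $0<y\le1$, $\Phi_\kappa(x,y)\to\Phi_0(x,y)=(x,y,\arccos y)$; there is a smooth deformation of $\widehat F(x,t)=(x,\cos t,t)$, $|t|<\pi/2$, into the surfaces $\widehat C_\kappa$; and every point of $\mathfrak H\times\mathbb R$ off the parabolic catenoid has a neighbourhood disjoint from $\widehat C_\kappa$ for all small $\kappa$. 3. For $0<y<1$, $$\lim_{\kappa\searrow0}\frac{\Phi_\kappa(x,y)-\Phi_0(x,y)}{\kappa}=\Big(0,0,\tfrac14\Big(\tfrac{x^2y}{\sqrt{1-y^2}}-\arccos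 y\Big)\Big),$$ and the inner product of this vector with $\nu=(0,-y^2,-\sqrt{1-y^2})$ is $w(x,y)=\frac14\big(\sqrt{1-y^2}\,\arccos y-x^2y\big)$. The vector $\nu$ is a unit normal of $\Phi_0$ on $\{0<y<1\}$, and $w(x,y)$ is the Jacobi field on it resulting from the deformation into $\widehat C_\kappa$. 4. In the parametrization $\widehat F(x,t)=(x,\cos t,t)$, $|t|<\pi/2$, of the whole parabolic catenoid, with unit normal $(0,-\cos^2t,-\sin t)$, the resulting Jacobi field is $w(x,t)=\frac14(t\sin t-x^2\cos t)$. For $0<t<\pi/2$ one has $\Phi_0(x,\cos t)=\widehat F(x,t)$, and $w(x,t)$ is the value of the function in 3 at $(x,\cos t)$. 5. On the model $\Psi(x,t)=(x,\sin t,t)$, $0<t<\pi$, with unit normal $(0,-\sin^2t,\cos t)$, the Jacobi field resulting from the deformation into the surfaces $\widehat C_\kappa$ translated vertically by $\pi/2$ is $\frac18\big((\pi-2t)\cos t-2x^2\sin t\big)$. -/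

import Mathlib

open Filter Topology
open scoped ContDiff

noncomputable section

/-! ### The ambient space `ℍ² × ℝ` in the half-plane model

Points are pairs `(z, t) : ℂ × ℝ` with `0 < z.im`, with metric `|dz|² / y² + dt²`;
tangent vectors are also elements of `ℂ × ℝ`. -/

/-- The Riemannian metric of `ℍ² × ℝ` at `p`. -/
def ambientMetric (p u v : ℂ × ℝ) : ℝ :=
  (u.1.re * v.1.re + u.1.im * v.1.im) / p.1.im ^ 2 + u.2 * v.2

/-- The Christoffel term of the Levi-Civita connection, `∇_u v = D_u v + christoffel p u v`.
For the conformal metric `λ² |dz|²` it is `2 (∂_z log λ) u v`, which is `(i / y) u v` for `λ = 1 / y`;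
the factor `ℝ` is flat. -/
def christoffel (p u v : ℂ × ℝ) : ℂ × ℝ :=
  (Complex.I / (p.1.im : ℂ) * u.1 * v.1, 0)

/-- The Ricci curvature `Ric(n, n)` of `ℍ² × ℝ` at `p`: minus the squared length of the
`ℍ²`-component of `n`. -/
def ambientRicci (p n : ℂ × ℝ) : ℝ :=
  -((n.1.re ^ 2 + n.1.im ^ 2) / p.1.im ^ 2)

/-! ### Parametrized surfaces `F : ℝ × ℝ → ℂ × ℝ` -/

/-- The standard basis vectors of the parameter plane. -/
def paramVec (i : Fin 2) : ℝ × ℝ := if i = 0 then (1, 0) else (0, 1)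

/-- The `i`-th partial derivative of a map on the parameter plane. -/
def partialD {E : Type*} [NormedAddCommGroup E] [NormedSpace ℝ E]
    (i : Fin 2) (f : ℝ × ℝ → E) (q : ℝ × ℝ) : E :=
  fderiv ℝ f q (paramVec i)

/-- The first fundamental form `g_{ij}`. -/
def firstForm (F : ℝ × ℝ → ℂ × ℝ) (q : ℝ × ℝ) : Matrix (Fin 2) (Fin 2) ℝ :=
  Matrix.of fun i j => ambientMetric (F q) (partialD i F q) (partialD j F q)

/-- The second fundamental form `⟨∇_{F_i} F_j, n⟩` with respect to the vector `n` at `F q`. -/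
def secondForm (F : ℝ × ℝ → ℂ × ℝ) (n : ℂ × ℝ) (q : ℝ × ℝ) : Matrix (Fin 2) (Fin 2) ℝ :=
  Matrix.of fun i j => ambientMetric (F q)
    (partialD i (partialD j F) q + christoffel (F q) (partialD i F q) (partialD j F q)) n

/-- `n` is a unit normal vector of the surface `F` at the parameter `q`. -/
def IsUnitNormal (F : ℝ × ℝ → ℂ × ℝ) (q : ℝ × ℝ) (n : ℂ × ℝ) : Prop :=
  ambientMetric (F q) n n = 1 ∧ ∀ i, ambientMetric (F q) (partialD i F q) n = 0

/-- `F` is a smooth immersion of the (open) set `U` into `ℍ² × ℝ` with vanishing mean curvature. -/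
structure IsMinimalImmersionOn (F : ℝ × ℝ → ℂ × ℝ) (U : Set (ℝ × ℝ)) : Prop where
  mapsTo : ∀ q ∈ U, 0 < (F q).1.im
  smooth : ContDiffOn ℝ ∞ F U
  immersion : ∀ q ∈ U, Function.Injective (fderiv ℝ F q)
  meanCurvature : ∀ q ∈ U, ∀ n, IsUnitNormal F q n →
    ((firstForm F q)⁻¹ * secondForm F n q).trace = 0

/-- The Laplace–Beltrami operator of the induced metric. -/
def surfaceLaplacian (F : ℝ × ℝ → ℂ × ℝ) (w : ℝ × ℝ → ℝ) (q : ℝ × ℝ) : ℝ :=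
  (√(firstForm F q).det)⁻¹ * ∑ i, ∑ j,
    partialD i (fun q' => √(firstForm F q').det * (firstForm F q')⁻¹ i j * partialD j w q') q

/-- The squared length `|A|²` of the second fundamental form. -/
def normSqSecondForm (F : ℝ × ℝ → ℂ × ℝ) (n : ℂ × ℝ) (q : ℝ × ℝ) : ℝ :=
  ((firstForm F q)⁻¹ * secondForm F n q * (firstForm F q)⁻¹ * secondForm F n q).trace

/-- The Jacobi operator `L = -(Δ_g + Ric(ν, ν) + |A|²)` of the surface `F` with unit normal `ν`. -/
def jacobiOperator (F ν : ℝ × ℝ → ℂ × ℝ) (w : ℝ × ℝ → ℝ) (q : ℝ × ℝ) : ℝ :=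
  -(surfaceLaplacian F w q +
    (ambientRicci (F q) (ν q) + normSqSecondForm F (ν q) q) * w q)

/-! ### Jacobi fields generated by deformations -/

/-- `G` exhibits the surfaces `S κ`, `κ > 0`, as a smooth deformation of the surface `F` on `U`:
`G (0, ·) = F`, `G` is smooth in all variables up to and across `κ = 0`, `G (κ, ·)` maps into `S κ`,
and near each point `F q`, for small `κ`, there is nothing of `S κ` outside the sheet `G (κ, ·)`. -/
structure IsSmoothDeformation (S : ℝ → Set (ℂ × ℝ)) (F : ℝ × ℝ → ℂ × ℝ) (U : Set (ℝ × ℝ))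
    (G : ℝ × (ℝ × ℝ) → ℂ × ℝ) : Prop where
  zero : ∀ q ∈ U, G (0, q) = F q
  smooth_mem : ∃ W : Set (ℝ × (ℝ × ℝ)), IsOpen W ∧ (∀ q ∈ U, ((0 : ℝ), q) ∈ W) ∧
    ContDiffOn ℝ ∞ G W ∧ ∀ κ q, 0 < κ → (κ, q) ∈ W → G (κ, q) ∈ S κ
  covers : ∀ q ∈ U, ∀ N ∈ 𝓝 q, ∃ V ∈ 𝓝 (F q),
    ∀ᶠ κ in 𝓝[>] (0 : ℝ), S κ ∩ V ⊆ (fun q' => G (κ, q')) '' N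

/-- The minimal surface `F` on `U`, with unit normal field `ν`, is smoothly deformed into the
surfaces `S κ`, `κ > 0`, and `w` is the resulting Jacobi field on it: the normal component of the
variation field `∂G/∂κ` at `κ = 0`, for whichever parametrization `G` of the deformation; and `w`
satisfies the Jacobi equation. -/
structure IsJacobiFieldOfDeformation (S : ℝ → Set (ℂ × ℝ)) (F ν : ℝ × ℝ → ℂ × ℝ)
    (U : Set (ℝ × ℝ)) (w : ℝ × ℝ → ℝ) : Prop where
  minimal : IsMinimalImmersionOn F U
  normal_smooth : ContDiffOn ℝ ∞ ν U
  normal : ∀ q ∈ U, IsUnitNormal F q (ν q)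
  deforms : ∃ G, IsSmoothDeformation S F U G
  eq_normal_component : ∀ G, IsSmoothDeformation S F U G → ∀ q ∈ U,
    ambientMetric (F q) (ν q) (deriv (fun κ => G (κ, q)) 0) = w q
  jacobi : ∀ q ∈ U, jacobiOperator F ν w q = 0

/-! ### Catenoids -/

/-- The neck radius `r₀ = √(κ+1) - √κ` in the Poincaré disk. -/
def neckRadius (κ : ℝ) : ℝ := √(κ + 1) - √κ

/-- `r` is the profile `r_κ` of the catenoid with parameter `κ`, of height `h`: it satisfies the
equation of minimality of the surface of revolution `|z| = r(t)` in the Poincaré disk times `ℝ`,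
with value `κ` of the first integral, is minimal at `t = 0` with value `r₀`, and reaches the
boundary circle at `t = ± h/2`. -/
structure IsCatenoidProfile (κ h : ℝ) (r : ℝ → ℝ) : Prop where
  height_pos : 0 < h
  smooth : ContDiff ℝ ∞ r
  pos : ∀ t, 0 < r t
  first_integral : ∀ t,
    κ = (1 - r t ^ 2) ^ 2 / (4 * r t ^ 2) + (deriv r t / r t) ^ 2
  ode : ∀ t, 4 * r t * deriv (deriv r) t - 4 * deriv r t ^ 2 + r t ^ 4 - 1 = 0
  neck : r 0 = neckRadius κ
  lt_one : ∀ t, |t| < h / 2 → r t < 1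
  top : r (h / 2) = 1
  bottom : r (-(h / 2)) = 1

/-- The catenoid `C_κ` in the Poincaré disk times `ℝ`: the image of
`X_κ(θ, t) = (r_κ(t) e^{i √κ θ}, t)`, `|t| < h_κ / 2`. -/
def catenoid (κ : ℝ) : Set (ℂ × ℝ) :=
  {p | ∃ (h : ℝ) (r : ℝ → ℝ), IsCatenoidProfile κ h r ∧ ∃ θ t : ℝ, |t| < h / 2 ∧
    p = ((r t : ℂ) * Complex.exp (Complex.I * (√κ : ℝ) * θ), t)}

/-- The isometry `g` from the Poincaré disk to the upper half-plane. -/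
def cayley (z : ℂ) : ℂ := Complex.I * ((1 - z) / (1 + z))

/-- The inverse of `g`. -/
def cayleyInv (z : ℂ) : ℂ := (Complex.I - z) / (Complex.I + z)

/-- `μ₀ = -i g(r₀)`. -/
def neckHeight (κ : ℝ) : ℝ := (-Complex.I * cayley (neckRadius κ : ℂ)).re

/-- The dilated catenoid `Ĉ_κ`, in the half-plane model: the image of `C_κ` under `g` followed by
the horizontal dilation `z ↦ z / μ₀`. -/
def dilatedCatenoid (κ : ℝ) : Set (ℂ × ℝ) :=
  (fun p : ℂ × ℝ => (((neckHeight κ)⁻¹ : ℝ) * cayley p.1, p.2)) '' catenoid κ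

/-- The region `Ω_κ`, complement in the half-plane of an open disk. -/
def catenoidDomain (κ : ℝ) : Set ℂ :=
  {z | 0 < z.im} \ Metric.ball
    (Complex.I * (((neckHeight κ + (neckHeight κ)⁻¹) / 2 : ℝ) : ℂ))
    (((neckHeight κ)⁻¹ - neckHeight κ) / 2)

/-- The dilated region `Ω_κ / μ₀`. -/
def dilatedDomain (κ : ℝ) : Set ℂ :=
  (fun z : ℂ => ((neckHeight κ)⁻¹ : ℝ) * z) '' catenoidDomain κ

/-- The height `t_κ(r)` of the catenoid over the circle of radius `r` in the Poincaré disk. -/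
def catenoidTime (κ r : ℝ) : ℝ :=
  ∫ u in (neckRadius κ)..r, 2 / √(4 * κ * u ^ 2 - (1 - u ^ 2) ^ 2)

/-- The height `t_κ(x, y)` of the dilated catenoid over the point `z = x + i y`. -/
def dilatedTime (κ : ℝ) (z : ℂ) : ℝ :=
  catenoidTime κ ‖cayleyInv ((neckHeight κ : ℂ) * z)‖

/-- `Φ_κ(x, y) = (x, y, t_κ(x, y))`, for `κ > 0`. -/
def catenoidGraph (κ : ℝ) (q : ℝ × ℝ) : ℂ × ℝ := (⟨q.1, q.2⟩, dilatedTime κ ⟨q.1, q.2⟩)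

/-! ### Parabolic catenoids -/

/-- `Φ₀(x, y) = (x, y, arccos y)`. -/
def parabolicGraph (q : ℝ × ℝ) : ℂ × ℝ := (⟨q.1, q.2⟩, Real.arccos q.2)

/-- `F̂(x, t) = (x, cos t, t)`. -/
def parabolicStrip (q : ℝ × ℝ) : ℂ × ℝ := (⟨q.1, Real.cos q.2⟩, q.2)

/-- `Ψ(x, t) = (x, sin t, t)`. -/
def parabolicModel (q : ℝ × ℝ) : ℂ × ℝ := (⟨q.1, Real.sin q.2⟩, q.2)

end

/-! ### Smoothness of integrals depending on a parameter -/

section ParametricIntegral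

open MeasureTheory

variable {H : Type} [NormedAddCommGroup H] [NormedSpace ℝ H] [ProperSpace H]

/-! Everything rests on replacing the height $t$ by an angle $\psi$ with
$(1-r^2)/(2r)=\sqrt\kappa\cos\psi$. The profile equation then integrates to
$dt/d\psi=(1+\kappa\cos^2\psi)^{-1/2}$, so that $t=\psi+\kappa\,T(\kappa,\psi)$ (`angleTime`), where
$T$ (`timeDefect`) is smooth across $\kappa=0$. The neck is $\psi=0$ and the boundary circles are
$\psi=\pm\pi/2$.

With $m=\mu_0^2$, which unlike $\mu_0$ is smooth at $\kappa=0$, the dilated catenoid in the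
half-plane is the set of points for which some $|\psi|<\pi/2$ satisfies $t=\psi+\kappa T$ and
$\cos\psi\,(1+m|z|^2)=(1-m)\sqrt{1+\kappa\cos^2\psi}\;y$ (`mem_dilatedCatenoid_iff`). No
$\sqrt\kappa$ is left. At $\kappa=0$ the equation is $\cos t=y$, the parabolic catenoid.

Solving for $\cos\psi$ gives the bigraph and, differentiated at $\kappa=0$, the variation field of
the graphs. Solving for $y$ by the quadratic formula gives the deformation `sheet` of the whole
parabolic catenoid. Compactness plays no part in the convergence: $|\psi-t|\le2\kappa$ and
continuity of the equation suffice.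

The Jacobi field does not depend on the parametrization because `normal_velocity` differentiates the
equation along any curve $\kappa\mapsto\gamma(\kappa)\in\widehat C_\kappa$. The result determines
exactly the normal component of $\gamma'(0)$. The surfaces $(x,f(t),t)$ with $f=\cos$ or $\sin$
carry the conformal metric $f^{-2}(dx^2+dt^2)$, and their Jacobi equation is $w_{xx}+w_{tt}+w=0$,
checked directly; the graph $(x,y,\arccos y)$ is treated in its own orthogonal coordinates.

Minimality of the dilated catenoids off the neck follows because the height depends on $z$ only
through $(1+m|z|^2)/y$, which reduces the minimal surface equation to an ordinary differential
equation. -/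

theorem hasFDerivAt_parametric_intervalIntegral {F : Type} [NormedAddCommGroup F]
    [NormedSpace ℝ F] [CompleteSpace F] {f : H × ℝ → F} (hf : ContDiff ℝ 1 f) (a b : ℝ) (x : H) :
    HasFDerivAt (fun x => ∫ u in a..b, f (x, u))
      (∫ u in a..b, (fderiv ℝ f (x, u)).comp (ContinuousLinearMap.inl ℝ H ℝ)) x := by
  have hf' : Continuous fun p : H × ℝ =>
      (fderiv ℝ f p).comp (ContinuousLinearMap.inl ℝ H ℝ) :=
    (hf.continuous_fderiv one_ne_zero).clm_comp continuous_const
  -- Closed balls are compact in a proper space, so a constant dominates the derivative near `x`.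
  obtain ⟨C, hC⟩ := ((isCompact_closedBall x 1).prod (isCompact_uIcc (a := a) (b := b))).exists_bound_of_continuousOn
    hf'.continuousOn
  refine (intervalIntegral.hasFDerivAt_integral_of_dominated_of_fderiv_le
    (bound := fun _ => C) (s := Metric.closedBall x 1)
    (F' := fun y u => (fderiv ℝ f (y, u)).comp (ContinuousLinearMap.inl ℝ H ℝ))
    (Metric.closedBall_mem_nhds x one_pos) ?_ ?_ ?_ ?_ ?_ ?_)
  · exact Eventually.of_forall fun y =>
      (hf.continuous.comp (by fun_prop : Continuous fun u : ℝ => (y, u))).aestronglyMeasurable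
  · exact (hf.continuous.comp (by fun_prop : Continuous fun u : ℝ => (x, u))).intervalIntegrable _ _
  · exact (hf'.comp (by fun_prop : Continuous fun u : ℝ => (x, u))).aestronglyMeasurable
  · exact Eventually.of_forall fun u hu y hy => hC (y, u) ⟨hy, Set.uIoc_subset_uIcc hu⟩
  · exact intervalIntegrable_const
  · refine Eventually.of_forall fun u _ y _ => ?_
    exact ((hf.differentiable one_ne_zero).differentiableAt.hasFDerivAt (x := (y, u))).comp y
      (hasFDerivAt_prodMk_left y u)

/-- The derivative is an integral of the same kind with values in `H →L[ℝ] F`. The induction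
therefore quantifies over the codomain, and `H`, `F` lie in `Type` so that the universe does not
change. -/
theorem contDiff_parametric_intervalIntegral_nat (n : ℕ) :
    ∀ {F : Type} [NormedAddCommGroup F] [NormedSpace ℝ F] [CompleteSpace F] {f : H × ℝ → F},
    ContDiff ℝ n f → ∀ a b : ℝ, ContDiff ℝ n fun x => ∫ u in a..b, f (x, u) := by
  induction n with
  | zero =>
    intro F _ _ _ f hf a b
    have h0 : Continuous f := contDiff_zero.1 (by exact_mod_cast hf)
    have : Continuous fun x => ∫ u in a..b, f (x, u) :=
      intervalIntegral.continuous_parametric_intervalIntegral_of_continuous' (by exact h0) a b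
    exact_mod_cast contDiff_zero.2 this
  | succ n ih =>
    intro F _ _ _ f hf a b
    have h1 : ContDiff ℝ 1 f := hf.of_le (by exact_mod_cast Nat.le_add_left 1 n)
    push_cast
    rw [contDiff_succ_iff_hasFDerivAt]
    refine ⟨_, ih (f := fun p => (fderiv ℝ f p).comp (ContinuousLinearMap.inl ℝ H ℝ)) ?_ a b,
      fun x => hasFDerivAt_parametric_intervalIntegral h1 a b x⟩
    exact (hf.fderiv_right (by push_cast; rfl)).clm_comp contDiff_const

theorem contDiff_parametric_intervalIntegral {F : Type} [NormedAddCommGroup F] [NormedSpace ℝ F]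
    [CompleteSpace F] {f : H × ℝ → F} (hf : ContDiff ℝ ∞ f) (a b : ℝ) :
    ContDiff ℝ ∞ fun x => ∫ u in a..b, f (x, u) :=
  contDiff_infty.2 fun n => contDiff_parametric_intervalIntegral_nat n (contDiff_infty.1 hf n) a b

/-- The substitution $u=p_2v$ moves the variable endpoint into the parameter. -/
theorem contDiff_parametric_primitive {f : H × ℝ → ℝ} (hf : ContDiff ℝ ∞ f) :
    ContDiff ℝ ∞ fun p : H × ℝ => ∫ u in (0 : ℝ)..p.2, f (p.1, u) := by
  have h : (fun p : H × ℝ => ∫ u in (0 : ℝ)..p.2, f (p.1, u)) =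
      fun p => p.2 * ∫ v in (0 : ℝ)..1, f (p.1, p.2 * v) := by
    funext p
    have := intervalIntegral.smul_integral_comp_mul_left (a := 0) (b := 1)
      (fun u => f (p.1, u)) p.2
    simpa using this.symm
  rw [h]
  refine contDiff_snd.mul ?_
  refine contDiff_parametric_intervalIntegral (H := H × ℝ)
    (f := fun q : (H × ℝ) × ℝ => f (q.1.1, q.1.2 * q.2)) ?_ 0 1
  exact hf.comp (by fun_prop)

end ParametricIntegral

/-! ### The height of a catenoid as a function of its angle -/

noncomputable section

/-- The quotient by `κ` of `1 / √(1 + κ cos² u) - 1`. -/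
def defectDensity (κ u : ℝ) : ℝ :=
  -Real.cos u ^ 2 / (√(1 + κ * Real.cos u ^ 2) * (1 + √(1 + κ * Real.cos u ^ 2)))

/-- The primitive of `defectDensity κ` vanishing at `0`. -/
def timeDefect (κ ψ : ℝ) : ℝ := ∫ u in (0 : ℝ)..ψ, defectDensity κ u

/-- The height of the catenoid at the angle `ψ`, where `(1 - r²) / (2 r) = √κ cos ψ`;
a primitive of `1 / √(1 + κ cos² ψ)`. -/
def angleTime (κ ψ : ℝ) : ℝ := ψ + κ * timeDefect κ ψ

theorem one_add_mul_cos_sq_pos {κ : ℝ} (hκ : -1 < κ) (u : ℝ) : 0 < 1 + κ * Real.cos u ^ 2 := by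
  rcases eq_or_ne (Real.cos u) 0 with h | h
  · simp [h]
  · have : 0 < Real.cos u ^ 2 := by positivity
    nlinarith [Real.cos_sq_le_one u]

/-- The parametric lemma asks for an integrand smooth on the whole space. Writing $\kappa=e^s-1$
turns $\kappa>-1$ into $s\in\mathbb R$ and $1+\kappa\cos^2u$ into $\sin^2u+e^s\cos^2u>0$; the result
is pulled back by $s=\log(1+\kappa)$. -/
theorem contDiffOn_timeDefect :
    ContDiffOn ℝ ∞ (fun p : ℝ × ℝ => timeDefect p.1 p.2) {p | -1 < p.1} := by
  have hpos : ∀ p : ℝ × ℝ, 0 < Real.sin p.2 ^ 2 + Real.exp p.1 * Real.cos p.2 ^ 2 := by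
    intro p
    have h := one_add_mul_cos_sq_pos (κ := Real.exp p.1 - 1) (by linarith [Real.exp_pos p.1]) p.2
    nlinarith [Real.sin_sq_add_cos_sq p.2]
  have hs : ContDiff ℝ ∞ fun p : ℝ × ℝ => √(Real.sin p.2 ^ 2 + Real.exp p.1 * Real.cos p.2 ^ 2) :=
    ContDiff.sqrt (by fun_prop) fun p => (hpos p).ne'
  have hf : ContDiff ℝ ∞ fun p : ℝ × ℝ => -Real.cos p.2 ^ 2 /
      (√(Real.sin p.2 ^ 2 + Real.exp p.1 * Real.cos p.2 ^ 2) *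
        (1 + √(Real.sin p.2 ^ 2 + Real.exp p.1 * Real.cos p.2 ^ 2))) := by
    refine ContDiff.div (by fun_prop) (by fun_prop) fun p => ?_
    have := Real.sqrt_pos.2 (hpos p)
    positivity
  have hlog : ContDiffOn ℝ ∞ (fun p : ℝ × ℝ => (Real.log (1 + p.1), p.2)) {p | -1 < p.1} := by
    refine ContDiffOn.prodMk (ContDiffOn.log (by fun_prop) fun p hp => ?_) (by fun_prop)
    have : -1 < p.1 := hp
    linarith
  refine ((contDiff_parametric_primitive hf).comp_contDiffOn hlog).congr fun p hp => ?_
  have hp' : 0 < 1 + p.1 := by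
    have : -1 < p.1 := hp
    linarith
  refine intervalIntegral.integral_congr fun u _ => ?_
  have : Real.sin u ^ 2 + (1 + p.1) * Real.cos u ^ 2 = 1 + p.1 * Real.cos u ^ 2 := by
    linarith [Real.sin_sq_add_cos_sq u]
  simp only [defectDensity, Real.exp_log hp', this]

theorem isOpen_neg_one_lt_fst : IsOpen {p : ℝ × ℝ | -1 < p.1} :=
  isOpen_lt continuous_const continuous_fst

theorem contDiffAt_timeDefect {κ : ℝ} (hκ : -1 < κ) (ψ : ℝ) :
    ContDiffAt ℝ ∞ (fun p : ℝ × ℝ => timeDefect p.1 p.2) (κ, ψ) :=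
  contDiffOn_timeDefect.contDiffAt (isOpen_neg_one_lt_fst.mem_nhds hκ)

theorem contDiffOn_angleTime :
    ContDiffOn ℝ ∞ (fun p : ℝ × ℝ => angleTime p.1 p.2) {p | -1 < p.1} :=
  contDiffOn_snd.add (contDiffOn_fst.mul contDiffOn_timeDefect)

theorem continuous_defectDensity {κ : ℝ} (hκ : -1 < κ) : Continuous (defectDensity κ) := by
  unfold defectDensity
  refine Continuous.div (by fun_prop) (by fun_prop) fun u => ?_
  have := Real.sqrt_pos.2 (one_add_mul_cos_sq_pos hκ u)
  positivity

theorem hasDerivAt_angleTime {κ : ℝ} (hκ : -1 < κ) (ψ : ℝ) :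
    HasDerivAt (angleTime κ) (1 / √(1 + κ * Real.cos ψ ^ 2)) ψ := by
  have h1 : HasDerivAt (timeDefect κ) (defectDensity κ ψ) ψ :=
    intervalIntegral.integral_hasDerivAt_right
      ((continuous_defectDensity hκ).intervalIntegrable _ _)
      ((continuous_defectDensity hκ).stronglyMeasurableAtFilter _ _)
      (continuous_defectDensity hκ).continuousAt
  have h2 := (hasDerivAt_id ψ).add (h1.const_mul κ)
  refine HasDerivAt.congr_deriv (f := angleTime κ) h2 ?_
  have hp := one_add_mul_cos_sq_pos hκ ψ
  have hs := Real.sqrt_pos.2 hp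
  have hq := Real.sq_sqrt hp.le
  simp only [defectDensity]
  field_simp
  linear_combination hq

theorem angleTime_zero (κ : ℝ) : angleTime κ 0 = 0 := by simp [angleTime, timeDefect]

theorem contDiff_angleTime {κ : ℝ} (hκ : -1 < κ) : ContDiff ℝ ∞ (angleTime κ) :=
  contDiffOn_univ.1 (contDiffOn_angleTime.comp
    (contDiff_prodMk_right κ).contDiffOn fun _ _ => hκ)

theorem strictMono_angleTime {κ : ℝ} (hκ : -1 < κ) : StrictMono (angleTime κ) :=
  strictMono_of_hasDerivAt_pos (hasDerivAt_angleTime hκ) fun ψ => by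
    have := Real.sqrt_pos.2 (one_add_mul_cos_sq_pos hκ ψ)
    positivity

theorem timeDefect_neg (κ ψ : ℝ) : timeDefect κ (-ψ) = -timeDefect κ ψ := by
  have h := intervalIntegral.integral_comp_neg (a := 0) (b := ψ) (defectDensity κ)
  have h2 : ∀ u, defectDensity κ (-u) = defectDensity κ u := fun u => by
    simp [defectDensity]
  simp only [h2, neg_zero] at h
  rw [timeDefect, timeDefect, h, intervalIntegral.integral_symm]

theorem angleTime_neg (κ ψ : ℝ) : angleTime κ (-ψ) = -angleTime κ ψ := by
  rw [angleTime, angleTime, timeDefect_neg]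
  ring

theorem abs_angleTime {κ : ℝ} (hκ : -1 < κ) (ψ : ℝ) : |angleTime κ ψ| = angleTime κ |ψ| := by
  rcases le_total 0 ψ with h | h
  · rw [abs_of_nonneg h, abs_of_nonneg]
    rw [← angleTime_zero κ]
    exact (strictMono_angleTime hκ).monotone h
  · rw [abs_of_nonpos h, abs_of_nonpos, angleTime_neg]
    rw [← angleTime_zero κ]
    exact (strictMono_angleTime hκ).monotone h

theorem abs_defectDensity_le {κ : ℝ} (hκ : 0 ≤ κ) (u : ℝ) : |defectDensity κ u| ≤ 1 := by
  have h1 : 1 ≤ √(1 + κ * Real.cos u ^ 2) := by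
    rw [Real.one_le_sqrt]
    nlinarith [mul_nonneg hκ (sq_nonneg (Real.cos u))]
  rw [defectDensity, abs_div, abs_neg, abs_of_nonneg (sq_nonneg _),
    abs_of_pos (by positivity), div_le_one (by positivity)]
  nlinarith [Real.cos_sq_le_one u]

theorem defectDensity_nonpos (κ u : ℝ) : defectDensity κ u ≤ 0 := by
  rw [defectDensity, neg_div]
  have : 0 ≤ Real.cos u ^ 2 / (√(1 + κ * Real.cos u ^ 2) * (1 + √(1 + κ * Real.cos u ^ 2))) := by
    positivity
  linarith

theorem abs_timeDefect_le {κ : ℝ} (hκ : 0 ≤ κ) (ψ : ℝ) : |timeDefect κ ψ| ≤ |ψ| := by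
  have := intervalIntegral.norm_integral_le_of_norm_le_const (a := 0) (b := ψ) (C := 1)
    (f := defectDensity κ) fun u _ => abs_defectDensity_le hκ u
  simpa [timeDefect] using this

/-- This keeps every dilated catenoid inside the slab $|t|<\pi/2$. -/
theorem angleTime_le_self {κ ψ : ℝ} (hκ : 0 ≤ κ) (hψ : 0 ≤ ψ) : angleTime κ ψ ≤ ψ := by
  have : timeDefect κ ψ ≤ 0 := by
    have := intervalIntegral.integral_nonneg (μ := MeasureTheory.volume) hψ
      (f := fun u => -defectDensity κ u) fun u _ => neg_nonneg.2 (defectDensity_nonpos κ u)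
    rw [intervalIntegral.integral_neg] at this
    rw [timeDefect]
    linarith
  rw [angleTime]
  nlinarith

/-- The first-order change of the height at a fixed angle; the terms $\arccos y$ and $t\sin t$ of
the Jacobi fields come from here. -/
theorem timeDefect_zero_left (ψ : ℝ) :
    timeDefect 0 ψ = -(ψ + Real.sin ψ * Real.cos ψ) / 4 := by
  have h : defectDensity 0 = fun u => -(1 / 2) * Real.cos u ^ 2 := by
    funext u
    simp [defectDensity]
    ring
  rw [timeDefect, h, intervalIntegral.integral_const_mul, integral_cos_sq]
  simp
  ring

theorem angleTime_zero_left (ψ : ℝ) : angleTime 0 ψ = ψ := by simp [angleTime]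

/-- The derivative is at least $1/\sqrt{1+\kappa}$, so the function grows at least linearly; oddness
handles $-\infty$. -/
theorem surjective_angleTime {κ : ℝ} (hκ : 0 ≤ κ) : Function.Surjective (angleTime κ) := by
  have hb : ∀ ψ, 0 ≤ ψ → (1 / √(1 + κ)) * ψ ≤ angleTime κ ψ := by
    intro ψ hψ
    have hd : ∀ x, HasDerivAt (fun ψ => angleTime κ ψ - (1 / √(1 + κ)) * ψ)
        (1 / √(1 + κ * Real.cos x ^ 2) - (1 / √(1 + κ)) * 1) x := fun x =>
      (hasDerivAt_angleTime (by linarith) x).sub ((hasDerivAt_id x).const_mul _)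
    have hm : MonotoneOn (fun ψ => angleTime κ ψ - (1 / √(1 + κ)) * ψ) (Set.univ) := by
      refine Monotone.monotoneOn (monotone_of_deriv_nonneg ?_ ?_) _
      · exact fun x => (hd x).differentiableAt
      · intro x
        rw [(hd x).deriv, mul_one, sub_nonneg]
        have hp := one_add_mul_cos_sq_pos (κ := κ) (by linarith) x
        refine one_div_le_one_div_of_le (Real.sqrt_pos.2 hp) (Real.sqrt_le_sqrt ?_)
        nlinarith [Real.cos_sq_le_one x]
    have := hm (Set.mem_univ 0) (Set.mem_univ ψ) hψ
    simp only [angleTime_zero, mul_zero, sub_zero] at this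
    linarith
  have hc : 0 < 1 / √(1 + κ) := by
    have : 0 < √(1 + κ) := Real.sqrt_pos.2 (by linarith)
    positivity
  have htop : Tendsto (angleTime κ) atTop atTop := by
    refine tendsto_atTop_mono' _ ?_ (tendsto_id.const_mul_atTop hc)
    filter_upwards [eventually_ge_atTop 0] with ψ hψ using hb ψ hψ
  have hbot : Tendsto (angleTime κ) atBot atBot := by
    have h := tendsto_neg_atTop_atBot.comp (htop.comp tendsto_neg_atBot_atTop)
    refine h.congr fun ψ => ?_
    simp [angleTime_neg]
  exact (contDiff_angleTime (by linarith)).continuous.surjective htop hbot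

end

/-! ### The profile of the catenoid -/

noncomputable section

/-- The radius in the Poincaré disk of the catenoid at the angle `ψ`. -/
def angleRadius (κ ψ : ℝ) : ℝ := √(1 + κ * Real.cos ψ ^ 2) - √κ * Real.cos ψ

theorem angleRadius_pos {κ : ℝ} (hκ : 0 < κ) (ψ : ℝ) : 0 < angleRadius κ ψ := by
  refine sub_pos.2 (Real.lt_sqrt_of_sq_lt ?_)
  rw [mul_pow, Real.sq_sqrt hκ.le]
  linarith

/-- For $r=e^{-s}$, this and the next identity say $\sinh s=\sqrt\kappa\cos\psi$ and $\cosh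
s=\sqrt{1+\kappa\cos^2\psi}$. Most later computations with the radius use only these two. -/
theorem one_sub_angleRadius_sq {κ : ℝ} (hκ : 0 < κ) (ψ : ℝ) :
    1 - angleRadius κ ψ ^ 2 = 2 * angleRadius κ ψ * (√κ * Real.cos ψ) := by
  have h1 := Real.sq_sqrt (one_add_mul_cos_sq_pos (κ := κ) (by linarith) ψ).le
  have h2 := Real.sq_sqrt hκ.le
  simp only [angleRadius]
  linear_combination Real.cos ψ ^ 2 * h2 - h1

theorem one_add_angleRadius_sq {κ : ℝ} (hκ : 0 < κ) (ψ : ℝ) :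
    1 + angleRadius κ ψ ^ 2 = 2 * angleRadius κ ψ * √(1 + κ * Real.cos ψ ^ 2) := by
  have h1 := Real.sq_sqrt (one_add_mul_cos_sq_pos (κ := κ) (by linarith) ψ).le
  have h2 := Real.sq_sqrt hκ.le
  simp only [angleRadius]
  linear_combination Real.cos ψ ^ 2 * h2 - h1

theorem angleRadius_zero {κ : ℝ} : angleRadius κ 0 = neckRadius κ := by
  simp [angleRadius, neckRadius, add_comm]

theorem neckRadius_pos {κ : ℝ} (hκ : 0 < κ) : 0 < neckRadius κ :=
  angleRadius_zero ▸ angleRadius_pos hκ 0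

theorem hasDerivAt_angleRadius {κ : ℝ} (hκ : 0 < κ) (ψ : ℝ) :
    HasDerivAt (angleRadius κ)
      (√κ * Real.sin ψ * angleRadius κ ψ / √(1 + κ * Real.cos ψ ^ 2)) ψ := by
  have hp := one_add_mul_cos_sq_pos (κ := κ) (by linarith) ψ
  have hs := Real.sqrt_pos.2 hp
  have h1 := ((((Real.hasDerivAt_cos ψ).pow 2).const_mul κ).const_add 1).sqrt hp.ne'
  have h2 := h1.sub ((Real.hasDerivAt_cos ψ).const_mul √κ)
  refine HasDerivAt.congr_deriv (f := angleRadius κ) h2 ?_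
  have h3 := Real.sq_sqrt hκ.le
  simp only [angleRadius, Pi.pow_apply]
  field_simp
  simp only [Nat.cast_ofNat, Nat.add_one_sub_one, pow_one]
  linear_combination 2 * Real.cos ψ * Real.sin ψ * h3

/-- The angle as a function of the height: the inverse of `angleTime κ`. -/
theorem exists_angle {κ : ℝ} (hκ : 0 < κ) :
    ∃ ψ : ℝ → ℝ, ContDiff ℝ ∞ ψ ∧ (∀ t, angleTime κ (ψ t) = t) ∧
      ∀ t, HasDerivAt ψ √(1 + κ * Real.cos (ψ t) ^ 2) t := by
  have hκ' : -1 < κ := by linarith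
  let e : ℝ ≃ₜ ℝ := ((strictMono_angleTime hκ').orderIsoOfSurjective _
    (surjective_angleTime hκ.le)).toHomeomorph
  have he : ∀ t, angleTime κ (e.symm t) = t := fun t => e.apply_symm_apply t
  refine ⟨e.symm, ?_, he, fun t => ?_⟩
  · refine e.contDiff_symm_deriv (f' := fun ψ => 1 / √(1 + κ * Real.cos ψ ^ 2)) (fun ψ => ?_)
      (hasDerivAt_angleTime hκ') (contDiff_angleTime hκ')
    have := Real.sqrt_pos.2 (one_add_mul_cos_sq_pos hκ' ψ)
    positivity
  · have hs := Real.sqrt_pos.2 (one_add_mul_cos_sq_pos hκ' (e.symm t))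
    have := HasDerivAt.of_local_left_inverse (g := e.symm) e.symm.continuous.continuousAt
      (hasDerivAt_angleTime hκ' (e.symm t)) (by positivity) (Eventually.of_forall he)
    simpa using this

theorem abs_angleTime_lt_iff {κ : ℝ} (hκ : 0 < κ) {ψ φ : ℝ} :
    |angleTime κ ψ| < angleTime κ φ ↔ |ψ| < φ := by
  rw [abs_angleTime (by linarith), (strictMono_angleTime (by linarith)).lt_iff_lt]

/-- Along the inverse of `angleTime κ` the radius satisfies $r'=\sqrt\kappa\,\sin\psi\;r$, so the
first integral is $\kappa\cos^2\psi+\kappa\sin^2\psi=\kappa$. -/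
theorem exists_isCatenoidProfile {κ : ℝ} (hκ : 0 < κ) :
    ∃ r, IsCatenoidProfile κ (2 * angleTime κ (Real.pi / 2)) r ∧
      ∀ ψ, r (angleTime κ ψ) = angleRadius κ ψ := by
  obtain ⟨ψ, hsm, hT, hd⟩ := exists_angle hκ
  have hκ' : -1 < κ := by linarith
  have hinj : ∀ φ, ψ (angleTime κ φ) = φ := fun φ =>
    (strictMono_angleTime hκ').injective (hT _)
  have hr : ∀ t, HasDerivAt (fun t => angleRadius κ (ψ t))
      (√κ * Real.sin (ψ t) * angleRadius κ (ψ t)) t := by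
    intro t
    have hs := Real.sqrt_pos.2 (one_add_mul_cos_sq_pos hκ' (ψ t))
    refine ((hasDerivAt_angleRadius hκ (ψ t)).comp t (hd t)).congr_deriv ?_
    field_simp
  have hr1 : deriv (fun t => angleRadius κ (ψ t)) =
      fun t => √κ * Real.sin (ψ t) * angleRadius κ (ψ t) := funext fun t => (hr t).deriv
  have hr2 : ∀ t, deriv (deriv fun t => angleRadius κ (ψ t)) t =
      √κ * (Real.cos (ψ t) * √(1 + κ * Real.cos (ψ t) ^ 2)) * angleRadius κ (ψ t) +
        √κ * Real.sin (ψ t) * (√κ * Real.sin (ψ t) * angleRadius κ (ψ t)) := by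
    intro t
    rw [hr1]
    exact ((((hd t).sin).const_mul √κ).mul (hr t)).deriv
  have hH : 0 < angleTime κ (Real.pi / 2) := by
    rw [← angleTime_zero κ]
    exact strictMono_angleTime hκ' (by positivity)
  refine ⟨fun t => angleRadius κ (ψ t), ⟨by positivity, ?_, ?_, ?_, ?_, ?_, ?_, ?_, ?_⟩, ?_⟩
  · unfold angleRadius
    refine ContDiff.sub (ContDiff.sqrt ?_ fun t => (one_add_mul_cos_sq_pos hκ' (ψ t)).ne') ?_
    · exact contDiff_const.add (contDiff_const.mul (hsm.cos.pow 2))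
    · exact contDiff_const.mul hsm.cos
  · exact fun t => angleRadius_pos hκ _
  · intro t
    have hρ := angleRadius_pos hκ (ψ t)
    rw [hr1, one_sub_angleRadius_sq hκ]
    field_simp
    rw [Real.sq_sqrt hκ.le]
    linear_combination (-4 * κ) * Real.sin_sq_add_cos_sq (ψ t)
  · intro t
    have h1 := one_sub_angleRadius_sq hκ (ψ t)
    have h2 := one_add_angleRadius_sq hκ (ψ t)
    rw [hr2, hr1]
    linear_combination (-1 - angleRadius κ (ψ t) ^ 2) * h1 -
      (2 * angleRadius κ (ψ t) * (√κ * Real.cos (ψ t))) * h2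
  · have : ψ 0 = 0 := by simpa [angleTime_zero] using hinj 0
    simp only [this, angleRadius_zero]
  · intro t ht
    have ht' : |ψ t| < Real.pi / 2 := by
      rw [← abs_angleTime_lt_iff hκ, hT]
      linarith
    have hc : 0 < Real.cos (ψ t) := Real.cos_pos_of_mem_Ioo (abs_lt.1 ht')
    have h1 := one_sub_angleRadius_sq hκ (ψ t)
    have hρ := angleRadius_pos hκ (ψ t)
    have : 0 < 2 * angleRadius κ (ψ t) * (√κ * Real.cos (ψ t)) := by positivity
    show angleRadius κ (ψ t) < 1
    nlinarith
  · have : 2 * angleTime κ (Real.pi / 2) / 2 = angleTime κ (Real.pi / 2) := by ring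
    simp [this, hinj, angleRadius]
  · have : -(2 * angleTime κ (Real.pi / 2) / 2) = angleTime κ (-(Real.pi / 2)) := by
      rw [angleTime_neg]
      ring
    simp only [this, hinj]
    simp [angleRadius]
  · intro φ
    simp only [hinj]

/-- Uniqueness of the profile. With $a=(1-r^2)/(2r\sqrt\kappa)$, $b=-r'/(r\sqrt\kappa)$ and
$w=(1+r^2)/(2r)$, the second-order equation becomes the rotation $a'=wb$, $b'=-wa$. Hence
$(a,b)=(\cos\psi,-\sin\psi)$ with $\psi=\int_0 w$, and $w^2=1+\kappa a^2$ shows that $\psi$ inverts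
`angleTime κ`. -/
theorem IsCatenoidProfile.eq_angleRadius {κ h : ℝ} {r : ℝ → ℝ} (hκ : 0 < κ)
    (H : IsCatenoidProfile κ h r) (ψ₀ : ℝ) : r (angleTime κ ψ₀) = angleRadius κ ψ₀ := by
  have hκ' : -1 < κ := by linarith
  have hk : 0 < √κ := Real.sqrt_pos.2 hκ
  have hk2 := Real.sq_sqrt hκ.le
  have hrd : ∀ t, HasDerivAt r (deriv r t) t := fun t =>
    (H.smooth.differentiable (by simp)).differentiableAt.hasDerivAt
  have hrdd : ∀ t, HasDerivAt (deriv r) (deriv (deriv r) t) t := fun t =>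
    ((contDiff_infty_iff_deriv.1 H.smooth).2.differentiable (by simp)).differentiableAt.hasDerivAt
  set w : ℝ → ℝ := fun t => (1 + r t ^ 2) / (2 * r t) with hw
  set a : ℝ → ℝ := fun t => (1 - r t ^ 2) / (2 * r t) / √κ with ha
  set b : ℝ → ℝ := fun t => -(deriv r t / r t) / √κ with hb
  have hrne : ∀ t, r t ≠ 0 := fun t => (H.pos t).ne'
  have hwc : Continuous w := by
    have := H.smooth.continuous
    refine Continuous.div (by fun_prop) (by fun_prop) fun t => ?_
    simpa using hrne t
  have ha' : ∀ t, HasDerivAt a (w t * b t) t := by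
    intro t
    have h1 := ((((hrd t).pow 2).const_sub 1).div ((hrd t).const_mul 2)
      (by simpa using hrne t)).div_const √κ
    refine HasDerivAt.congr_deriv (f := a) h1 ?_
    have := hrne t
    simp only [hw, hb]
    simp
    field_simp
    ring
  have hb' : ∀ t, HasDerivAt b (-(w t * a t)) t := by
    intro t
    have h1 := (((hrdd t).div (hrd t) (hrne t)).neg).div_const √κ
    refine HasDerivAt.congr_deriv (f := b) h1 ?_
    have := hrne t
    simp only [hw, ha]
    field_simp
    linear_combination (-1) * H.ode t
  let ψ : ℝ → ℝ := fun t => ∫ u in (0 : ℝ)..t, w u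
  have hψ : ∀ t, HasDerivAt ψ (w t) t := fun t =>
    intervalIntegral.integral_hasDerivAt_right (hwc.intervalIntegrable _ _)
      (hwc.stronglyMeasurableAtFilter _ _) hwc.continuousAt
  have hψ0 : ψ 0 = 0 := intervalIntegral.integral_same
  have hr0 : 0 < neckRadius κ := H.neck ▸ H.pos 0
  have hr0' : 1 - neckRadius κ ^ 2 = 2 * neckRadius κ * √κ := by
    have := one_sub_angleRadius_sq hκ 0
    rwa [angleRadius_zero, Real.cos_zero, mul_one] at this
  have ha0 : a 0 = 1 := by
    simp only [ha, H.neck, hr0']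
    field_simp
  -- At the neck the first term of the first integral already equals $\kappa$, which forces
  -- $r'(0)=0$. The first integral is needed only here.
  have hb0 : b 0 = 0 := by
    have h1 := H.first_integral 0
    rw [H.neck, hr0'] at h1
    have h2 : (deriv r 0 / neckRadius κ) ^ 2 = 0 := by
      have : (2 * neckRadius κ * √κ) ^ 2 / (4 * neckRadius κ ^ 2) = κ := by
        rw [mul_pow, hk2]
        field_simp
        norm_num
      linarith
    have h3 : deriv r 0 / neckRadius κ = 0 := by simpa using h2
    simp only [hb, H.neck, h3]
    simp
  have hC : ∀ t, a t * Real.cos (ψ t) - b t * Real.sin (ψ t) = 1 := by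
    intro t
    have hd : ∀ t, HasDerivAt (fun t => a t * Real.cos (ψ t) - b t * Real.sin (ψ t)) 0 t := by
      intro t
      refine (((ha' t).mul (hψ t).cos).sub ((hb' t).mul (hψ t).sin)).congr_deriv ?_
      ring
    have := is_const_of_deriv_eq_zero (fun t => (hd t).differentiableAt)
      (fun t => (hd t).deriv) t 0
    simpa [hψ0, ha0, hb0] using this
  have hS : ∀ t, a t * Real.sin (ψ t) + b t * Real.cos (ψ t) = 0 := by
    intro t
    have hd : ∀ t, HasDerivAt (fun t => a t * Real.sin (ψ t) + b t * Real.cos (ψ t)) 0 t := by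
      intro t
      refine (((ha' t).mul (hψ t).sin).add ((hb' t).mul (hψ t).cos)).congr_deriv ?_
      ring
    have := is_const_of_deriv_eq_zero (fun t => (hd t).differentiableAt)
      (fun t => (hd t).deriv) t 0
    simpa [hψ0, ha0, hb0] using this
  have hacos : ∀ t, a t = Real.cos (ψ t) := fun t => by
    linear_combination (-a t) * Real.sin_sq_add_cos_sq (ψ t) + Real.cos (ψ t) * hC t +
      Real.sin (ψ t) * hS t
  have hsq : ∀ t, w t = √(1 + κ * Real.cos (ψ t) ^ 2) := by
    intro t
    have hp := H.pos t
    have hwp : 0 < w t := by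
      simp only [hw]
      positivity
    rw [eq_comm, Real.sqrt_eq_iff_mul_self_eq (one_add_mul_cos_sq_pos hκ' _).le hwp.le, ← hacos]
    simp only [hw, ha]
    field_simp
    rw [hk2]
    ring
  have hT : ∀ t, angleTime κ (ψ t) = t := by
    intro t
    have hd : ∀ t, HasDerivAt (fun t => angleTime κ (ψ t) - t) 0 t := by
      intro t
      refine (((hasDerivAt_angleTime hκ' (ψ t)).comp t (hψ t)).sub (hasDerivAt_id t)).congr_deriv ?_
      have := Real.sqrt_pos.2 (one_add_mul_cos_sq_pos hκ' (ψ t))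
      rw [hsq]
      field_simp
      simp
    have := is_const_of_deriv_eq_zero (fun t => (hd t).differentiableAt)
      (fun t => (hd t).deriv) t 0
    simp only [hψ0, angleTime_zero] at this
    linarith
  have hψT : ψ (angleTime κ ψ₀) = ψ₀ := (strictMono_angleTime hκ').injective (hT _)
  have h1 := hacos (angleTime κ ψ₀)
  have h2 := hsq (angleTime κ ψ₀)
  rw [hψT] at h1 h2
  have hp := H.pos (angleTime κ ψ₀)
  rw [angleRadius, ← h2, ← h1]
  simp only [hw, ha]
  field_simp
  ring

/-- The radius first reaches $1$ at $\psi=\pi/2$. A smaller end angle would contradict `top`, a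
larger one `lt_one`. -/
theorem IsCatenoidProfile.height_eq {κ h : ℝ} {r : ℝ → ℝ} (hκ : 0 < κ)
    (H : IsCatenoidProfile κ h r) : h / 2 = angleTime κ (Real.pi / 2) := by
  have hκ' : -1 < κ := by linarith
  have hhalf := H.height_pos
  obtain ⟨φ, hφ⟩ := surjective_angleTime hκ.le (h / 2)
  rcases lt_trichotomy φ (Real.pi / 2) with h1 | h1 | h1
  · exfalso
    have hφ0 : 0 < φ := by
      rw [← (strictMono_angleTime hκ').lt_iff_lt, angleTime_zero, hφ]
      positivity
    have hc : 0 < Real.cos φ := Real.cos_pos_of_mem_Ioo ⟨by linarith, h1⟩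
    have h2 := H.top
    rw [← hφ, H.eq_angleRadius hκ] at h2
    have h3 := one_sub_angleRadius_sq hκ φ
    have hk : 0 < √κ := Real.sqrt_pos.2 hκ
    rw [h2] at h3
    have : 0 < √κ * Real.cos φ := by positivity
    linarith
  · rw [← hφ, h1]
  · exfalso
    have h2 := H.lt_one (angleTime κ (Real.pi / 2)) (by
      rw [← hφ, abs_angleTime_lt_iff hκ, abs_of_pos (by positivity)]
      exact h1)
    rw [H.eq_angleRadius hκ] at h2
    simp [angleRadius] at h2

theorem mem_catenoid_iff {κ : ℝ} (hκ : 0 < κ) (p : ℂ × ℝ) :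
    p ∈ catenoid κ ↔ ∃ ψ, |ψ| < Real.pi / 2 ∧ ‖p.1‖ = angleRadius κ ψ ∧ p.2 = angleTime κ ψ := by
  have hk : 0 < √κ := Real.sqrt_pos.2 hκ
  constructor
  · rintro ⟨h, r, H, θ, t, ht, rfl⟩
    obtain ⟨ψ, rfl⟩ := surjective_angleTime hκ.le t
    refine ⟨ψ, ?_, ?_, rfl⟩
    · rwa [H.height_eq hκ, abs_angleTime_lt_iff hκ] at ht
    · have : Complex.I * (√κ : ℝ) * θ = ((√κ * θ : ℝ) : ℂ) * Complex.I := by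
        push_cast
        ring
      rw [norm_mul, this, Complex.norm_exp_ofReal_mul_I, mul_one, Complex.norm_real,
        Real.norm_of_nonneg (H.pos _).le, H.eq_angleRadius hκ]
  · rintro ⟨ψ, hψ, h1, h2⟩
    obtain ⟨r, H, hr⟩ := exists_isCatenoidProfile hκ
    refine ⟨_, r, H, Complex.arg p.1 / √κ, angleTime κ ψ, ?_, ?_⟩
    · rw [mul_div_cancel_left₀ _ two_ne_zero]
      exact (abs_angleTime_lt_iff hκ).2 hψ
    · refine Prod.ext ?_ h2
      have hk' : ((√κ : ℝ) : ℂ) ≠ 0 := by exact_mod_cast hk.ne'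
      have : Complex.I * (√κ : ℝ) * ((Complex.arg p.1 / √κ : ℝ) : ℂ) =
          Complex.arg p.1 * Complex.I := by
        push_cast
        field_simp
      simp only [this, hr, ← h1]
      exact (Complex.norm_mul_exp_arg_mul_I p.1).symm

end

/-! ### The dilated catenoid in the half-plane model -/

noncomputable section

/-- The square `μ₀²` of the neck height, as a function smooth across `κ = 0`. -/
def neckHeightSq (κ : ℝ) : ℝ := κ / (1 + √(1 + κ)) ^ 2

theorem neckHeight_eq {κ : ℝ} (hκ : 0 < κ) : neckHeight κ = √κ / (1 + √(1 + κ)) := by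
  have h1 : neckHeight κ = (1 - neckRadius κ) / (1 + neckRadius κ) := by
    have : -Complex.I * cayley (neckRadius κ : ℂ) =
        (((1 - neckRadius κ) / (1 + neckRadius κ) : ℝ) : ℂ) := by
      rw [cayley, ← mul_assoc, neg_mul, Complex.I_mul_I]
      push_cast
      ring
    rw [neckHeight, this, Complex.ofReal_re]
  have h2 := neckRadius_pos hκ
  have h3 : 1 + neckRadius κ ≠ 0 := by positivity
  have h4 : 1 + √(1 + κ) ≠ 0 := by positivity
  have h5 := Real.sq_sqrt hκ.le
  have h6 := Real.sq_sqrt (show 0 ≤ κ + 1 by linarith)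
  rw [h1, div_eq_div_iff h3 h4, neckRadius, add_comm 1 κ]
  linear_combination h5 - h6

theorem neckHeight_pos {κ : ℝ} (hκ : 0 < κ) : 0 < neckHeight κ := by
  rw [neckHeight_eq hκ]
  have := Real.sqrt_pos.2 hκ
  positivity

theorem neckHeight_sq {κ : ℝ} (hκ : 0 < κ) : neckHeight κ ^ 2 = neckHeightSq κ := by
  rw [neckHeight_eq hκ, div_pow, Real.sq_sqrt hκ.le, neckHeightSq]

theorem one_sub_neckHeightSq {κ : ℝ} (hκ : -1 < κ) : 1 - neckHeightSq κ = 2 / (1 + √(1 + κ)) := by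
  have h4 : 1 + √(1 + κ) ≠ 0 := by positivity
  have h6 := Real.sq_sqrt (show 0 ≤ 1 + κ by linarith)
  rw [neckHeightSq]
  field_simp
  linear_combination h6

theorem neckHeightSq_lt_one {κ : ℝ} (hκ : -1 < κ) : neckHeightSq κ < 1 := by
  have h := one_sub_neckHeightSq hκ
  have : 0 < 2 / (1 + √(1 + κ)) := by positivity
  linarith

/-- This relation between $\kappa$ and $m$ is what collapses the discriminants and squared equations
below. -/
theorem mul_one_sub_neckHeightSq_sq {κ : ℝ} (hκ : -1 < κ) :
    κ * (1 - neckHeightSq κ) ^ 2 = 4 * neckHeightSq κ := by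
  rw [one_sub_neckHeightSq hκ, neckHeightSq]
  field_simp
  norm_num

theorem two_mul_neckHeight {κ : ℝ} (hκ : 0 < κ) :
    2 * neckHeight κ = √κ * (1 - neckHeightSq κ) := by
  rw [one_sub_neckHeightSq (by linarith), neckHeight_eq hκ]
  ring

theorem neckHeightSq_pos {κ : ℝ} (hκ : 0 < κ) : 0 < neckHeightSq κ := by
  rw [neckHeightSq]
  positivity

/-! ### The Cayley transform and circles about the origin of the disk. -/

theorem one_add_ne_zero_of_norm_lt_one {z : ℂ} (hz : ‖z‖ < 1) : 1 + z ≠ 0 := by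
  intro h
  rw [eq_neg_of_add_eq_zero_right h] at hz
  simp at hz

theorem I_add_ne_zero_of_im_pos {w : ℂ} (hw : 0 < w.im) : Complex.I + w ≠ 0 := by
  intro h
  have := congrArg Complex.im h
  simp at this
  linarith

theorem cayleyInv_cayley {z : ℂ} (hz : ‖z‖ < 1) : cayleyInv (cayley z) = z := by
  have h1 := one_add_ne_zero_of_norm_lt_one hz
  have hI := Complex.I_ne_zero
  have h2 : Complex.I + cayley z = Complex.I * 2 / (1 + z) := by
    rw [cayley]
    field_simp
    ring
  have h3 : Complex.I - cayley z = Complex.I * (2 * z) / (1 + z) := by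
    rw [cayley]
    field_simp
    ring
  rw [cayleyInv, h2, h3]
  field_simp

theorem cayley_cayleyInv {w : ℂ} (hw : 0 < w.im) : cayley (cayleyInv w) = w := by
  have h1 := I_add_ne_zero_of_im_pos hw
  have hI := Complex.I_ne_zero
  have h2 : 1 + cayleyInv w = Complex.I * 2 / (Complex.I + w) := by
    rw [cayleyInv]
    field_simp
    ring
  have h3 : 1 - cayleyInv w = 2 * w / (Complex.I + w) := by
    rw [cayleyInv]
    field_simp
    ring
  rw [cayley, h2, h3]
  field_simp

theorem im_cayley_pos {z : ℂ} (hz : ‖z‖ < 1) : 0 < (cayley z).im := by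
  have h1 := one_add_ne_zero_of_norm_lt_one hz
  have h2 : 0 < Complex.normSq (1 + z) := Complex.normSq_pos.2 h1
  have h3 : Complex.normSq z < 1 := by
    rw [Complex.normSq_eq_norm_sq]
    nlinarith [norm_nonneg z]
  have : (cayley z).im = (1 - Complex.normSq z) / Complex.normSq (1 + z) := by
    rw [cayley, Complex.I_mul_im, Complex.div_re, ← add_div]
    congr 1
    simp [Complex.normSq_apply]
    ring
  rw [this]
  exact div_pos (by linarith) h2

theorem norm_cayleyInv_sq (w : ℂ) : ‖cayleyInv w‖ ^ 2 =
    (1 + Complex.normSq w - 2 * w.im) / (1 + Complex.normSq w + 2 * w.im) := by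
  rw [← Complex.normSq_eq_norm_sq, cayleyInv, Complex.normSq_div]
  congr 1 <;> simp [Complex.normSq_apply] <;> ring

theorem two_mul_im_le_one_add_normSq (w : ℂ) : 2 * w.im ≤ 1 + Complex.normSq w := by
  rw [Complex.normSq_apply]
  nlinarith [sq_nonneg (w.im - 1), sq_nonneg w.re]

theorem norm_cayleyInv_lt_one {w : ℂ} (hw : 0 < w.im) : ‖cayleyInv w‖ < 1 := by
  have h := two_mul_im_le_one_add_normSq w
  have h1 : ‖cayleyInv w‖ ^ 2 < 1 := by
    rw [norm_cayleyInv_sq, div_lt_one (by linarith)]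
    linarith
  nlinarith [norm_nonneg (cayleyInv w)]

/-- Two radii agree exactly when their values of $(1-R^2)/(1+R^2)$ do. This quotient is
$2\operatorname{Im}w/(1+|w|^2)$ on one side and $\sqrt\kappa\cos\psi/\sqrt{1+\kappa\cos^2\psi}$ on
the other. -/
theorem norm_cayleyInv_eq_angleRadius_iff {κ ψ : ℝ} (hκ : 0 < κ) {w : ℂ}
    (hw : 0 < w.im) : ‖cayleyInv w‖ = angleRadius κ ψ ↔
      √κ * Real.cos ψ * (1 + Complex.normSq w) = 2 * √(1 + κ * Real.cos ψ ^ 2) * w.im := by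
  have hρ := angleRadius_pos hκ ψ
  have h1 := one_sub_angleRadius_sq hκ ψ
  have h2 := one_add_angleRadius_sq hκ ψ
  have h3 := norm_cayleyInv_sq w
  have h := two_mul_im_le_one_add_normSq w
  have hN : 0 < 1 + Complex.normSq w + 2 * w.im := by linarith
  rw [← sq_eq_sq₀ (norm_nonneg _) hρ.le, h3, div_eq_iff hN.ne']
  set k := √κ * Real.cos ψ
  set s := √(1 + κ * Real.cos ψ ^ 2)
  set N := Complex.normSq w
  constructor
  · intro h4
    have : 2 * angleRadius κ ψ * (k * (1 + N) - 2 * s * w.im) = 0 := by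
      linear_combination h4 - (1 + N) * h1 + 2 * w.im * h2
    rcases mul_eq_zero.1 this with h5 | h5
    · exact absurd h5 (by positivity)
    · linarith
  · intro h4
    linear_combination (1 + N) * h1 - 2 * w.im * h2 + 2 * angleRadius κ ψ * h4

/-- The central description. Since $2\mu_0=\sqrt\kappa\,(1-m)$, a factor $\sqrt\kappa$ cancels, and
what remains is smooth across $\kappa=0$. -/
theorem mem_dilatedCatenoid_iff {κ : ℝ} (hκ : 0 < κ) (p : ℂ × ℝ) :
    p ∈ dilatedCatenoid κ ↔ 0 < p.1.im ∧ ∃ ψ, |ψ| < Real.pi / 2 ∧ p.2 = angleTime κ ψ ∧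
      Real.cos ψ * (1 + neckHeightSq κ * Complex.normSq p.1) =
        (1 - neckHeightSq κ) * √(1 + κ * Real.cos ψ ^ 2) * p.1.im := by
  have hμ := neckHeight_pos hκ
  have hk : 0 < √κ := Real.sqrt_pos.2 hκ
  have hμ' : ((neckHeight κ : ℝ) : ℂ) ≠ 0 := by exact_mod_cast hμ.ne'
  have key : ∀ z : ℂ, 0 < z.im → ∀ ψ,
      (‖cayleyInv (neckHeight κ * z)‖ = angleRadius κ ψ ↔
        Real.cos ψ * (1 + neckHeightSq κ * Complex.normSq z) =
          (1 - neckHeightSq κ) * √(1 + κ * Real.cos ψ ^ 2) * z.im) := by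
    intro z hz ψ
    rw [norm_cayleyInv_eq_angleRadius_iff hκ (by simpa using mul_pos hμ hz),
      Complex.normSq_mul, Complex.normSq_ofReal, ← sq, neckHeight_sq hκ, Complex.im_ofReal_mul]
    have h2 := two_mul_neckHeight hκ
    constructor
    · intro h
      refine mul_left_cancel₀ hk.ne' ?_
      linear_combination h + √(1 + κ * Real.cos ψ ^ 2) * z.im * h2
    · intro h
      linear_combination √κ * h - √(1 + κ * Real.cos ψ ^ 2) * z.im * h2
  constructor
  · rintro ⟨q, hq, rfl⟩
    obtain ⟨ψ, hψ, h1, h2⟩ := (mem_catenoid_iff hκ q).1 hq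
    have hc : 0 < Real.cos ψ := Real.cos_pos_of_mem_Ioo (abs_lt.1 hψ)
    have hq1 : ‖q.1‖ < 1 := by
      have h3 := one_sub_angleRadius_sq hκ ψ
      have hρ := angleRadius_pos hκ ψ
      have : 0 < 2 * angleRadius κ ψ * (√κ * Real.cos ψ) := by positivity
      rw [h1]
      nlinarith
    have him : 0 < (((neckHeight κ)⁻¹ : ℝ) * cayley q.1 : ℂ).im := by
      rw [Complex.im_ofReal_mul]
      exact mul_pos (inv_pos.2 hμ) (im_cayley_pos hq1)
    refine ⟨him, ψ, hψ, h2, (key _ him ψ).1 ?_⟩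
    rw [← h1, ← mul_assoc]
    push_cast
    rw [mul_inv_cancel₀ hμ', one_mul, cayleyInv_cayley hq1]
  · rintro ⟨him, ψ, hψ, h2, h3⟩
    have him' : 0 < ((neckHeight κ : ℂ) * p.1).im := by
      rw [Complex.im_ofReal_mul]
      exact mul_pos hμ him
    refine ⟨(cayleyInv (neckHeight κ * p.1), p.2), (mem_catenoid_iff hκ _).2
      ⟨ψ, hψ, (key _ him ψ).2 h3, h2⟩, Prod.ext ?_ rfl⟩
    simp only [cayley_cayleyInv him', ← mul_assoc]
    push_cast
    rw [inv_mul_cancel₀ hμ', one_mul]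

/-- The boundary circle of $\Omega_\kappa$ is $|w|^2+1=(\mu_0+\mu_0^{-1})\operatorname{Im}w$; here
$w=\mu_0z$. -/
theorem mem_dilatedDomain_iff {κ : ℝ} (hκ : 0 < κ) (z : ℂ) :
    z ∈ dilatedDomain κ ↔ 0 < z.im ∧
      (1 + neckHeightSq κ) * z.im ≤ 1 + neckHeightSq κ * Complex.normSq z := by
  have hμ := neckHeight_pos hκ
  have hμ' : ((neckHeight κ : ℝ) : ℂ) ≠ 0 := by exact_mod_cast hμ.ne'
  have hm := neckHeight_sq hκ
  have hm1 : neckHeight κ < 1 := by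
    have := neckHeightSq_lt_one (κ := κ) (by linarith)
    nlinarith
  have hR : 0 ≤ ((neckHeight κ)⁻¹ - neckHeight κ) / 2 := by
    have := (one_le_inv₀ hμ).2 hm1.le
    linarith
  have hmem : z ∈ dilatedDomain κ ↔ (neckHeight κ : ℂ) * z ∈ catenoidDomain κ := by
    constructor
    · rintro ⟨w, hw, rfl⟩
      simp only [← mul_assoc]
      push_cast
      rwa [mul_inv_cancel₀ hμ', one_mul]
    · intro h
      refine ⟨_, h, ?_⟩
      simp only [← mul_assoc]
      push_cast
      rw [inv_mul_cancel₀ hμ', one_mul]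
  rw [hmem, catenoidDomain, Set.mem_sdiff, Set.mem_ofPred_eq, Complex.im_ofReal_mul,
    mul_pos_iff_of_pos_left hμ, Metric.mem_ball, not_lt, dist_eq_norm]
  refine and_congr_right fun _ => ?_
  rw [← sq_le_sq₀ hR (norm_nonneg _), ← Complex.normSq_eq_norm_sq, Complex.normSq_apply,
    Complex.normSq_apply, ← hm, ← sub_nonneg]
  conv_rhs => rw [← sub_nonneg]
  have hi := mul_inv_cancel₀ hμ.ne'
  refine iff_of_eq (congrArg (0 ≤ ·) ?_)
  simp
  linear_combination (1 - z.im) * hi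

/-- The cosine of the angle of the dilated catenoid over `z`. -/
def cosAngle (κ : ℝ) (z : ℂ) : ℝ :=
  (1 - neckHeightSq κ) * z.im /
    √((1 + neckHeightSq κ * Complex.normSq z) ^ 2 - 4 * neckHeightSq κ * z.im ^ 2)

/-! ### The height of the dilated catenoid in closed form, and the bigraph. -/

theorem catenoidTime_eq {κ r : ℝ} (hκ : 0 < κ) (hr : neckRadius κ ≤ r) (hr1 : r ≤ 1) :
    catenoidTime κ r = angleTime κ (Real.arccos ((1 - r ^ 2) / (2 * r * √κ))) := by
  have hκ' : -1 < κ := by linarith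
  have hk : 0 < √κ := Real.sqrt_pos.2 hκ
  have hk2 := Real.sq_sqrt hκ.le
  have hr0 := neckRadius_pos hκ
  have hn : 1 - neckRadius κ ^ 2 = 2 * neckRadius κ * √κ := by
    have := one_sub_angleRadius_sq hκ 0
    rwa [angleRadius_zero, Real.cos_zero, mul_one] at this
  set g : ℝ → ℝ := fun u => angleTime κ (Real.arccos ((1 - u ^ 2) / (2 * u * √κ))) with hg
  have hcont : ContinuousOn g (Set.uIcc (neckRadius κ) r) := by
    rw [Set.uIcc_of_le hr]
    refine (contDiff_angleTime hκ').continuous.comp_continuousOn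
      (Real.continuous_arccos.comp_continuousOn ?_)
    refine ContinuousOn.div (by fun_prop) (by fun_prop) fun u hu => ?_
    have : 0 < u := hr0.trans_le hu.1
    positivity
  have hderiv : ∀ u ∈ Set.Ioo (min (neckRadius κ) r) (max (neckRadius κ) r),
      HasDerivAt g (2 / √(4 * κ * u ^ 2 - (1 - u ^ 2) ^ 2)) u := by
    intro u hu
    rw [min_eq_left hr, max_eq_right hr] at hu
    have hu0 : 0 < u := hr0.trans hu.1
    have hu1 : u < 1 := hu.2.trans_le hr1
    have hlt : 1 - u ^ 2 < 2 * u * √κ := by nlinarith [hu.1]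
    have hpos : 0 < 1 - u ^ 2 := by nlinarith
    set X := (1 - u ^ 2) / (2 * u * √κ) with hX
    have hX1 : X < 1 := (div_lt_one (by positivity)).2 hlt
    have hX0 : 0 < X := div_pos hpos (by positivity)
    have hXd : HasDerivAt (fun u : ℝ => (1 - u ^ 2) / (2 * u * √κ))
        (-(1 + u ^ 2) / (2 * u ^ 2 * √κ)) u := by
      have h1 := (((hasDerivAt_id u).pow 2).const_sub 1).div
        (((hasDerivAt_id u).const_mul 2).mul_const √κ) (by simp; constructor <;> positivity)
      refine HasDerivAt.congr_deriv (f := fun u : ℝ => (1 - u ^ 2) / (2 * u * √κ)) h1 ?_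
      simp
      field_simp
      ring
    have hcomp := (hasDerivAt_angleTime hκ' (Real.arccos X)).comp u
      ((Real.hasDerivAt_arccos (by linarith) (by linarith)).comp u hXd)
    refine HasDerivAt.congr_deriv (f := g) hcomp ?_
    rw [Real.cos_arccos (by linarith) hX1.le]
    have e1 : √(1 + κ * X ^ 2) = (1 + u ^ 2) / (2 * u) := by
      rw [Real.sqrt_eq_iff_mul_self_eq (by positivity) (by positivity), hX]
      field_simp
      rw [hk2]
      ring
    have hP : 0 < 4 * κ * u ^ 2 - (1 - u ^ 2) ^ 2 := by
      have : (1 - u ^ 2) ^ 2 < (2 * u * √κ) ^ 2 := by gcongr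
      rw [mul_pow, hk2] at this
      nlinarith
    have e2 : √(1 - X ^ 2) = √(4 * κ * u ^ 2 - (1 - u ^ 2) ^ 2) / (2 * u * √κ) := by
      rw [Real.sqrt_eq_iff_mul_self_eq (by nlinarith) (by positivity), hX]
      have hS := Real.sq_sqrt hP.le
      generalize √(4 * κ * u ^ 2 - (1 - u ^ 2) ^ 2) = S at hS ⊢
      field_simp
      linear_combination (-1) * hS + 4 * u ^ 2 * hk2
    have hPs := Real.sqrt_pos.2 hP
    rw [e1, e2]
    field_simp
  -- The integrand is singular at the neck. It is integrable because it is the nonnegative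
  -- derivative of a function continuous up to the endpoints.
  have hint := intervalIntegral.intervalIntegrable_deriv_of_nonneg hcont hderiv
    fun u _ => by positivity
  rw [catenoidTime, intervalIntegral.integral_eq_sub_of_hasDeriv_right hcont
    (fun u hu => (hderiv u hu).hasDerivWithinAt) hint]
  have : g (neckRadius κ) = 0 := by
    simp only [hg, hn]
    rw [div_self (by positivity), Real.arccos_one, angleTime_zero]
  rw [this, sub_zero]

theorem cosAngle_denom_pos_aux {m y a : ℝ} (hm : m < 1) (hy : 0 < y) (hm0 : -1 < m)
    (h : (1 + m) * y ≤ a) : (1 - m) ^ 2 * y ^ 2 ≤ a ^ 2 - 4 * m * y ^ 2 ∧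
      0 < a ^ 2 - 4 * m * y ^ 2 := by
  have h1 : 0 < (1 - m) ^ 2 * y ^ 2 := by
    have : 0 < 1 - m := by linarith
    positivity
  have h2 : ((1 + m) * y) ^ 2 ≤ a ^ 2 := by
    have : 0 ≤ (1 + m) * y := mul_nonneg (by linarith) hy.le
    gcongr
  constructor <;> nlinarith

theorem cosAngle_mem {κ : ℝ} (hκ : 0 < κ) {z : ℂ} (hz : z ∈ dilatedDomain κ) :
    0 < cosAngle κ z ∧ cosAngle κ z ≤ 1 := by
  obtain ⟨hy, hz⟩ := (mem_dilatedDomain_iff hκ z).1 hz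
  have hm := neckHeightSq_pos hκ
  have hm1 := neckHeightSq_lt_one (κ := κ) (by linarith)
  obtain ⟨h1, h2⟩ := cosAngle_denom_pos_aux hm1 hy (by linarith) hz
  have h3 : 0 < (1 - neckHeightSq κ) * z.im := mul_pos (by linarith) hy
  refine ⟨div_pos h3 (Real.sqrt_pos.2 h2), div_le_one_of_le₀ ?_ (Real.sqrt_nonneg _)⟩
  exact Real.le_sqrt_of_sq_le (by rwa [mul_pow])

theorem dilatedTime_eq {κ : ℝ} (hκ : 0 < κ) {z : ℂ} (hz : z ∈ dilatedDomain κ) :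
    dilatedTime κ z = angleTime κ (Real.arccos (cosAngle κ z)) := by
  have hk : 0 < √κ := Real.sqrt_pos.2 hκ
  have hcos := cosAngle_mem hκ hz
  obtain ⟨hy, hz⟩ := (mem_dilatedDomain_iff hκ z).1 hz
  have hm := neckHeightSq_pos hκ
  have hm1 := neckHeightSq_lt_one (κ := κ) (by linarith)
  have hμ := neckHeight_pos hκ
  have hmu := neckHeight_sq hκ
  have h2μ := two_mul_neckHeight hκ
  obtain ⟨-, hD⟩ := cosAngle_denom_pos_aux hm1 hy (by linarith) hz
  have hw : 0 < ((neckHeight κ : ℂ) * z).im := by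
    rw [Complex.im_ofReal_mul]
    exact mul_pos hμ hy
  have hR1 := norm_cayleyInv_lt_one hw
  have hRsq := norm_cayleyInv_sq ((neckHeight κ : ℂ) * z)
  rw [Complex.normSq_mul, Complex.normSq_ofReal, ← sq, hmu, Complex.im_ofReal_mul] at hRsq
  have hS := Real.sq_sqrt hD.le
  have hSpos := Real.sqrt_pos.2 hD
  have hN : 0 ≤ neckHeightSq κ * Complex.normSq z := mul_nonneg hm.le (Complex.normSq_nonneg z)
  have hA : 0 < 1 + neckHeightSq κ * Complex.normSq z + 2 * (neckHeight κ * z.im) := by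
    have := mul_pos hμ hy
    linarith
  have hR : ‖cayleyInv ((neckHeight κ : ℂ) * z)‖ =
      √((1 + neckHeightSq κ * Complex.normSq z) ^ 2 - 4 * neckHeightSq κ * z.im ^ 2) /
        (1 + neckHeightSq κ * Complex.normSq z + 2 * (neckHeight κ * z.im)) := by
    rw [← sq_eq_sq₀ (norm_nonneg _) (by positivity), hRsq, div_pow, hS]
    field_simp
    linear_combination (-4) * z.im ^ 2 * hmu
  have hΘ : 1 - ‖cayleyInv ((neckHeight κ : ℂ) * z)‖ ^ 2 =
      2 * ‖cayleyInv ((neckHeight κ : ℂ) * z)‖ * √κ * cosAngle κ z := by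
    rw [hRsq, hR, cosAngle]
    generalize √((1 + neckHeightSq κ * Complex.normSq z) ^ 2 - 4 * neckHeightSq κ * z.im ^ 2) = S
      at hSpos
    field_simp
    linear_combination 2 * z.im * h2μ
  have hR0 : 0 < ‖cayleyInv ((neckHeight κ : ℂ) * z)‖ := by
    rw [hR]
    positivity
  have hn : 1 - neckRadius κ ^ 2 = 2 * neckRadius κ * √κ := by
    have := one_sub_angleRadius_sq hκ 0
    rwa [angleRadius_zero, Real.cos_zero, mul_one] at this
  -- $(1-R^2)/(2R)$ is decreasing in $R$, is $\sqrt\kappa$ at the neck, and here is $\sqrt\kappa$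
  -- times a cosine at most $1$.
  have hle : neckRadius κ ≤ ‖cayleyInv ((neckHeight κ : ℂ) * z)‖ := by
    set R := ‖cayleyInv ((neckHeight κ : ℂ) * z)‖
    by_contra! hlt
    have h4 : 2 * R * √κ * cosAngle κ z ≤ 2 * R * √κ :=
      mul_le_of_le_one_right (by positivity) hcos.2
    have h5 : 2 * R * √κ < 2 * neckRadius κ * √κ := by gcongr
    nlinarith
  rw [dilatedTime, catenoidTime_eq hκ hle hR1.le, hΘ, mul_div_cancel_left₀ _ (by positivity)]

/-- Squaring the equation and using $\kappa(1-m)^2=4m$ leaves $\cos^2\psi$ times a quantity free of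
$\psi$. Positivity makes the squaring reversible, and $\cos\psi\le1$ is the domain condition. -/
theorem cos_eq_cosAngle {κ ψ : ℝ} (hκ : 0 < κ) {z : ℂ} (hy : 0 < z.im) (hψ : |ψ| < Real.pi / 2)
    (h : Real.cos ψ * (1 + neckHeightSq κ * Complex.normSq z) =
        (1 - neckHeightSq κ) * √(1 + κ * Real.cos ψ ^ 2) * z.im) :
    z ∈ dilatedDomain κ ∧ Real.cos ψ = cosAngle κ z := by
  have hκ' : -1 < κ := by linarith
  have hm := neckHeightSq_pos hκ
  have hm1 := neckHeightSq_lt_one hκ'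
  have hc : 0 < Real.cos ψ := Real.cos_pos_of_mem_Ioo (abs_lt.1 hψ)
  have hN : 0 ≤ neckHeightSq κ * Complex.normSq z := mul_nonneg hm.le (Complex.normSq_nonneg z)
  have hs := Real.sq_sqrt (one_add_mul_cos_sq_pos hκ' ψ).le
  have hk := mul_one_sub_neckHeightSq_sq hκ'
  have hsq : Real.cos ψ ^ 2 * ((1 + neckHeightSq κ * Complex.normSq z) ^ 2 -
      4 * neckHeightSq κ * z.im ^ 2) = ((1 - neckHeightSq κ) * z.im) ^ 2 := by
    have := congrArg (· ^ 2) h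
    linear_combination this + (1 - neckHeightSq κ) ^ 2 * z.im ^ 2 * hs +
      Real.cos ψ ^ 2 * z.im ^ 2 * hk
  have hD : 0 < (1 + neckHeightSq κ * Complex.normSq z) ^ 2 - 4 * neckHeightSq κ * z.im ^ 2 := by
    have : 0 < ((1 - neckHeightSq κ) * z.im) ^ 2 := by
      have : 0 < 1 - neckHeightSq κ := by linarith
      positivity
    rw [← hsq] at this
    exact pos_of_mul_pos_right this (by positivity)
  constructor
  · rw [mem_dilatedDomain_iff hκ]
    refine ⟨hy, ?_⟩
    rw [← sq_le_sq₀ (by positivity) (by positivity)]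
    have := mul_le_mul_of_nonneg_right (Real.cos_sq_le_one ψ) hD.le
    nlinarith
  · have h1 : 0 < (1 - neckHeightSq κ) * z.im := mul_pos (by linarith) hy
    rw [cosAngle, eq_div_iff (Real.sqrt_pos.2 hD).ne', ← sq_eq_sq₀ (by positivity) h1.le,
      mul_pow, Real.sq_sqrt hD.le, hsq]

theorem cosAngle_equation {κ ψ : ℝ} (hκ : 0 < κ) {z : ℂ} (hz : z ∈ dilatedDomain κ)
    (h : Real.cos ψ = cosAngle κ z) :
    Real.cos ψ * (1 + neckHeightSq κ * Complex.normSq z) =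
        (1 - neckHeightSq κ) * √(1 + κ * Real.cos ψ ^ 2) * z.im := by
  have hκ' : -1 < κ := by linarith
  have hc := (cosAngle_mem hκ hz).1
  rw [← h] at hc
  obtain ⟨hy, hz⟩ := (mem_dilatedDomain_iff hκ z).1 hz
  have hm := neckHeightSq_pos hκ
  have hm1 := neckHeightSq_lt_one hκ'
  have hN : 0 ≤ neckHeightSq κ * Complex.normSq z := mul_nonneg hm.le (Complex.normSq_nonneg z)
  have hp := one_add_mul_cos_sq_pos hκ' ψ
  have hk := mul_one_sub_neckHeightSq_sq hκ'
  obtain ⟨-, hD⟩ := cosAngle_denom_pos_aux hm1 hy (by linarith) hz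
  have h1 : 0 < 1 - neckHeightSq κ := by linarith
  rw [cosAngle, eq_div_iff (Real.sqrt_pos.2 hD).ne'] at h
  have hsq := congrArg (· ^ 2) h
  simp only [mul_pow, Real.sq_sqrt hD.le] at hsq
  rw [← sq_eq_sq₀ (by positivity) (by positivity), mul_pow, mul_pow, mul_pow, Real.sq_sqrt hp.le]
  linear_combination hsq - Real.cos ψ ^ 2 * z.im ^ 2 * hk

theorem dilatedCatenoid_eq_bigraph {κ : ℝ} (hκ : 0 < κ) :
    dilatedCatenoid κ = {p | p.1 ∈ dilatedDomain κ ∧ |p.2| = dilatedTime κ p.1} := by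
  have hκ' : -1 < κ := by linarith
  ext p
  rw [mem_dilatedCatenoid_iff hκ, Set.mem_ofPred_eq]
  constructor
  · rintro ⟨hy, ψ, hψ, ht, h⟩
    obtain ⟨hz, hc⟩ := cos_eq_cosAngle hκ hy hψ h
    refine ⟨hz, ?_⟩
    rw [dilatedTime_eq hκ hz, ht, abs_angleTime hκ', ← hc, ← Real.cos_abs,
      Real.arccos_cos (abs_nonneg _) (by linarith [Real.pi_pos])]
  · rintro ⟨hz, ht⟩
    have hc := cosAngle_mem hκ hz
    refine ⟨((mem_dilatedDomain_iff hκ _).1 hz).1, ?_⟩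
    rw [dilatedTime_eq hκ hz] at ht
    set φ := Real.arccos (cosAngle κ p.1)
    have hφ : Real.cos φ = cosAngle κ p.1 := Real.cos_arccos (by linarith) hc.2
    have hφ1 : |φ| < Real.pi / 2 := by
      rw [abs_of_nonneg (Real.arccos_nonneg _)]
      exact Real.arccos_lt_pi_div_two.2 hc.1
    rcases abs_choice p.2 with h | h
    · exact ⟨φ, hφ1, by rw [← ht, h], cosAngle_equation hκ hz hφ⟩
    · have hφ' : Real.cos (-φ) = cosAngle κ p.1 := by rw [Real.cos_neg, hφ]
      exact ⟨-φ, by rwa [abs_neg], by rw [angleTime_neg, ← ht, h, neg_neg],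
        cosAngle_equation hκ hz hφ'⟩

/-! ### The dilated domain as $\kappa\searrow0$. -/

theorem strip_subset_dilatedDomain {κ : ℝ} (hκ : 0 < κ) :
    {z : ℂ | 0 < z.im ∧ z.im ≤ 1} ⊆ dilatedDomain κ := by
  rintro z ⟨h0, h1⟩
  rw [mem_dilatedDomain_iff hκ]
  have hm := neckHeightSq_pos hκ
  have hm1 := neckHeightSq_lt_one (κ := κ) (by linarith)
  refine ⟨h0, ?_⟩
  rw [Complex.normSq_apply]
  have h2 : neckHeightSq κ * z.im ≤ 1 := by nlinarith
  -- The condition is $(1-y)(1-my)+mx^2\ge0$.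
  nlinarith [mul_nonneg (sub_nonneg.2 h1) (sub_nonneg.2 h2),
    mul_nonneg hm.le (mul_self_nonneg z.re)]

theorem contDiffOn_neckHeightSq : ContDiffOn ℝ ∞ neckHeightSq {κ | -1 < κ} := by
  unfold neckHeightSq
  refine contDiffOn_id.div (ContDiffOn.pow (contDiffOn_const.add (ContDiffOn.sqrt (by fun_prop)
    fun κ hκ => ?_)) 2) fun κ hκ => by positivity
  have : -1 < κ := hκ
  linarith

theorem neckHeightSq_zero : neckHeightSq 0 = 0 := by simp [neckHeightSq]

theorem hasDerivAt_neckHeightSq_zero : HasDerivAt neckHeightSq (1 / 4) 0 := by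
  have h1 := (((hasDerivAt_id (0 : ℝ)).const_add 1).sqrt (by simp)).const_add 1
  have h2 := (hasDerivAt_id (0 : ℝ)).div (h1.pow 2) (by simp)
  refine HasDerivAt.congr_deriv (f := neckHeightSq) h2 ?_
  simp
  norm_num

theorem eventually_notMem_dilatedDomain {z : ℂ} (hz : 1 < z.im) :
    ∀ᶠ κ in 𝓝[>] (0 : ℝ), z ∉ dilatedDomain κ := by
  have hc : ContinuousAt (fun κ => (1 + neckHeightSq κ) * z.im -
      (1 + neckHeightSq κ * Complex.normSq z)) 0 := by
    have := hasDerivAt_neckHeightSq_zero.continuousAt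
    fun_prop
  have h0 : 0 < (1 + neckHeightSq 0) * z.im - (1 + neckHeightSq 0 * Complex.normSq z) := by
    rw [neckHeightSq_zero]
    linarith
  filter_upwards [nhdsWithin_le_nhds (hc.eventually (lt_mem_nhds h0)), self_mem_nhdsWithin]
    with κ h1 hκ h2
  have := ((mem_dilatedDomain_iff hκ z).1 h2).2
  linarith

end

/-! ### Partial derivatives and fundamental forms -/

noncomputable section

/-- `f` is differentiable at `q` with partial derivatives `a` and `b`. -/
def HasPartials {E : Type*} [NormedAddCommGroup E] [NormedSpace ℝ E] (f : ℝ × ℝ → E) (q : ℝ × ℝ)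
    (a b : E) : Prop :=
  HasFDerivAt f ((ContinuousLinearMap.fst ℝ ℝ ℝ).smulRight a +
    (ContinuousLinearMap.snd ℝ ℝ ℝ).smulRight b) q

section Partials

variable {E : Type*} [NormedAddCommGroup E] [NormedSpace ℝ E] {f : ℝ × ℝ → E} {q : ℝ × ℝ} {a b : E}

theorem HasPartials.partialD_zero (h : HasPartials f q a b) : partialD 0 f q = a := by
  rw [partialD, HasFDerivAt.fderiv h]
  simp [paramVec]

theorem HasPartials.partialD_one (h : HasPartials f q a b) : partialD 1 f q = b := by
  rw [partialD, HasFDerivAt.fderiv h]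
  simp [paramVec]

theorem hasPartials_of_hasDerivAt (hf : DifferentiableAt ℝ f q)
    (ha : HasDerivAt (fun s => f (s, q.2)) a q.1) (hb : HasDerivAt (fun s => f (q.1, s)) b q.2) :
    HasPartials f q a b := by
  have h1 := hf.hasFDerivAt.comp_hasDerivAt q.1 ((hasDerivAt_id q.1).prodMk (hasDerivAt_const q.1 q.2))
  have h2 := hf.hasFDerivAt.comp_hasDerivAt q.2 ((hasDerivAt_const q.2 q.1).prodMk (hasDerivAt_id q.2))
  have e1 := ha.unique h1
  have e2 := hb.unique h2
  refine hf.hasFDerivAt.congr_fderiv ?_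
  ext <;> simp [e1, e2]

theorem HasPartials.congr_of_eventuallyEq {g : ℝ × ℝ → E} (h : HasPartials f q a b)
    (hg : g =ᶠ[𝓝 q] f) : HasPartials g q a b :=
  HasFDerivAt.congr_of_eventuallyEq h hg

theorem HasPartials.congr_partials {a' b' : E} (h : HasPartials f q a b) (ha : a = a')
    (hb : b = b') : HasPartials f q a' b' := ha ▸ hb ▸ h

theorem hasPartials_const (c : E) : HasPartials (fun _ => c) q 0 0 := by
  unfold HasPartials
  simpa using hasFDerivAt_const c q

theorem hasPartials_fst : HasPartials Prod.fst q (1 : ℝ) 0 := by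
  refine hasFDerivAt_fst.congr_fderiv ?_
  ext <;> simp

theorem hasPartials_snd : HasPartials Prod.snd q (0 : ℝ) 1 := by
  refine hasFDerivAt_snd.congr_fderiv ?_
  ext <;> simp

theorem HasDerivAt.comp_hasPartials {u : ℝ × ℝ → ℝ} {g : ℝ → ℝ} {g' a b : ℝ}
    (hg : HasDerivAt g g' (u q)) (hu : HasPartials u q a b) :
    HasPartials (fun q => g (u q)) q (g' * a) (g' * b) := by
  refine (hg.comp_hasFDerivAt q hu).congr_fderiv ?_
  ext <;> simp

theorem HasPartials.mul {u v : ℝ × ℝ → ℝ} {a b c d : ℝ} (hu : HasPartials u q a b)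
    (hv : HasPartials v q c d) :
    HasPartials (fun q => u q * v q) q (a * v q + u q * c) (b * v q + u q * d) := by
  refine (HasFDerivAt.mul hu hv).congr_fderiv ?_
  ext <;> simp <;> ring

theorem HasPartials.mk {X Y Z : ℝ × ℝ → ℝ} {a b c d e f : ℝ} (hX : HasPartials X q a b)
    (hY : HasPartials Y q c d) (hZ : HasPartials Z q e f) :
    HasPartials (fun q => ((⟨X q, Y q⟩ : ℂ), Z q)) q ((⟨a, c⟩ : ℂ), e) ((⟨b, d⟩ : ℂ), f) := by
  have h1 := Complex.equivRealProdCLM.symm.hasFDerivAt.comp q (HasFDerivAt.prodMk hX hY)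
  refine (HasFDerivAt.prodMk h1 hZ).congr_fderiv ?_
  ext <;> simp <;> rfl

end Partials

theorem continuous_complex_mk : Continuous fun q : ℝ × ℝ => (⟨q.1, q.2⟩ : ℂ) :=
  Complex.equivRealProdCLM.symm.continuous

theorem contDiff_complex_mk : ContDiff ℝ ∞ fun q : ℝ × ℝ => (⟨q.1, q.2⟩ : ℂ) :=
  Complex.equivRealProdCLM.symm.contDiff

theorem firstForm_eq {F : ℝ × ℝ → ℂ × ℝ} {q : ℝ × ℝ} {A : Fin 2 → ℂ × ℝ}
    (hF : HasPartials F q (A 0) (A 1)) :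
    firstForm F q = Matrix.of fun i j => ambientMetric (F q) (A i) (A j) := by
  have h : ∀ i, partialD i F q = A i := by
    intro i
    fin_cases i
    · exact hF.partialD_zero
    · exact hF.partialD_one
  ext i j
  simp [firstForm, h]

theorem secondForm_eq {F : ℝ × ℝ → ℂ × ℝ} {q : ℝ × ℝ} {n : ℂ × ℝ} {A : Fin 2 → ℝ × ℝ → ℂ × ℝ}
    {B : Fin 2 → Fin 2 → ℂ × ℝ} (hF : ∀ᶠ q' in 𝓝 q, HasPartials F q' (A 0 q') (A 1 q'))
    (hA : ∀ j, HasPartials (A j) q (B 0 j) (B 1 j)) :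
    secondForm F n q = Matrix.of fun i j =>
      ambientMetric (F q) (B i j + christoffel (F q) (A i q) (A j q)) n := by
  have h : ∀ i, partialD i F =ᶠ[𝓝 q] A i := by
    intro i
    filter_upwards [hF] with q' hq'
    fin_cases i
    · exact hq'.partialD_zero
    · exact hq'.partialD_one
  have h2 : ∀ i j, partialD i (partialD j F) q = B i j := by
    intro i j
    have := (hA j).congr_of_eventuallyEq (h j)
    fin_cases i
    · exact this.partialD_zero
    · exact this.partialD_one
  ext i j
  simp only [secondForm, Matrix.of_apply, h2, (h i).self_of_nhds, (h j).self_of_nhds]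

theorem trace_inv_mul_fin_two (g h : Matrix (Fin 2) (Fin 2) ℝ) : (g⁻¹ * h).trace =
    (g.det)⁻¹ * (g 1 1 * h 0 0 - g 0 1 * h 1 0 - g 1 0 * h 0 1 + g 0 0 * h 1 1) := by
  rw [Matrix.inv_def, Ring.inverse_eq_inv', Matrix.adjugate_fin_two, Matrix.smul_mul,
    Matrix.trace_smul, smul_eq_mul]
  congr 1
  rw [Matrix.trace_fin_two, Matrix.mul_apply, Matrix.mul_apply, Fin.sum_univ_two,
    Fin.sum_univ_two]
  simp
  ring

/-! ### Minimal graphs -/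

theorem isMinimalImmersionOn_graph {u ux uy uxx uxy uyy : ℝ × ℝ → ℝ} {U : Set (ℝ × ℝ)}
    (hU : IsOpen U) (hpos : ∀ q ∈ U, 0 < q.2) (hu : ContDiffOn ℝ ∞ u U)
    (h1 : ∀ q ∈ U, HasPartials u q (ux q) (uy q))
    (h2 : ∀ q ∈ U, HasPartials ux q (uxx q) (uxy q))
    (h3 : ∀ q ∈ U, HasPartials uy q (uxy q) (uyy q))
    (heq : ∀ q ∈ U, 1 / q.2 ^ 2 * (uxx q + uyy q) + uy q ^ 2 * uxx q -
      2 * ux q * uy q * uxy q + ux q ^ 2 * uyy q - uy q / q.2 * (ux q ^ 2 + uy q ^ 2) = 0) :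
    IsMinimalImmersionOn (fun q => ((⟨q.1, q.2⟩ : ℂ), u q)) U := by
  have hF : ∀ q ∈ U, HasPartials (fun q => ((⟨q.1, q.2⟩ : ℂ), u q)) q ((⟨1, 0⟩ : ℂ), ux q)
      ((⟨0, 1⟩ : ℂ), uy q) := fun q hq => hasPartials_fst.mk hasPartials_snd (h1 q hq)
  refine ⟨hpos, ?_, ?_, ?_⟩
  · exact contDiff_complex_mk.contDiffOn.prodMk hu
  · intro q hq v w hvw
    rw [HasFDerivAt.fderiv (hF q hq)] at hvw
    have h4 := congrArg (fun p : ℂ × ℝ => p.1.re) hvw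
    have h5 := congrArg (fun p : ℂ × ℝ => p.1.im) hvw
    simp at h4 h5
    exact Prod.ext h4 h5
  · intro q hq n hn
    have hy := hpos q hq
    have hA := hn.2 0
    have hB := hn.2 1
    rw [(hF q hq).partialD_zero] at hA
    rw [(hF q hq).partialD_one] at hB
    rw [trace_inv_mul_fin_two, firstForm_eq (A := ![((⟨1, 0⟩ : ℂ), ux q), ((⟨0, 1⟩ : ℂ), uy q)])
      (hF q hq), secondForm_eq (A := ![fun q => ((⟨1, 0⟩ : ℂ), ux q), fun q => ((⟨0, 1⟩ : ℂ), uy q)])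
      (B := ![![((⟨0, 0⟩ : ℂ), uxx q), ((⟨0, 0⟩ : ℂ), uxy q)],
        ![((⟨0, 0⟩ : ℂ), uxy q), ((⟨0, 0⟩ : ℂ), uyy q)]])
      (eventually_of_mem (hU.mem_nhds hq) hF) ?_]
    · refine mul_eq_zero_of_right _ ?_
      have hIy : Complex.I / (q.2 : ℂ) = ⟨0, 1 / q.2⟩ := by
        apply Complex.ext <;> simp [Complex.div_re, Complex.div_im, Complex.normSq_apply]
      simp [ambientMetric, christoffel, hIy] at hA hB ⊢
      -- Orthogonality makes `n` a multiple of the upward conormal, so the trace is a multiple of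
      -- the graph equation; its length is irrelevant.
      have hA' : n.1.re = -(q.2 ^ 2 * (ux q * n.2)) := by
        field_simp at hA
        linarith
      have hB' : n.1.im = -(q.2 ^ 2 * (uy q * n.2)) := by
        field_simp at hB
        linarith
      rw [hA', hB']
      have h := heq q hq
      field_simp at h ⊢
      linear_combination n.2 * q.2 * h
    · intro j
      fin_cases j
      · exact (hasPartials_const 1).mk (hasPartials_const 0) (h2 q hq)
      · exact (hasPartials_const 0).mk (hasPartials_const 1) (h3 q hq)

/-! ### Minimality of the dilated catenoids -/

/-- For a height $u(E)$ with $E=(1+m|z|^2)/y$ and $P=u'$, one has $|\nabla E|^2=(E^2-4m)/y^2$, and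
the minimal surface equation becomes $(E^2-4m)P'+2EP+E(E^2-4m)P^3=0$. The relations `hP` and `hP'`
give a solution. -/
theorem catenoid_minimal_equation {m x y E P P' Q : ℝ} (hy : y ≠ 0)
    (hQ : Q = (E ^ 2 - 4 * m) * (E ^ 2 - (1 + m) ^ 2)) (hQ0 : Q ≠ 0) (hP : P ^ 2 * Q = (1 - m) ^ 2)
    (hP' : P' * Q = -P * (E * (2 * E ^ 2 - 4 * m - (1 + m) ^ 2)))
    (hE : E * y = 1 + m * (x ^ 2 + y ^ 2)) (Ex Ey : ℝ) (hEx : Ex = 2 * m * x / y)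
    (hEy : Ey = 2 * m - E / y) (uxx uxy uyy : ℝ) (hxx : uxx = P' * Ex ^ 2 + P * (2 * m / y))
    (hxy : uxy = P' * (Ex * Ey) + P * -(2 * m * x / y ^ 2))
    (hyy : uyy = P' * Ey ^ 2 + P * (2 * E / y ^ 2 - 2 * m / y)) :
    1 / y ^ 2 * (uxx + uyy) + (P * Ey) ^ 2 * uxx - 2 * (P * Ex) * (P * Ey) * uxy +
      (P * Ex) ^ 2 * uyy - P * Ey / y * ((P * Ex) ^ 2 + (P * Ey) ^ 2) = 0 := by
  have hN : Ex ^ 2 + Ey ^ 2 = (E ^ 2 - 4 * m) / y ^ 2 := by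
    rw [hEx, hEy]
    field_simp
    linear_combination (-4 * m) * hE
  have hE' : E = (2 * m - Ey) * y := by
    rw [hEy]
    field_simp
    ring
  have hx : 2 * m * x / y ^ 2 = Ex / y := by
    rw [hEx]
    field_simp
  have hK : Ey ^ 2 * (2 * m / y) - 2 * Ex * Ey * -(2 * m * x / y ^ 2) +
      Ex ^ 2 * (2 * E / y ^ 2 - 2 * m / y) - Ey / y * (Ex ^ 2 + Ey ^ 2) =
      E / y ^ 2 * (Ex ^ 2 + Ey ^ 2) := by
    rw [hx, hE']
    field_simp
    ring
  have hsplit : 1 / y ^ 2 * (uxx + uyy) + (P * Ey) ^ 2 * uxx - 2 * (P * Ex) * (P * Ey) * uxy +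
      (P * Ex) ^ 2 * uyy - P * Ey / y * ((P * Ex) ^ 2 + (P * Ey) ^ 2) =
      1 / y ^ 2 * (P' * (Ex ^ 2 + Ey ^ 2) + P * (2 * E / y ^ 2)) +
        P ^ 3 * (E / y ^ 2 * (Ex ^ 2 + Ey ^ 2)) := by
    rw [← hK, hxx, hxy, hyy]
    ring
  rw [hsplit, hN]
  refine mul_left_cancel₀ hQ0 ?_
  rw [mul_zero]
  field_simp
  linear_combination (E ^ 2 - 4 * m) * hP' + P * E * (E ^ 2 - 4 * m) * hP + 2 * P * E * hQ

/-- The height of the dilated catenoid as a function of `(1 + m |z|²) / y`, where `m = μ₀²`. -/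
def levelTime (κ E : ℝ) : ℝ :=
  angleTime κ (Real.arccos ((1 - neckHeightSq κ) / √(E ^ 2 - 4 * neckHeightSq κ)))

/-- The function `(1 + m |z|²) / y`, constant on the circles of a catenoid. -/
def levelFun (m : ℝ) (q : ℝ × ℝ) : ℝ := (1 + m * (q.1 ^ 2 + q.2 ^ 2)) / q.2

theorem levelTime_arg_mem {m E : ℝ} (hm : 0 < m) (hm1 : m < 1) (hE : 1 + m < E) :
    0 < E ^ 2 - 4 * m ∧ 0 < E ^ 2 - (1 + m) ^ 2 ∧ 0 < (1 - m) / √(E ^ 2 - 4 * m) ∧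
      (1 - m) / √(E ^ 2 - 4 * m) < 1 := by
  have h1 : 0 < E ^ 2 - (1 + m) ^ 2 := by nlinarith
  have h2 : 0 < E ^ 2 - 4 * m := by nlinarith
  have h3 := Real.sqrt_pos.2 h2
  refine ⟨h2, h1, div_pos (by linarith) h3, (div_lt_one h3).2 ?_⟩
  exact Real.lt_sqrt_of_sq_lt (by nlinarith)

theorem hasDerivAt_levelTime {κ E : ℝ} (hκ : 0 < κ) (hE : 1 + neckHeightSq κ < E) :
    HasDerivAt (levelTime κ) ((1 - neckHeightSq κ) /
      √((E ^ 2 - 4 * neckHeightSq κ) * (E ^ 2 - (1 + neckHeightSq κ) ^ 2))) E := by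
  have hκ' : -1 < κ := by linarith
  have hm := neckHeightSq_pos hκ
  have hm1 := neckHeightSq_lt_one hκ'
  have hk := mul_one_sub_neckHeightSq_sq hκ'
  obtain ⟨h1, h2, h3, h4⟩ := levelTime_arg_mem hm hm1 hE
  set m := neckHeightSq κ
  have hS := Real.sqrt_pos.2 h1
  have hS2 := Real.sq_sqrt h1.le
  have hR := Real.sqrt_pos.2 h2
  have hR2 := Real.sq_sqrt h2.le
  have hd := (hasDerivAt_const E (1 - m)).div ((((hasDerivAt_id E).pow 2).sub_const (4 * m)).sqrt
    (by simpa using h1.ne')) (by simpa using hS.ne')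
  have hX : HasDerivAt (fun E => (1 - m) / √(E ^ 2 - 4 * m))
      (-((1 - m) * E) / √(E ^ 2 - 4 * m) ^ 3) E := by
    refine HasDerivAt.congr_deriv (f := fun E => (1 - m) / √(E ^ 2 - 4 * m)) hd ?_
    simp only [id, Pi.pow_apply]
    generalize √(E ^ 2 - 4 * m) = S at hS hS2
    field_simp
    simp
  have hcomp := (hasDerivAt_angleTime hκ' (Real.arccos ((1 - m) / √(E ^ 2 - 4 * m)))).comp E
    ((Real.hasDerivAt_arccos (by linarith) h4.ne).comp E hX)
  refine HasDerivAt.congr_deriv (f := levelTime κ) hcomp ?_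
  clear_value m
  clear hcomp hX hd
  have hE0 : 0 < E := by linarith
  rw [Real.cos_arccos (by linarith) h4.le, Real.sqrt_mul h1.le]
  have e1 : √(1 + κ * ((1 - m) / √(E ^ 2 - 4 * m)) ^ 2) = E / √(E ^ 2 - 4 * m) := by
    rw [Real.sqrt_eq_iff_mul_self_eq (by positivity) (by positivity)]
    generalize √(E ^ 2 - 4 * m) = S at hS hS2
    field_simp
    linear_combination hS2 + hk
  have e2 : √(1 - ((1 - m) / √(E ^ 2 - 4 * m)) ^ 2) =
      √(E ^ 2 - (1 + m) ^ 2) / √(E ^ 2 - 4 * m) := by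
    rw [← Real.sqrt_div h2.le]
    congr 1
    rw [div_pow, hS2, eq_div_iff h1.ne', sub_mul, div_mul_cancel₀ _ h1.ne']
    ring
  simp only [e1, e2]
  generalize √(E ^ 2 - (1 + m) ^ 2) = R at hR hR2
  generalize √(E ^ 2 - 4 * m) = S at hS hS2
  field_simp

theorem contDiffOn_levelTime {κ : ℝ} (hκ : 0 < κ) :
    ContDiffOn ℝ ∞ (levelTime κ) (Set.Ioi (1 + neckHeightSq κ)) := by
  intro E hE
  have hκ' : -1 < κ := by linarith
  obtain ⟨h1, h2, h3, h4⟩ :=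
    levelTime_arg_mem (neckHeightSq_pos hκ) (neckHeightSq_lt_one hκ') hE
  refine ContDiffAt.contDiffWithinAt ?_
  have hd : ContDiffAt ℝ ∞
      (fun E => (1 - neckHeightSq κ) / √(E ^ 2 - 4 * neckHeightSq κ)) E :=
    contDiffAt_const.div (ContDiffAt.sqrt (by fun_prop) h1.ne') (Real.sqrt_pos.2 h1).ne'
  exact (contDiff_angleTime hκ').contDiffAt.comp E
    (ContDiffAt.comp (g := Real.arccos) E (Real.contDiffAt_arccos (by linarith) h4.ne) hd)

theorem hasPartials_levelFun (m : ℝ) {q : ℝ × ℝ} (hq : q.2 ≠ 0) :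
    HasPartials (levelFun m) q (2 * m * q.1 / q.2) (2 * m - levelFun m q / q.2) := by
  refine hasPartials_of_hasDerivAt ?_ ?_ ?_
  · unfold levelFun
    fun_prop (disch := assumption)
  · refine HasDerivAt.congr_deriv (f := fun s => levelFun m (s, q.2))
      (((((hasDerivAt_id q.1).pow 2).add_const (q.2 ^ 2)).const_mul m).const_add 1 |>.div_const q.2) ?_
    simp
    ring
  · refine HasDerivAt.congr_deriv (f := fun s => levelFun m (q.1, s))
      (((((hasDerivAt_id q.2).pow 2).const_add (q.1 ^ 2)).const_mul m).const_add 1 |>.div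
        (hasDerivAt_id q.2) hq) ?_
    simp [levelFun]
    field_simp

/-- At an interior point with equality the defining function would have a local minimum in each
coordinate. Then $x=0$ and $(1+m)^2=4m$, which is impossible for $m<1$. -/
theorem lt_of_mem_interior_dilatedDomain {κ : ℝ} (hκ : 0 < κ) {z : ℂ}
    (hz : z ∈ interior (dilatedDomain κ)) :
    0 < z.im ∧ (1 + neckHeightSq κ) * z.im < 1 + neckHeightSq κ * Complex.normSq z := by
  have hm := neckHeightSq_pos hκ
  have hm1 := neckHeightSq_lt_one (κ := κ) (by linarith)
  have hz0 := (mem_dilatedDomain_iff hκ z).1 (interior_subset hz)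
  refine ⟨hz0.1, lt_of_le_of_ne hz0.2 fun heq => ?_⟩
  set m := neckHeightSq κ
  have hn := mem_interior_iff_mem_nhds.1 hz
  rw [Complex.normSq_apply] at heq
  have key : ∀ w : ℂ, w ∈ dilatedDomain κ → (1 + m) * w.im ≤ 1 + m * (w.re * w.re + w.im * w.im) :=
    fun w hw => by simpa [Complex.normSq_apply] using ((mem_dilatedDomain_iff hκ w).1 hw).2
  have h1 : IsLocalMin (fun s : ℝ => 1 + m * (s * s + z.im * z.im) - (1 + m) * z.im) z.re := by
    have hc : ContinuousAt (fun s : ℝ => (⟨s, z.im⟩ : ℂ)) z.re :=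
      (continuous_complex_mk.comp (by fun_prop : Continuous fun s : ℝ => (s, z.im))).continuousAt
    filter_upwards [hc.preimage_mem_nhds hn] with s hs
    have := key _ hs
    simp only at this
    linarith
  have h2 : IsLocalMin (fun s : ℝ => 1 + m * (z.re * z.re + s * s) - (1 + m) * s) z.im := by
    have hc : ContinuousAt (fun s : ℝ => (⟨z.re, s⟩ : ℂ)) z.im :=
      (continuous_complex_mk.comp (by fun_prop : Continuous fun s : ℝ => (z.re, s))).continuousAt
    filter_upwards [hc.preimage_mem_nhds hn] with s hs
    have := key _ hs
    simp only at this
    linarith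
  have d1 := h1.hasDerivAt_eq_zero ((((((hasDerivAt_id z.re).mul (hasDerivAt_id z.re)).add_const
    (z.im * z.im)).const_mul m).const_add 1).sub_const ((1 + m) * z.im))
  have d2 := h2.hasDerivAt_eq_zero ((((((hasDerivAt_id z.im).mul (hasDerivAt_id z.im)).const_add
    (z.re * z.re)).const_mul m).const_add 1).sub ((hasDerivAt_id z.im).const_mul (1 + m)))
  simp only [id, one_mul, mul_one] at d1 d2
  have hx : z.re = 0 := by
    have : m * z.re = 0 := by linarith
    exact (mul_eq_zero.1 this).resolve_left hm.ne'
  rw [hx] at heq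
  have h3 : m * z.im ^ 2 = 1 := by linear_combination z.im * d2 + heq
  have h4 : (1 + m) ^ 2 = 4 * m := by
    linear_combination (-(2 * m * z.im) - (1 + m)) * d2 + 4 * m * h3
  nlinarith

theorem isMinimalImmersionOn_catenoidGraph {κ : ℝ} (hκ : 0 < κ) :
    IsMinimalImmersionOn (catenoidGraph κ)
      {q | (⟨q.1, q.2⟩ : ℂ) ∈ interior (dilatedDomain κ)} := by
  have hκ' : -1 < κ := by linarith
  have hm := neckHeightSq_pos hκ
  have hm1 := neckHeightSq_lt_one hκ'
  set U := {q : ℝ × ℝ | (⟨q.1, q.2⟩ : ℂ) ∈ interior (dilatedDomain κ)} with hUdef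
  have hU : IsOpen U := isOpen_interior.preimage continuous_complex_mk
  have hpos : ∀ q ∈ U, 0 < q.2 := fun q hq => (lt_of_mem_interior_dilatedDomain hκ hq).1
  have hlev : ∀ q ∈ U, 1 + neckHeightSq κ < levelFun (neckHeightSq κ) q := by
    intro q hq
    obtain ⟨h1, h2⟩ := lt_of_mem_interior_dilatedDomain hκ hq
    simp only at h1 h2
    rw [levelFun, lt_div_iff₀ h1]
    rw [Complex.normSq_apply] at h2
    simp only at h2
    linarith
  have hEq : ∀ q ∈ U, dilatedTime κ ⟨q.1, q.2⟩ = levelTime κ (levelFun (neckHeightSq κ) q) := by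
    intro q hq
    have hy := hpos q hq
    obtain ⟨h1, -, -, -⟩ := levelTime_arg_mem hm hm1 (hlev q hq)
    rw [dilatedTime_eq hκ (interior_subset hq), levelTime]
    congr 2
    -- Dividing numerator and denominator of `cosAngle` by $y$ leaves a function of the level alone.
    have hS := Real.sqrt_pos.2 h1
    have : √((1 + neckHeightSq κ * Complex.normSq ⟨q.1, q.2⟩) ^ 2 - 4 * neckHeightSq κ * q.2 ^ 2) =
        q.2 * √(levelFun (neckHeightSq κ) q ^ 2 - 4 * neckHeightSq κ) := by
      rw [← Real.sqrt_sq hy.le, ← Real.sqrt_mul (sq_nonneg _), Real.sqrt_sq hy.le]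
      congr 1
      rw [levelFun, Complex.normSq_apply]
      field_simp
    rw [cosAngle, this]
    field_simp
  set m := neckHeightSq κ
  have hlevp := fun q (hq : q ∈ U) => hasPartials_levelFun m (hpos q hq).ne'
  set P : ℝ → ℝ := fun E => (1 - m) / √((E ^ 2 - 4 * m) * (E ^ 2 - (1 + m) ^ 2)) with hPdef
  set P' : ℝ → ℝ := fun E => -(P E * (E * (2 * E ^ 2 - 4 * m - (1 + m) ^ 2))) /
    ((E ^ 2 - 4 * m) * (E ^ 2 - (1 + m) ^ 2)) with hP'def
  have hPd : ∀ q ∈ U, HasDerivAt P (P' (levelFun m q)) (levelFun m q) := by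
    intro q hq
    obtain ⟨h1, h2, -, -⟩ := levelTime_arg_mem hm hm1 (hlev q hq)
    set E := levelFun m q
    have hS := Real.sqrt_pos.2 (mul_pos h1 h2)
    have hS2 := Real.sq_sqrt (mul_pos h1 h2).le
    have hd := (hasDerivAt_const E (1 - m)).div (((((hasDerivAt_id E).pow 2).sub_const (4 * m)).mul
      (((hasDerivAt_id E).pow 2).sub_const ((1 + m) ^ 2))).sqrt
      (by simpa using ⟨h1.ne', h2.ne'⟩)) (by simpa using hS.ne')
    refine HasDerivAt.congr_deriv (f := P) hd ?_
    simp only [hP'def, hPdef, id, Pi.pow_apply, Pi.mul_apply]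
    generalize √((E ^ 2 - 4 * m) * (E ^ 2 - (1 + m) ^ 2)) = S at hS hS2
    rw [← hS2]
    field_simp
    simp
    ring
  refine isMinimalImmersionOn_graph hU hpos (u := fun q => dilatedTime κ ⟨q.1, q.2⟩)
    (ux := fun q => P (levelFun m q) * (2 * m * q.1 / q.2))
    (uy := fun q => P (levelFun m q) * (2 * m - levelFun m q / q.2))
    (uxx := fun q => P' (levelFun m q) * (2 * m * q.1 / q.2) ^ 2 + P (levelFun m q) * (2 * m / q.2))
    (uxy := fun q => P' (levelFun m q) * ((2 * m * q.1 / q.2) * (2 * m - levelFun m q / q.2)) +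
      P (levelFun m q) * -(2 * m * q.1 / q.2 ^ 2))
    (uyy := fun q => P' (levelFun m q) * (2 * m - levelFun m q / q.2) ^ 2 +
      P (levelFun m q) * (2 * levelFun m q / q.2 ^ 2 - 2 * m / q.2)) ?_ ?_ ?_ ?_ ?_
  · refine ContDiffOn.congr ?_ hEq
    refine (contDiffOn_levelTime hκ).comp ?_ hlev
    unfold levelFun
    exact ContDiffOn.div (by fun_prop) (by fun_prop) fun q hq => (hpos q hq).ne'
  · intro q hq
    exact ((hasDerivAt_levelTime hκ (hlev q hq)).comp_hasPartials (hlevp q hq)).congr_of_eventuallyEq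
      (eventually_of_mem (hU.mem_nhds hq) hEq)
  · intro q hq
    have hy := (hpos q hq).ne'
    have h1 : HasPartials (fun q : ℝ × ℝ => 2 * m * q.1 / q.2) q (2 * m / q.2)
        (-(2 * m * q.1 / q.2 ^ 2)) := by
      refine hasPartials_of_hasDerivAt (by fun_prop (disch := assumption)) ?_ ?_
      · simpa using ((hasDerivAt_id q.1).const_mul (2 * m)).div_const q.2
      · refine ((hasDerivAt_const q.2 (2 * m * q.1)).div (hasDerivAt_id q.2) hy).congr_deriv ?_
        simp
        ring
    refine (((hPd q hq).comp_hasPartials (hlevp q hq)).mul h1).congr_partials ?_ ?_ <;> ring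
  · intro q hq
    have hy := (hpos q hq).ne'
    have h1 : HasPartials (fun q : ℝ × ℝ => 2 * m - levelFun m q / q.2) q (-(2 * m * q.1 / q.2 ^ 2))
        (2 * levelFun m q / q.2 ^ 2 - 2 * m / q.2) := by
      refine hasPartials_of_hasDerivAt ?_ ?_ ?_
      · unfold levelFun
        fun_prop (disch := assumption)
      · have := ((((((hasDerivAt_id q.1).pow 2).add_const (q.2 ^ 2)).const_mul m).const_add 1).div_const
          q.2).div_const q.2 |>.const_sub (2 * m)
        refine HasDerivAt.congr_deriv (f := fun s => 2 * m - levelFun m (s, q.2) / q.2) this ?_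
        simp
        field_simp
      · have := ((((((hasDerivAt_id q.2).pow 2).const_add (q.1 ^ 2)).const_mul m).const_add 1).div
          (hasDerivAt_id q.2) hy).div (hasDerivAt_id q.2) hy |>.const_sub (2 * m)
        refine HasDerivAt.congr_deriv (f := fun s => 2 * m - levelFun m (q.1, s) / s) this ?_
        simp [levelFun]
        field_simp
        ring
    refine (((hPd q hq).comp_hasPartials (hlevp q hq)).mul h1).congr_partials ?_ ?_ <;> ring
  · intro q hq
    have hy := (hpos q hq).ne'
    obtain ⟨h1, h2, -, -⟩ := levelTime_arg_mem hm hm1 (hlev q hq)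
    have hQ := mul_pos h1 h2
    refine catenoid_minimal_equation (P := P (levelFun m q)) (P' := P' (levelFun m q)) hy rfl
      hQ.ne' ?_ ?_ ?_ _ _ rfl rfl _ _ _ rfl rfl rfl
    · simp only [hPdef]
      rw [div_pow, Real.sq_sqrt hQ.le, div_mul_cancel₀ _ hQ.ne']
    · simp only [hP'def]
      field_simp
    · rw [levelFun]
      field_simp

end

/-! ### Convergence to the parabolic catenoid -/

noncomputable section

theorem continuousAt_timeDefect_comp {α : Type*} [TopologicalSpace α] {f g : α → ℝ} {a : α}
    (hf : ContinuousAt f a) (hg : ContinuousAt g a) (hκ : -1 < f a) :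
    ContinuousAt (fun x => timeDefect (f x) (g x)) a :=
  ContinuousAt.comp (f := fun x => (f x, g x)) (g := fun p : ℝ × ℝ => timeDefect p.1 p.2)
    (contDiffAt_timeDefect hκ (g a)).continuousAt (hf.prodMk hg)

/-- Thanks to the factor $\kappa$ in `angleTime`, only continuity of `timeDefect` is needed to
differentiate at $\kappa=0$. -/
theorem hasDerivAt_mul_self_of_continuousAt {g : ℝ → ℝ} (hg : ContinuousAt g 0) :
    HasDerivAt (fun κ => κ * g κ) (g 0) 0 := by
  rw [hasDerivAt_iff_tendsto_slope]
  refine (hg.tendsto.mono_left nhdsWithin_le_nhds).congr' ?_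
  filter_upwards [self_mem_nhdsWithin] with κ hκ
  have : κ ≠ 0 := hκ
  simp [slope_def_field]
  field_simp

theorem hasDerivAt_cosAngle_zero (z : ℂ) : HasDerivAt (fun κ => cosAngle κ z)
    (-(z.im + z.im * z.re ^ 2 - z.im ^ 3) / 4) 0 := by
  have hm := hasDerivAt_neckHeightSq_zero
  have h := ((hm.const_sub 1).mul_const z.im).div
    (((((hm.mul_const (Complex.normSq z)).const_add 1).pow 2).sub
      ((hm.const_mul 4).mul_const (z.im ^ 2))).sqrt (by simp [neckHeightSq_zero]))
      (by simp [neckHeightSq_zero])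
  refine HasDerivAt.congr_deriv (f := fun κ => cosAngle κ z) h ?_
  simp [neckHeightSq_zero, Complex.normSq_apply]
  ring

theorem cosAngle_zero (z : ℂ) : cosAngle 0 z = z.im := by simp [cosAngle, neckHeightSq_zero]

theorem catenoidGraph_eventuallyEq {x y : ℝ} (hy : 0 < y) (hy1 : y ≤ 1) :
    (fun κ => catenoidGraph κ (x, y)) =ᶠ[𝓝[>] 0]
      fun κ => ((⟨x, y⟩ : ℂ), angleTime κ (Real.arccos (cosAngle κ ⟨x, y⟩))) := by
  filter_upwards [self_mem_nhdsWithin] with κ hκ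
  rw [catenoidGraph, dilatedTime_eq hκ (strip_subset_dilatedDomain hκ ⟨hy, hy1⟩)]

theorem tendsto_catenoidGraph {x y : ℝ} (hy : 0 < y) (hy1 : y ≤ 1) :
    Tendsto (fun κ => catenoidGraph κ (x, y)) (𝓝[>] 0) (𝓝 (parabolicGraph (x, y))) := by
  refine Tendsto.congr' (catenoidGraph_eventuallyEq hy hy1).symm ?_
  have h1 : ContinuousAt (fun κ => Real.arccos (cosAngle κ ⟨x, y⟩)) 0 :=
    Real.continuous_arccos.continuousAt.comp (hasDerivAt_cosAngle_zero ⟨x, y⟩).continuousAt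
  have h2 : ContinuousAt (fun κ => ((⟨x, y⟩ : ℂ),
      angleTime κ (Real.arccos (cosAngle κ ⟨x, y⟩)))) 0 := by
    refine continuousAt_const.prodMk (h1.add (continuousAt_id.mul ?_))
    exact continuousAt_timeDefect_comp continuousAt_id h1 (by norm_num)
  have h3 := h2.tendsto.mono_left (nhdsWithin_le_nhds (s := Set.Ioi 0))
  simpa only [angleTime_zero_left, cosAngle_zero, parabolicGraph] using h3

/-- The moving angle over a fixed point contributes $\frac14(y\sqrt{1-y^2}+x^2y/\sqrt{1-y^2})$, and
`timeDefect` contributes $-\frac14(\arccos y+y\sqrt{1-y^2})$; the terms $y\sqrt{1-y^2}$ cancel. -/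
theorem tendsto_slope_catenoidGraph {x y : ℝ} (hy : 0 < y) (hy1 : y < 1) :
    Tendsto (fun κ : ℝ => κ⁻¹ • (catenoidGraph κ (x, y) - parabolicGraph (x, y))) (𝓝[>] 0)
      (𝓝 (0, 1 / 4 * (x ^ 2 * y / √(1 - y ^ 2) - Real.arccos y))) := by
  have hz := cosAngle_zero ⟨x, y⟩
  simp only at hz
  have ha : HasDerivAt (fun κ => Real.arccos (cosAngle κ ⟨x, y⟩))
      (-(1 / √(1 - y ^ 2)) * (-(y + y * x ^ 2 - y ^ 3) / 4)) 0 := by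
    have h := (Real.hasDerivAt_arccos (x := cosAngle 0 ⟨x, y⟩) (by rw [hz]; linarith)
      (by rw [hz]; exact hy1.ne)).comp 0 (hasDerivAt_cosAngle_zero ⟨x, y⟩)
    rwa [hz] at h
  have hb := hasDerivAt_mul_self_of_continuousAt
    (continuousAt_timeDefect_comp continuousAt_id ha.continuousAt (by norm_num))
  have hT : HasDerivAt (fun κ => angleTime κ (Real.arccos (cosAngle κ ⟨x, y⟩)))
      (1 / 4 * (x ^ 2 * y / √(1 - y ^ 2) - Real.arccos y)) 0 := by
    refine HasDerivAt.congr_deriv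
      (f := fun κ => angleTime κ (Real.arccos (cosAngle κ ⟨x, y⟩))) (ha.add hb) ?_
    have hs : 0 < 1 - y ^ 2 := by nlinarith
    have hS := Real.sqrt_pos.2 hs
    have hS2 := Real.sq_sqrt hs.le
    rw [hz, id, timeDefect_zero_left, Real.sin_arccos, Real.cos_arccos (by linarith) hy1.le]
    generalize √(1 - y ^ 2) = S at hS hS2
    field_simp
    linear_combination (-y) * hS2
  have h := (hasDerivAt_const (0 : ℝ) (⟨x, y⟩ : ℂ)).prodMk hT
  refine Tendsto.congr' ?_ h.tendsto_slope_zero_right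
  filter_upwards [catenoidGraph_eventuallyEq (x := x) hy hy1.le] with κ hκ
  rw [hκ, zero_add, parabolicGraph, angleTime_zero_left, hz]

/-- The defining function of the dilated catenoids in terms of a point and its angle. -/
def angleDefect (κ : ℝ) (p : ℂ × ℝ) (ψ : ℝ) : ℝ :=
  Real.cos ψ * (1 + neckHeightSq κ * Complex.normSq p.1) -
    (1 - neckHeightSq κ) * √(1 + κ * Real.cos ψ ^ 2) * p.1.im

theorem exists_angle_of_mem {κ : ℝ} (hκ : 0 < κ) {p : ℂ × ℝ} (hp : p ∈ dilatedCatenoid κ) :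
    0 < p.1.im ∧ ∃ ψ, |ψ| < Real.pi / 2 ∧ p.2 = angleTime κ ψ ∧ |ψ - p.2| ≤ κ * 2 ∧
      angleDefect κ p ψ = 0 := by
  obtain ⟨hy, ψ, hψ, ht, h⟩ := (mem_dilatedCatenoid_iff hκ p).1 hp
  refine ⟨hy, ψ, hψ, ht, ?_, sub_eq_zero.2 h⟩
  have h1 : ψ - p.2 = -(κ * timeDefect κ ψ) := by
    rw [ht, angleTime]
    ring
  rw [h1, abs_neg, abs_mul, abs_of_pos hκ]
  have := abs_timeDefect_le hκ.le ψ
  -- The constant $2$ bounds $\pi/2>|\psi|$.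
  have := Real.pi_le_four
  gcongr
  linarith

theorem exists_disjoint_nhds {p : ℂ × ℝ} (hy : 0 < p.1.im)
    (hp : p ∉ parabolicStrip '' {q | |q.2| < Real.pi / 2}) :
    ∃ V ∈ 𝓝 p, ∀ᶠ κ in 𝓝[>] (0 : ℝ), Disjoint (dilatedCatenoid κ) V := by
  rcases lt_or_ge (Real.pi / 2) |p.2| with ht | ht
  · refine ⟨{p' | Real.pi / 2 < |p'.2|},
      (isOpen_lt continuous_const (by fun_prop)).mem_nhds ht, ?_⟩
    filter_upwards [self_mem_nhdsWithin] with κ hκ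
    rw [Set.disjoint_left]
    intro p' hp' hV
    obtain ⟨-, ψ, hψ, ht', -, -⟩ := exists_angle_of_mem hκ hp'
    have hV' : Real.pi / 2 < |p'.2| := hV
    rw [ht', abs_angleTime (by linarith [show (0 : ℝ) < κ from hκ])] at hV'
    linarith [angleTime_le_self (κ := κ) (le_of_lt hκ) (abs_nonneg ψ)]
  -- At $\kappa=0$ the defect is $\cos t-y$. It does not vanish at $|t|=\pi/2$ either, since $y>0$.
  -- Continuity in $(\kappa,p,\psi)$ together with $|\psi-t|\le2\kappa$ then keeps it nonzero
  -- nearby.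
  · have hne : angleDefect 0 p p.2 ≠ 0 := by
      intro h
      simp only [angleDefect, neckHeightSq_zero] at h
      simp at h
      refine hp ⟨(p.1.re, p.2), ?_, ?_⟩
      · refine lt_of_le_of_ne ht fun h2 => ?_
        have : Real.cos p.2 = 0 := by rw [← Real.cos_abs, h2, Real.cos_pi_div_two]
        linarith
      · refine Prod.ext (Complex.ext rfl ?_) rfl
        simp only [parabolicStrip]
        linarith
    have hc : ContinuousAt (fun P : ℝ × ((ℂ × ℝ) × ℝ) => angleDefect P.1 P.2.1 P.2.2)
        (0, (p, p.2)) := by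
      have hm : ContinuousAt (fun P : ℝ × ((ℂ × ℝ) × ℝ) => neckHeightSq P.1) (0, (p, p.2)) :=
        ContinuousAt.comp (g := neckHeightSq) hasDerivAt_neckHeightSq_zero.continuousAt
          continuousAt_fst
      have hN : Continuous fun P : ℝ × ((ℂ × ℝ) × ℝ) => Complex.normSq P.2.1.1 :=
        Complex.continuous_normSq.comp (by fun_prop)
      have hi : Continuous fun P : ℝ × ((ℂ × ℝ) × ℝ) => P.2.1.1.im :=
        Complex.continuous_im.comp (by fun_prop)
      unfold angleDefect
      fun_prop
    obtain ⟨ε, hε, hball⟩ := Metric.eventually_nhds_iff.1 (hc.eventually_ne hne)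
    refine ⟨Metric.ball p (ε / 2), Metric.ball_mem_nhds p (by positivity), ?_⟩
    filter_upwards [Ioo_mem_nhdsGT (show (0 : ℝ) < ε / 4 by positivity)] with κ hκ
    rw [Set.disjoint_left]
    intro p' hp' hV
    obtain ⟨-, ψ, hψ, ht', hd, h0⟩ := exists_angle_of_mem hκ.1 hp'
    rw [Metric.mem_ball] at hV
    refine hball (y := (κ, (p', ψ))) ?_ h0
    have h1 : dist p'.2 p.2 < ε / 2 := (le_max_right _ _).trans_lt hV
    rw [Real.dist_eq] at h1
    have h2 : |ψ - p.2| < ε := by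
      calc |ψ - p.2| ≤ |ψ - p'.2| + |p'.2 - p.2| := abs_sub_le _ _ _
        _ < ε := by linarith [hκ.2]
    rw [Prod.dist_eq, Prod.dist_eq, Real.dist_eq, Real.dist_eq, sub_zero, abs_of_pos hκ.1]
    exact max_lt (by linarith [hκ.2]) (max_lt (by linarith) h2)

/-! ### The deformation of the parabolic catenoid -/

/-- The second coordinate of the dilated catenoid over `x` at the angle `ψ`: the small root of
`m c y² - B y + c (1 + m x²) = 0`, where `m = μ₀²`, `c = cos ψ`, `B = (1 - m) √(1 + κ c²)`. -/
def sheetHeight (κ x ψ : ℝ) : ℝ :=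
  2 * Real.cos ψ * (1 + neckHeightSq κ * x ^ 2) /
    ((1 - neckHeightSq κ) * √(1 + κ * Real.cos ψ ^ 2) +
      √((1 - neckHeightSq κ) ^ 2 - 4 * neckHeightSq κ ^ 2 * Real.cos ψ ^ 2 * x ^ 2))

/-- The deformation of the parabolic catenoid into the dilated catenoids. -/
def sheet (p : ℝ × (ℝ × ℝ)) : ℂ × ℝ :=
  (⟨p.2.1, sheetHeight p.1 p.2.1 p.2.2⟩, angleTime p.1 p.2.2)

/-- By $\kappa(1-m)^2=4m$ the discriminant $B^2-4mc^2(1+mx^2)$ equals $(1-m)^2-4m^2c^2x^2$. Writing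
the root with the radical in the denominator avoids dividing by $m$, so it stays smooth at
$\kappa=0$. -/
theorem sheetHeight_equation {κ x ψ : ℝ} (hκ : -1 < κ)
    (hD : 0 < (1 - neckHeightSq κ) ^ 2 - 4 * neckHeightSq κ ^ 2 * Real.cos ψ ^ 2 * x ^ 2) :
    Real.cos ψ * (1 + neckHeightSq κ * (x ^ 2 + sheetHeight κ x ψ ^ 2)) =
      (1 - neckHeightSq κ) * √(1 + κ * Real.cos ψ ^ 2) * sheetHeight κ x ψ := by
  have hm1 := neckHeightSq_lt_one hκ
  have hk := mul_one_sub_neckHeightSq_sq hκ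
  have hp := one_add_mul_cos_sq_pos hκ ψ
  have hq := Real.sqrt_pos.2 hp
  have hq2 := Real.sq_sqrt hp.le
  have hs := Real.sqrt_pos.2 hD
  have hs2 := Real.sq_sqrt hD.le
  have hB : 0 < (1 - neckHeightSq κ) * √(1 + κ * Real.cos ψ ^ 2) := mul_pos (by linarith) hq
  rw [sheetHeight]
  generalize √(1 + κ * Real.cos ψ ^ 2) = q at *
  generalize √((1 - neckHeightSq κ) ^ 2 - 4 * neckHeightSq κ ^ 2 * Real.cos ψ ^ 2 * x ^ 2) = s at *
  generalize Real.cos ψ = c at *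
  generalize neckHeightSq κ = m at *
  have hne : (1 - m) * q + s ≠ 0 := by positivity
  field_simp
  linear_combination c * (1 + m * x ^ 2) * (hs2 - (1 - m) ^ 2 * hq2 - c ^ 2 * hk)

/-- A root with $2my<1-m$ has $B-2mcy>0$. This quantity is then the positive square root of the
discriminant, so the root is the small one. -/
theorem eq_sheetHeight {κ x y ψ : ℝ} (hκ : 0 < κ) (hψ : |ψ| < Real.pi / 2)
    (hy : 2 * neckHeightSq κ * y < 1 - neckHeightSq κ) (hy0 : 0 < y)
    (h : Real.cos ψ * (1 + neckHeightSq κ * (x ^ 2 + y ^ 2)) =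
      (1 - neckHeightSq κ) * √(1 + κ * Real.cos ψ ^ 2) * y) : sheetHeight κ x ψ = y := by
  have hκ' : -1 < κ := by linarith
  have hc : 0 < Real.cos ψ := Real.cos_pos_of_mem_Ioo (abs_lt.1 hψ)
  have hm := neckHeightSq_pos hκ
  have hm1 := neckHeightSq_lt_one hκ'
  have hk := mul_one_sub_neckHeightSq_sq hκ'
  have hp := one_add_mul_cos_sq_pos hκ' ψ
  have hq : 1 ≤ √(1 + κ * Real.cos ψ ^ 2) := by
    rw [Real.one_le_sqrt]
    have : 0 < κ * Real.cos ψ ^ 2 := by positivity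
    linarith
  have hq2 := Real.sq_sqrt hp.le
  have hc1 := Real.cos_le_one ψ
  have hB : 1 - neckHeightSq κ ≤ (1 - neckHeightSq κ) * √(1 + κ * Real.cos ψ ^ 2) :=
    le_mul_of_one_le_right (by linarith) hq
  have hle : 2 * neckHeightSq κ * Real.cos ψ * y < 1 - neckHeightSq κ := by
    refine lt_of_le_of_lt ?_ hy
    rw [mul_right_comm]
    exact mul_le_of_le_one_right (by positivity) hc1
  have hs : √((1 - neckHeightSq κ) ^ 2 - 4 * neckHeightSq κ ^ 2 * Real.cos ψ ^ 2 * x ^ 2) =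
      (1 - neckHeightSq κ) * √(1 + κ * Real.cos ψ ^ 2) - 2 * neckHeightSq κ * Real.cos ψ * y := by
    rw [← Real.sqrt_sq (show 0 ≤ (1 - neckHeightSq κ) * √(1 + κ * Real.cos ψ ^ 2) -
      2 * neckHeightSq κ * Real.cos ψ * y by linarith)]
    congr 1
    linear_combination (-4 * neckHeightSq κ * Real.cos ψ) * h - (1 - neckHeightSq κ) ^ 2 * hq2 -
      Real.cos ψ ^ 2 * hk
  rw [sheetHeight, hs, div_eq_iff]
  · linear_combination 2 * h
  · have : 0 < neckHeightSq κ * Real.cos ψ * y := by positivity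
    linarith

/-- The set on which `sheet` is smooth. -/
def sheetSource : Set (ℝ × (ℝ × ℝ)) :=
  {p | -1 < p.1} ∩ ({p | |p.2.2| < Real.pi / 2} ∩ {p | 0 < (1 - neckHeightSq p.1) ^ 2 -
    4 * neckHeightSq p.1 ^ 2 * Real.cos p.2.2 ^ 2 * p.2.1 ^ 2})

theorem contDiffOn_neckHeightSq_fst :
    ContDiffOn ℝ ∞ (fun p : ℝ × (ℝ × ℝ) => neckHeightSq p.1) {p | -1 < p.1} :=
  contDiffOn_neckHeightSq.comp contDiffOn_fst fun _ hp => hp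

theorem contDiffOn_sheet_discriminant : ContDiffOn ℝ ∞ (fun p : ℝ × (ℝ × ℝ) =>
    (1 - neckHeightSq p.1) ^ 2 - 4 * neckHeightSq p.1 ^ 2 * Real.cos p.2.2 ^ 2 * p.2.1 ^ 2)
    {p | -1 < p.1} := by
  have := contDiffOn_neckHeightSq_fst
  fun_prop

theorem isOpen_sheetSource : IsOpen sheetSource := by
  have h1 : IsOpen {p : ℝ × (ℝ × ℝ) | -1 < p.1} := isOpen_lt continuous_const continuous_fst
  have h2 : IsOpen {p : ℝ × (ℝ × ℝ) | |p.2.2| < Real.pi / 2} :=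
    isOpen_lt (by fun_prop) continuous_const
  have h3 := contDiffOn_sheet_discriminant.continuousOn.isOpen_inter_preimage h1
    (isOpen_Ioi (a := (0 : ℝ)))
  have : sheetSource = {p | |p.2.2| < Real.pi / 2} ∩ ({p | -1 < p.1} ∩
      (fun p : ℝ × (ℝ × ℝ) => (1 - neckHeightSq p.1) ^ 2 -
        4 * neckHeightSq p.1 ^ 2 * Real.cos p.2.2 ^ 2 * p.2.1 ^ 2) ⁻¹' Set.Ioi 0) := by
    rw [sheetSource, Set.inter_left_comm]
    rfl
  rw [this]
  exact h2.inter h3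

theorem contDiffOn_sheet : ContDiffOn ℝ ∞ sheet sheetSource := by
  have hsub : sheetSource ⊆ {p | -1 < p.1} := Set.inter_subset_left
  have hm := contDiffOn_neckHeightSq_fst.mono hsub
  have hq : ContDiffOn ℝ ∞ (fun p : ℝ × (ℝ × ℝ) => √(1 + p.1 * Real.cos p.2.2 ^ 2)) sheetSource :=
    ContDiffOn.sqrt (by fun_prop) fun p hp => (one_add_mul_cos_sq_pos (hsub hp) _).ne'
  have hs := (contDiffOn_sheet_discriminant.mono hsub).sqrt fun p hp => ne_of_gt hp.2.2
  have hY : ContDiffOn ℝ ∞ (fun p : ℝ × (ℝ × ℝ) => sheetHeight p.1 p.2.1 p.2.2) sheetSource := by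
    unfold sheetHeight
    refine ContDiffOn.div (by fun_prop) ((contDiffOn_const.sub hm).mul hq |>.add hs) fun p hp => ?_
    have h1 := Real.sqrt_pos.2 (one_add_mul_cos_sq_pos (hsub hp) p.2.2)
    have h2 := neckHeightSq_lt_one (hsub hp)
    have h3 := Real.sqrt_pos.2 hp.2.2
    have := mul_pos (sub_pos.2 h2) h1
    positivity
  have hT : ContDiffOn ℝ ∞ (fun p : ℝ × (ℝ × ℝ) => angleTime p.1 p.2.2) sheetSource :=
    contDiffOn_angleTime.comp (f := fun p : ℝ × (ℝ × ℝ) => (p.1, p.2.2)) (by fun_prop) hsub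
  exact (contDiff_complex_mk.comp_contDiffOn
    (ContDiffOn.prodMk (f := fun p : ℝ × (ℝ × ℝ) => p.2.1) (by fun_prop) hY)).prodMk hT

theorem isSmoothDeformation_sheet :
    IsSmoothDeformation dilatedCatenoid parabolicStrip {q | |q.2| < Real.pi / 2} sheet := by
  refine ⟨?_, ⟨sheetSource, isOpen_sheetSource, ?_, contDiffOn_sheet, ?_⟩, ?_⟩
  · intro q hq
    refine Prod.ext (Complex.ext rfl ?_) (angleTime_zero_left _)
    simp [sheet, sheetHeight, parabolicStrip, neckHeightSq_zero]
    norm_num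
  · intro q hq
    refine ⟨by norm_num, hq, ?_⟩
    simp [neckHeightSq_zero]
  · rintro κ ⟨x, ψ⟩ hκ ⟨hκ', hψ, hD⟩
    have hc : 0 < Real.cos ψ := Real.cos_pos_of_mem_Ioo (abs_lt.1 hψ)
    have hm := neckHeightSq_pos hκ
    have hm1 := neckHeightSq_lt_one hκ'
    have hp := Real.sqrt_pos.2 (one_add_mul_cos_sq_pos hκ' ψ)
    rw [mem_dilatedCatenoid_iff hκ]
    refine ⟨?_, ψ, hψ, rfl, ?_⟩
    · show 0 < sheetHeight κ x ψ
      rw [sheetHeight]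
      have := mul_pos (sub_pos.2 hm1) hp
      positivity
    · have := sheetHeight_equation hκ' hD
      simpa [sheet, Complex.normSq_apply, sq] using this
  · rintro ⟨x₀, t₀⟩ hq N hN
    obtain ⟨ε, hε, hball⟩ := Metric.mem_nhds_iff.1 hN
    -- The bound $y<2$ leaves room above $\cos t_0\le1$ and excludes the large root, which escapes
    -- to infinity.
    refine ⟨{p | |p.1.re - x₀| < ε ∧ |p.2 - t₀| < ε / 2 ∧ p.1.im < 2}, ?_, ?_⟩
    · refine IsOpen.mem_nhds ?_ ?_
      · have h1 : Continuous fun p : ℂ × ℝ => p.1.re := Complex.continuous_re.comp continuous_fst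
        have h2 : Continuous fun p : ℂ × ℝ => p.1.im := Complex.continuous_im.comp continuous_fst
        exact (isOpen_lt (h1.sub continuous_const).abs continuous_const).inter
          ((isOpen_lt (continuous_snd.sub continuous_const).abs continuous_const).inter (isOpen_lt h2 continuous_const))
      · refine ⟨by simpa [parabolicStrip] using hε, by simpa [parabolicStrip] using hε, ?_⟩
        show Real.cos t₀ < 2
        linarith [Real.cos_le_one t₀]
    -- With $y<2$, the bound $m<1/5$ gives $2my<4m<1-m$, as `eq_sheetHeight` requires.
    · have hm0 : ∀ᶠ κ in 𝓝[>] (0 : ℝ), neckHeightSq κ < 1 / 5 := by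
        refine nhdsWithin_le_nhds (hasDerivAt_neckHeightSq_zero.continuousAt.eventually
          (gt_mem_nhds ?_))
        rw [neckHeightSq_zero]
        norm_num
      filter_upwards [hm0, Ioo_mem_nhdsGT (show (0 : ℝ) < ε / 4 by positivity)]
        with κ hm hκ p hp
      obtain ⟨hpS, h1, h2, h3⟩ := hp
      obtain ⟨hy, ψ, hψ, ht, hd, h0⟩ := exists_angle_of_mem hκ.1 hpS
      refine ⟨(p.1.re, ψ), hball ?_, ?_⟩
      · have h4 : |ψ - t₀| < ε := by
          calc |ψ - t₀| ≤ |ψ - p.2| + |p.2 - t₀| := abs_sub_le _ _ _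
            _ < ε := by linarith [hκ.2]
        rw [Metric.mem_ball, Prod.dist_eq, Real.dist_eq, Real.dist_eq]
        exact max_lt h1 h4
      · refine Prod.ext (Complex.ext rfl ?_) ht.symm
        have hmp := neckHeightSq_pos hκ.1
        refine eq_sheetHeight hκ.1 hψ (by nlinarith) hy ?_
        have := sub_eq_zero.1 h0
        rwa [Complex.normSq_apply, ← sq, ← sq] at this

/-! ### Reparametrizations and translations of deformations -/

/-- Openness of `φ`, assumed pointwise in `hopen`, is what carries the covering condition over. -/
theorem IsSmoothDeformation.comp_param {S : ℝ → Set (ℂ × ℝ)} {F F' : ℝ × ℝ → ℂ × ℝ}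
    {U U' : Set (ℝ × ℝ)} {G : ℝ × (ℝ × ℝ) → ℂ × ℝ} (h : IsSmoothDeformation S F U G)
    {φ : ℝ × ℝ → ℝ × ℝ} (hU' : IsOpen U') (hφ : ContDiffOn ℝ ∞ φ U') (hmaps : Set.MapsTo φ U' U)
    (hopen : ∀ q ∈ U', ∀ N ∈ 𝓝 q, φ '' N ∈ 𝓝 (φ q)) (hF : ∀ q ∈ U', F' q = F (φ q)) :
    IsSmoothDeformation S F' U' fun p => G (p.1, φ p.2) := by
  obtain ⟨W, hW, hUW, hG, hS⟩ := h.smooth_mem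
  have hφ' : ContDiffOn ℝ ∞ (fun p : ℝ × (ℝ × ℝ) => (p.1, φ p.2)) (Prod.snd ⁻¹' U') :=
    contDiffOn_fst.prodMk (hφ.comp contDiffOn_snd fun _ hp => hp)
  refine ⟨fun q hq => by rw [hF q hq, h.zero _ (hmaps hq)], ⟨Prod.snd ⁻¹' U' ∩
    (fun p : ℝ × (ℝ × ℝ) => (p.1, φ p.2)) ⁻¹' W, ?_, ?_, ?_, ?_⟩, ?_⟩
  · exact hφ'.continuousOn.isOpen_inter_preimage (hU'.preimage continuous_snd) hW
  · exact fun q hq => ⟨hq, hUW _ (hmaps hq)⟩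
  · exact hG.comp (hφ'.mono Set.inter_subset_left) fun _ hp => hp.2
  · exact fun κ q hκ hq => hS κ _ hκ hq.2
  · intro q hq N hN
    obtain ⟨V, hV, hsub⟩ := h.covers _ (hmaps hq) _ (hopen q hq N hN)
    refine ⟨V, by rwa [hF q hq], hsub.mono fun κ hκ => hκ.trans ?_⟩
    rintro _ ⟨_, ⟨q', hq', rfl⟩, rfl⟩
    exact ⟨q', hq', rfl⟩

theorem IsSmoothDeformation.translate {S : ℝ → Set (ℂ × ℝ)} {F : ℝ × ℝ → ℂ × ℝ}
    {U : Set (ℝ × ℝ)} {G : ℝ × (ℝ × ℝ) → ℂ × ℝ} (h : IsSmoothDeformation S F U G) (c : ℝ) :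
    IsSmoothDeformation (fun κ => (fun p : ℂ × ℝ => (p.1, p.2 + c)) '' S κ)
      (fun q => ((F q).1, (F q).2 + c)) U fun p => ((G p).1, (G p).2 + c) := by
  obtain ⟨W, hW, hUW, hG, hS⟩ := h.smooth_mem
  refine ⟨fun q hq => by rw [h.zero q hq], ⟨W, hW, hUW, ?_, ?_⟩, ?_⟩
  · exact hG.fst.prodMk (hG.snd.add contDiffOn_const)
  · exact fun κ q hκ hq => ⟨_, hS κ q hκ hq, rfl⟩
  · intro q hq N hN
    obtain ⟨V, hV, hsub⟩ := h.covers q hq N hN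
    refine ⟨(fun p : ℂ × ℝ => (p.1, p.2 - c)) ⁻¹' V, ?_, hsub.mono fun κ hκ => ?_⟩
    · refine ContinuousAt.preimage_mem_nhds (by fun_prop) ?_
      simpa using hV
    · rintro _ ⟨⟨p, hp, rfl⟩, hpV⟩
      have hpV' : p ∈ V := by simpa using hpV
      obtain ⟨q', hq', rfl⟩ := hκ ⟨hp, hpV'⟩
      exact ⟨q', hq', rfl⟩

/-- Besides the initial value, these two facts are all that the normal component of a deformation
depends on. -/
theorem IsSmoothDeformation.hasDerivAt_and_eventually_mem {S : ℝ → Set (ℂ × ℝ)}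
    {F : ℝ × ℝ → ℂ × ℝ} {U : Set (ℝ × ℝ)} {G : ℝ × (ℝ × ℝ) → ℂ × ℝ}
    (h : IsSmoothDeformation S F U G) {q : ℝ × ℝ} (hq : q ∈ U) :
    HasDerivAt (fun κ => G (κ, q)) (deriv (fun κ => G (κ, q)) 0) 0 ∧
      ∀ᶠ κ in 𝓝[>] (0 : ℝ), G (κ, q) ∈ S κ := by
  obtain ⟨W, hW, hUW, hG, hS⟩ := h.smooth_mem
  have hmem := hW.mem_nhds (hUW q hq)
  constructor
  · have h1 : DifferentiableAt ℝ G (0, q) :=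
      (hG.contDiffAt hmem).differentiableAt (by simp)
    exact (DifferentiableAt.comp (0 : ℝ) h1 (by fun_prop :
      DifferentiableAt ℝ (fun κ : ℝ => (κ, q)) 0)).hasDerivAt
  · have hc : ContinuousAt (fun κ : ℝ => (κ, q)) 0 := by fun_prop
    filter_upwards [nhdsWithin_le_nhds (hc.preimage_mem_nhds hmem), self_mem_nhdsWithin]
      with κ h1 h2 using hS κ q h2 h1

/-- The normal component of the velocity of a curve that runs through the dilated catenoids,
starting on the parabolic catenoid. -/
theorem normal_velocity {γ : ℝ → ℂ × ℝ} {v : ℂ × ℝ} {x t : ℝ} (hγ : HasDerivAt γ v 0)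
    (h0 : γ 0 = parabolicStrip (x, t)) (hmem : ∀ᶠ κ in 𝓝[>] (0 : ℝ), γ κ ∈ dilatedCatenoid κ) :
    -v.1.im - Real.sin t * v.2 = 1 / 4 * (t * Real.sin t - x ^ 2 * Real.cos t) := by
  have hev : ∀ᶠ κ in 𝓝[>] (0 : ℝ), ∃ ψ, |ψ| < Real.pi / 2 ∧ (γ κ).2 = angleTime κ ψ ∧
      |ψ - (γ κ).2| ≤ κ * 2 ∧ angleDefect κ (γ κ) ψ = 0 := by
    filter_upwards [hmem, self_mem_nhdsWithin] with κ h1 h2 using (exists_angle_of_mem h2 h1).2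
  obtain ⟨ψ₀, hψ₀⟩ := hev.choice
  -- The chosen angles exist only for small $\kappa>0$; the value at $0$ is prescribed so that
  -- one-sided slopes make sense.
  set ψ : ℝ → ℝ := fun κ => if κ = 0 then t else ψ₀ κ with hψdef
  have hψ0 : ψ 0 = t := by simp [hψdef]
  have hψ : ∀ᶠ κ in 𝓝[>] (0 : ℝ), 0 < κ ∧ (γ κ).2 = angleTime κ (ψ κ) ∧
      |ψ κ - (γ κ).2| ≤ κ * 2 ∧ angleDefect κ (γ κ) (ψ κ) = 0 := by
    filter_upwards [hψ₀, self_mem_nhdsWithin] with κ h1 h2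
    have h3 : ψ κ = ψ₀ κ := by
      have : κ ≠ 0 := ne_of_gt h2
      simp [hψdef, this]
    rw [h3]
    exact ⟨h2, h1.2⟩
  have hγ2 : HasDerivAt (fun κ => (γ κ).2) v.2 0 :=
    (ContinuousLinearMap.snd ℝ ℂ ℝ).hasFDerivAt.comp_hasDerivAt 0 hγ
  have hγ1 : HasDerivAt (fun κ => (γ κ).1) v.1 0 :=
    (ContinuousLinearMap.fst ℝ ℂ ℝ).hasFDerivAt.comp_hasDerivAt 0 hγ
  have hγre : HasDerivAt (fun κ => (γ κ).1.re) v.1.re 0 :=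
    Complex.reCLM.hasFDerivAt.comp_hasDerivAt 0 hγ1
  have hγim : HasDerivAt (fun κ => (γ κ).1.im) v.1.im 0 :=
    Complex.imCLM.hasFDerivAt.comp_hasDerivAt 0 hγ1
  have h02 : (γ 0).2 = t := by rw [h0, parabolicStrip]
  have h0re : (γ 0).1.re = x := by rw [h0, parabolicStrip]
  have h0im : (γ 0).1.im = Real.cos t := by rw [h0, parabolicStrip]
  have hψlim : Tendsto ψ (𝓝[>] 0) (𝓝 t) := by
    have h1 : Tendsto (fun κ => (γ κ).2) (𝓝[>] 0) (𝓝 t) := by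
      rw [← h02]
      exact hγ2.continuousAt.tendsto.mono_left nhdsWithin_le_nhds
    have h2 : Tendsto (fun κ => ψ κ - (γ κ).2) (𝓝[>] 0) (𝓝 0) := by
      refine squeeze_zero_norm' (a := fun κ => κ * 2) (hψ.mono fun κ h => h.2.2.1) ?_
      have : Tendsto (fun κ : ℝ => κ * 2) (𝓝 0) (𝓝 (0 * 2)) := tendsto_id.mul_const 2
      rw [zero_mul] at this
      exact this.mono_left nhdsWithin_le_nhds
    simpa using h2.add h1
  have hK : Tendsto (fun κ => timeDefect κ (ψ κ)) (𝓝[>] 0) (𝓝 (timeDefect 0 t)) :=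
    (contDiffAt_timeDefect (κ := 0) (by norm_num) t).continuousAt.tendsto.comp
      (((tendsto_id (α := ℝ) (x := 𝓝 0)).mono_left nhdsWithin_le_nhds).prodMk_nhds hψlim)
  -- Regularity of the choice is not assumed. Since $\psi=\gamma_2-\kappa T(\kappa,\psi)$, its slope
  -- is that of $\gamma_2$ minus $T(\kappa,\psi)$, and the latter converges because $\psi\to t$.
  have hψd : HasDerivWithinAt ψ (v.2 - timeDefect 0 t) (Set.Ioi 0) 0 := by
    rw [hasDerivWithinAt_iff_tendsto_slope' (by simp)]
    have h1 := (hasDerivWithinAt_iff_tendsto_slope' (by simp)).1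
      (hγ2.hasDerivWithinAt (s := Set.Ioi 0))
    refine (h1.sub hK).congr' ?_
    filter_upwards [hψ] with κ h
    have hκ := h.1
    have h3 : (γ κ).2 = ψ κ + κ * timeDefect κ (ψ κ) := h.2.1
    rw [slope_def_field, slope_def_field, h02, hψ0, h3, sub_zero]
    field_simp
    ring
  have hm := hasDerivAt_neckHeightSq_zero.hasDerivWithinAt (s := Set.Ioi 0)
  -- The defining equation holds identically along the curve, so its right derivative, computed term
  -- by term, is zero; the tangential part of $v$ enters only through $v_y$ and $v_t$ in the normal
  -- combination.
  have hD := (hψd.cos.mul ((hm.mul ((hγre.hasDerivWithinAt.mul hγre.hasDerivWithinAt).add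
    (hγim.hasDerivWithinAt.mul hγim.hasDerivWithinAt))).const_add 1)).sub
    (((hm.const_sub 1).mul ((((hasDerivWithinAt_id (0 : ℝ) (Set.Ioi 0)).mul
      (hψd.cos.pow 2)).const_add 1).sqrt (by simp))).mul hγim.hasDerivWithinAt)
  have hD0 : HasDerivWithinAt (fun κ => angleDefect κ (γ κ) (ψ κ)) 0 (Set.Ioi 0) 0 := by
    refine (hasDerivWithinAt_const (0 : ℝ) (Set.Ioi 0) (0 : ℝ)).congr_of_eventuallyEq ?_ ?_
    · filter_upwards [hψ] with κ h using h.2.2.2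
    · rw [angleDefect, h0im, hψ0, neckHeightSq_zero]
      simp
  have huniq := (uniqueDiffWithinAt_Ioi (0 : ℝ)).eq_deriv (Set.Ioi 0)
    (f := fun κ => angleDefect κ (γ κ) (ψ κ)) hD hD0
  simp [hψ0, neckHeightSq_zero, h0re, h0im, timeDefect_zero_left] at huniq
  have hsc := Real.sin_sq_add_cos_sq t
  linear_combination huniq + Real.cos t / 4 * hsc

end

/-! ### The Jacobi operator of surfaces with orthogonal coordinates -/

noncomputable section

theorem inv_diagonal_fin_two {a b : ℝ} (ha : a ≠ 0) (hb : b ≠ 0) :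
    (!![a, 0; 0, b] : Matrix (Fin 2) (Fin 2) ℝ)⁻¹ = !![a⁻¹, 0; 0, b⁻¹] := by
  refine Matrix.inv_eq_right_inv ?_
  ext i j
  fin_cases i <;> fin_cases j <;> simp [ha, hb]

/-- In coordinates with metric $\operatorname{diag}(a,b)$ the Laplacian loses its mixed terms. The
weights `α`, `β` are supplied in simplified form on all of `U` because they are differentiated. -/
theorem jacobiOperator_eq {F ν : ℝ × ℝ → ℂ × ℝ} {w a b α β w₀ w₁ : ℝ × ℝ → ℝ} {U : Set (ℝ × ℝ)}
    {q : ℝ × ℝ} {h₀₀ h₀₁ h₁₁ p₀ p₁ c d : ℝ} (hU : IsOpen U) (hq : q ∈ U)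
    (ha : ∀ q ∈ U, 0 < a q) (hb : ∀ q ∈ U, 0 < b q)
    (hI : ∀ q ∈ U, firstForm F q = !![a q, 0; 0, b q])
    (hα : ∀ q ∈ U, √(a q * b q) * (a q)⁻¹ = α q) (hβ : ∀ q ∈ U, √(a q * b q) * (b q)⁻¹ = β q)
    (hII : secondForm F (ν q) q = !![h₀₀, h₀₁; h₀₁, h₁₁])
    (hw : ∀ q ∈ U, HasPartials w q (w₀ q) (w₁ q))
    (h₀ : HasPartials (fun q => α q * w₀ q) q p₀ c)
    (h₁ : HasPartials (fun q => β q * w₁ q) q d p₁) :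
    jacobiOperator F ν w q = -((√(a q * b q))⁻¹ * (p₀ + p₁) + (ambientRicci (F q) (ν q) +
      (h₀₀ ^ 2 / a q ^ 2 + 2 * h₀₁ ^ 2 / (a q * b q) + h₁₁ ^ 2 / b q ^ 2)) * w q) := by
  have hnhds := hU.mem_nhds hq
  have hdet : ∀ q ∈ U, (firstForm F q).det = a q * b q := fun q hq => by
    rw [hI q hq, Matrix.det_fin_two_of]
    ring
  have hinv : ∀ q ∈ U, (firstForm F q)⁻¹ = !![(a q)⁻¹, 0; 0, (b q)⁻¹] := fun q hq => by
    rw [hI q hq, inv_diagonal_fin_two (ha q hq).ne' (hb q hq).ne']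
  have e00 := (h₀.congr_of_eventuallyEq (g := fun q' => √(firstForm F q').det *
      (firstForm F q')⁻¹ 0 0 * partialD 0 w q') (eventually_of_mem hnhds fun q' hq' => by
    beta_reduce
    rw [hdet q' hq', hinv q' hq', (hw q' hq').partialD_zero, ← hα q' hq']
    simp)).partialD_zero
  have e11 := (h₁.congr_of_eventuallyEq (g := fun q' => √(firstForm F q').det *
      (firstForm F q')⁻¹ 1 1 * partialD 1 w q') (eventually_of_mem hnhds fun q' hq' => by
    beta_reduce
    rw [hdet q' hq', hinv q' hq', (hw q' hq').partialD_one, ← hβ q' hq']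
    simp)).partialD_one
  have e01 := ((hasPartials_const (0 : ℝ)).congr_of_eventuallyEq
    (g := fun q' => √(firstForm F q').det * (firstForm F q')⁻¹ 0 1 * partialD 1 w q')
    (eventually_of_mem hnhds fun q' hq' => by
      beta_reduce
      rw [hinv q' hq']
      simp)).partialD_zero
  have e10 := ((hasPartials_const (0 : ℝ)).congr_of_eventuallyEq
    (g := fun q' => √(firstForm F q').det * (firstForm F q')⁻¹ 1 0 * partialD 0 w q')
    (eventually_of_mem hnhds fun q' hq' => by
      beta_reduce
      rw [hinv q' hq']
      simp)).partialD_one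
  have ha0 := (ha q hq).ne'
  have hb0 := (hb q hq).ne'
  rw [jacobiOperator, surfaceLaplacian, Fin.sum_univ_two, Fin.sum_univ_two, Fin.sum_univ_two,
    e00, e11, e01, e10, normSqSecondForm, hdet q hq, hinv q hq, hII]
  simp [Matrix.trace_fin_two]
  left
  field_simp
  ring

/-! ### Surfaces invariant under horizontal translation -/

section Profile

variable {f g : ℝ → ℝ} {I : Set ℝ}

theorem hasPartials_profile (hf : ∀ t, HasDerivAt f (g t) t) (q : ℝ × ℝ) :
    HasPartials (fun q : ℝ × ℝ => ((⟨q.1, f q.2⟩ : ℂ), q.2)) q ((⟨1, 0⟩ : ℂ), 0)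
      ((⟨0, g q.2⟩ : ℂ), 1) :=
  hasPartials_fst.mk (((hf q.2).comp_hasPartials hasPartials_snd).congr_partials (by simp)
    (by simp)) hasPartials_snd

/-- The relations $f'=g$, $f^2+g^2=1$ make the parametrization conformal; they hold for
$(\cos,-\sin)$ and $(\sin,\cos)$ alike. -/
theorem firstForm_profile (hf : ∀ t, HasDerivAt f (g t) t) (h1 : ∀ t, f t ^ 2 + g t ^ 2 = 1)
    {q : ℝ × ℝ} (hpos : 0 < f q.2) :
    firstForm (fun q : ℝ × ℝ => ((⟨q.1, f q.2⟩ : ℂ), q.2)) q =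
      !![1 / f q.2 ^ 2, 0; 0, 1 / f q.2 ^ 2] := by
  have e : g q.2 * g q.2 / f q.2 ^ 2 + 1 = (f q.2 ^ 2)⁻¹ := by
    field_simp
    linear_combination h1 q.2
  rw [firstForm_eq (A := ![((⟨1, 0⟩ : ℂ), 0), ((⟨0, g q.2⟩ : ℂ), 1)]) (hasPartials_profile hf q)]
  ext i j
  fin_cases i <;> fin_cases j <;> simp [ambientMetric, e]

theorem secondForm_profile (hf : ∀ t, HasDerivAt f (g t) t) (hg : ∀ t, HasDerivAt g (-f t) t)
    (h1 : ∀ t, f t ^ 2 + g t ^ 2 = 1) {q : ℝ × ℝ} (hpos : 0 < f q.2) (n : ℂ × ℝ) :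
    secondForm (fun q : ℝ × ℝ => ((⟨q.1, f q.2⟩ : ℂ), q.2)) n q =
      !![n.1.im / f q.2 ^ 3, -(g q.2 * n.1.re) / f q.2 ^ 3;
        -(g q.2 * n.1.re) / f q.2 ^ 3, -n.1.im / f q.2 ^ 3] := by
  have hIy : Complex.I / (f q.2 : ℂ) = ⟨0, 1 / f q.2⟩ := by
    apply Complex.ext <;> simp [Complex.div_re, Complex.div_im, Complex.normSq_apply]
  rw [secondForm_eq (A := ![fun _ => ((⟨1, 0⟩ : ℂ), 0), fun q => ((⟨0, g q.2⟩ : ℂ), 1)])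
    (B := ![![((⟨0, 0⟩ : ℂ), 0), ((⟨0, 0⟩ : ℂ), 0)],
      ![((⟨0, 0⟩ : ℂ), 0), ((⟨0, -f q.2⟩ : ℂ), 0)]])
    (Eventually.of_forall fun q => hasPartials_profile hf q) ?_]
  · have h := h1 q.2
    ext i j
    fin_cases i <;> fin_cases j <;> simp [ambientMetric, christoffel, hIy]
    · field_simp
    · field_simp
    · field_simp
    · field_simp
      linear_combination (-n.1.im) * h
  · intro j
    fin_cases j
    · exact (hasPartials_const 1).mk (hasPartials_const 0) (hasPartials_const 0)
    · exact (hasPartials_const 0).mk (((hg q.2).comp_hasPartials hasPartials_snd).congr_partials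
        (by simp) (by simp)) (hasPartials_const 1)

theorem isMinimalImmersionOn_profile (hsm : ContDiff ℝ ∞ f) (hf : ∀ t, HasDerivAt f (g t) t)
    (hg : ∀ t, HasDerivAt g (-f t) t) (h1 : ∀ t, f t ^ 2 + g t ^ 2 = 1)
    (hpos : ∀ t ∈ I, 0 < f t) :
    IsMinimalImmersionOn (fun q : ℝ × ℝ => ((⟨q.1, f q.2⟩ : ℂ), q.2)) {q | q.2 ∈ I} := by
  refine ⟨fun q hq => hpos _ hq, ?_, ?_, ?_⟩
  · exact ((contDiff_complex_mk.comp (contDiff_fst.prodMk (hsm.comp contDiff_snd))).prodMk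
      contDiff_snd).contDiffOn
  · intro q hq v w hvw
    rw [HasFDerivAt.fderiv (hasPartials_profile hf q)] at hvw
    have h4 := congrArg (fun p : ℂ × ℝ => p.1.re) hvw
    have h5 := congrArg (fun p : ℂ × ℝ => p.2) hvw
    simp at h4 h5
    exact Prod.ext h4 h5
  · intro q hq n _
    rw [trace_inv_mul_fin_two, firstForm_profile hf h1 (hpos _ hq),
      secondForm_profile hf hg h1 (hpos _ hq)]
    simp
    right
    ring

theorem isUnitNormal_profile (hf : ∀ t, HasDerivAt f (g t) t) (h1 : ∀ t, f t ^ 2 + g t ^ 2 = 1)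
    {q : ℝ × ℝ} (hpos : 0 < f q.2) :
    IsUnitNormal (fun q : ℝ × ℝ => ((⟨q.1, f q.2⟩ : ℂ), q.2)) q (⟨0, -f q.2 ^ 2⟩, g q.2) := by
  refine ⟨?_, fun i => ?_⟩
  · simp only [ambientMetric]
    field_simp
    linear_combination f q.2 ^ 2 * h1 q.2
  · fin_cases i
    · rw [Fin.mk_zero, (hasPartials_profile hf q).partialD_zero]
      simp [ambientMetric]
    · rw [Fin.mk_one, (hasPartials_profile hf q).partialD_one]
      simp [ambientMetric]
      field_simp
      ring

/-- Here $\mathrm{Ric}(\nu,\nu)=-f^2$ and $|A|^2=2f^2$, while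
$\Delta_g=f^2(\partial_x^2+\partial_t^2)$. The Jacobi equation is therefore $w_{xx}+w_{tt}+w=0$,
which is `heq`. -/
theorem jacobiOperator_profile (hI : IsOpen I) (hf : ∀ t, HasDerivAt f (g t) t)
    (hg : ∀ t, HasDerivAt g (-f t) t) (h1 : ∀ t, f t ^ 2 + g t ^ 2 = 1) (hpos : ∀ t ∈ I, 0 < f t)
    {w w₀ w₁ : ℝ × ℝ → ℝ} {q : ℝ × ℝ} {p₀ p₁ c d : ℝ} (hq : q.2 ∈ I)
    (hw : ∀ q, HasPartials w q (w₀ q) (w₁ q)) (h₀ : HasPartials w₀ q p₀ c)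
    (h₁ : HasPartials w₁ q d p₁) (heq : p₀ + p₁ = -w q) :
    jacobiOperator (fun q : ℝ × ℝ => ((⟨q.1, f q.2⟩ : ℂ), q.2))
      (fun q => (⟨0, -f q.2 ^ 2⟩, g q.2)) w q = 0 := by
  have hU : IsOpen {q : ℝ × ℝ | q.2 ∈ I} := hI.preimage continuous_snd
  have hsq : ∀ q : ℝ × ℝ, q.2 ∈ I → √(1 / f q.2 ^ 2 * (1 / f q.2 ^ 2)) = 1 / f q.2 ^ 2 :=
    fun q _ => Real.sqrt_mul_self (by positivity)
  have hone : ∀ q : ℝ × ℝ, q.2 ∈ I → √(1 / f q.2 ^ 2 * (1 / f q.2 ^ 2)) * (1 / f q.2 ^ 2)⁻¹ = 1 := by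
    intro q hq
    rw [hsq q hq]
    have := hpos _ hq
    field_simp
  rw [jacobiOperator_eq (a := fun q => 1 / f q.2 ^ 2) (b := fun q => 1 / f q.2 ^ 2)
    (α := fun _ => 1) (β := fun _ => 1) hU hq (fun q hq => by have := hpos _ hq; positivity)
    (fun q hq => by have := hpos _ hq; positivity)
    (fun q hq => firstForm_profile hf h1 (hpos _ hq)) hone hone
    (secondForm_profile hf hg h1 (hpos _ hq) _) (fun q _ => hw q) (by simpa using h₀)
    (by simpa using h₁), hsq q hq, heq]
  have := hpos _ hq
  simp [ambientRicci]
  field_simp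
  ring

end Profile

/-! ### Jacobi fields of the deformation into the catenoids -/

theorem image_mem_nhds_of_continuousAt_rightInverse {φ θ : ℝ × ℝ → ℝ × ℝ} {q : ℝ × ℝ}
    {N : Set (ℝ × ℝ)} (hN : N ∈ 𝓝 q) (hθ : ContinuousAt θ (φ q)) (hq : θ (φ q) = q)
    (hright : ∀ᶠ p in 𝓝 (φ q), φ (θ p) = p) : φ '' N ∈ 𝓝 (φ q) := by
  rw [← hq] at hN
  filter_upwards [hθ.preimage_mem_nhds hN, hright] with p h1 h2 using ⟨θ p, h1, h2⟩

theorem isJacobiField_parabolicStrip :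
    IsJacobiFieldOfDeformation dilatedCatenoid parabolicStrip
      (fun q => (⟨0, -Real.cos q.2 ^ 2⟩, -Real.sin q.2)) {q | |q.2| < Real.pi / 2}
      (fun q => 1 / 4 * (q.2 * Real.sin q.2 - q.1 ^ 2 * Real.cos q.2)) := by
  have hg : ∀ t, HasDerivAt (fun t => -Real.sin t) (-Real.cos t) t := fun t =>
    (Real.hasDerivAt_sin t).neg
  have h1 : ∀ t, Real.cos t ^ 2 + (-Real.sin t) ^ 2 = 1 := fun t => by
    rw [neg_sq, Real.cos_sq_add_sin_sq]
  have hpos : ∀ t ∈ {t : ℝ | |t| < Real.pi / 2}, 0 < Real.cos t := fun t ht =>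
    Real.cos_pos_of_mem_Ioo (abs_lt.1 ht)
  refine ⟨isMinimalImmersionOn_profile Real.contDiff_cos Real.hasDerivAt_cos hg h1 hpos, ?_,
    fun q hq => isUnitNormal_profile Real.hasDerivAt_cos h1 (hpos _ hq),
    ⟨sheet, isSmoothDeformation_sheet⟩, ?_, ?_⟩
  · refine ContDiff.contDiffOn (ContDiff.prodMk (contDiff_complex_mk.comp
      (f := fun q : ℝ × ℝ => ((0 : ℝ), -Real.cos q.2 ^ 2)) (by fun_prop)) (by fun_prop))
  · intro G hG q hq
    obtain ⟨hd, hmem⟩ := hG.hasDerivAt_and_eventually_mem hq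
    rw [← normal_velocity hd (hG.zero q hq) hmem]
    have := hpos _ hq
    simp only [ambientMetric, parabolicStrip]
    field_simp
    ring
  · intro q hq
    refine jacobiOperator_profile (isOpen_lt continuous_abs continuous_const) Real.hasDerivAt_cos hg
      h1 hpos hq (w₀ := fun q => 1 / 4 * -(2 * q.1 * Real.cos q.2))
      (w₁ := fun q => 1 / 4 * (Real.sin q.2 + q.2 * Real.cos q.2 + q.1 ^ 2 * Real.sin q.2))
      (p₀ := 1 / 4 * -(2 * Real.cos q.2)) (c := 1 / 4 * (2 * q.1 * Real.sin q.2))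
      (d := 1 / 4 * (2 * q.1 * Real.sin q.2))
      (p₁ := 1 / 4 * (2 * Real.cos q.2 - q.2 * Real.sin q.2 + q.1 ^ 2 * Real.cos q.2))
      (fun q => ?_) ?_ ?_ ?_
    · refine hasPartials_of_hasDerivAt (by fun_prop) ?_ ?_
      · refine (((((hasDerivAt_id q.1).pow 2).mul_const (Real.cos q.2)).const_sub
          (q.2 * Real.sin q.2)).const_mul (1 / 4)).congr_deriv ?_
        simp
      · refine ((((hasDerivAt_id q.2).mul (Real.hasDerivAt_sin q.2)).sub
          ((Real.hasDerivAt_cos q.2).const_mul (q.1 ^ 2))).const_mul (1 / 4)).congr_deriv ?_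
        simp
    · refine hasPartials_of_hasDerivAt (by fun_prop) ?_ ?_
      · refine (((((hasDerivAt_id q.1).const_mul 2).mul_const (Real.cos q.2)).neg).const_mul
          (1 / 4)).congr_deriv ?_
        simp
      · refine ((((Real.hasDerivAt_cos q.2).const_mul (2 * q.1)).neg).const_mul
          (1 / 4)).congr_deriv ?_
        simp
    · refine hasPartials_of_hasDerivAt (by fun_prop) ?_ ?_
      · refine (((((hasDerivAt_id q.1).pow 2).mul_const (Real.sin q.2)).const_add
          (Real.sin q.2 + q.2 * Real.cos q.2)).const_mul (1 / 4)).congr_deriv ?_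
        simp
      · refine ((((Real.hasDerivAt_sin q.2).add ((hasDerivAt_id q.2).mul
          (Real.hasDerivAt_cos q.2))).add ((Real.hasDerivAt_sin q.2).const_mul
            (q.1 ^ 2))).const_mul (1 / 4)).congr_deriv ?_
        simp
        ring
    · ring

theorem isSmoothDeformation_parabolicModel :
    IsSmoothDeformation
      (fun κ => (fun p : ℂ × ℝ => (p.1, p.2 + Real.pi / 2)) '' dilatedCatenoid κ)
      parabolicModel {q | 0 < q.2 ∧ q.2 < Real.pi}
      fun p => ((sheet (p.1, (p.2.1, p.2.2 - Real.pi / 2))).1,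
        (sheet (p.1, (p.2.1, p.2.2 - Real.pi / 2))).2 + Real.pi / 2) := by
  refine (isSmoothDeformation_sheet.translate (Real.pi / 2)).comp_param
    (φ := fun q => (q.1, q.2 - Real.pi / 2)) ?_ (by fun_prop) ?_ ?_ ?_
  · exact (isOpen_lt continuous_const continuous_snd).inter
      (isOpen_lt continuous_snd continuous_const)
  · rintro q ⟨h0, h1⟩
    show |q.2 - Real.pi / 2| < Real.pi / 2
    rw [abs_lt]
    constructor <;> linarith
  · intro q _ N hN
    exact image_mem_nhds_of_continuousAt_rightInverse (φ := fun q => (q.1, q.2 - Real.pi / 2))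
      (θ := fun q => (q.1, q.2 + Real.pi / 2)) hN
      (by fun_prop) (by simp) (Eventually.of_forall fun p => by simp)
  · intro q _
    simp [parabolicModel, parabolicStrip, Real.cos_sub_pi_div_two]

theorem isJacobiField_parabolicModel :
    IsJacobiFieldOfDeformation
      (fun κ => (fun p : ℂ × ℝ => (p.1, p.2 + Real.pi / 2)) '' dilatedCatenoid κ)
      parabolicModel (fun q => (⟨0, -Real.sin q.2 ^ 2⟩, Real.cos q.2))
      {q | 0 < q.2 ∧ q.2 < Real.pi}
      (fun q => 1 / 8 * ((Real.pi - 2 * q.2) * Real.cos q.2 - 2 * q.1 ^ 2 * Real.sin q.2)) := by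
  have h1 : ∀ t, Real.sin t ^ 2 + Real.cos t ^ 2 = 1 := Real.sin_sq_add_cos_sq
  have hpos : ∀ t ∈ Set.Ioo 0 Real.pi, 0 < Real.sin t := fun t ht =>
    Real.sin_pos_of_mem_Ioo ht
  refine ⟨isMinimalImmersionOn_profile Real.contDiff_sin Real.hasDerivAt_sin Real.hasDerivAt_cos h1
    hpos, ?_, fun q hq => isUnitNormal_profile Real.hasDerivAt_sin h1 (hpos _ hq),
    ⟨_, isSmoothDeformation_parabolicModel⟩, ?_, ?_⟩
  · refine ContDiff.contDiffOn (ContDiff.prodMk (contDiff_complex_mk.comp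
      (f := fun q : ℝ × ℝ => ((0 : ℝ), -Real.sin q.2 ^ 2)) (by fun_prop)) (by fun_prop))
  · intro G hG q hq
    obtain ⟨hd, hmem⟩ := hG.hasDerivAt_and_eventually_mem hq
    -- Undoing the vertical translation gives a curve through the catenoids themselves with the same
    -- velocity.
    have hd' : HasDerivAt (fun κ => G (κ, q) - ((0 : ℂ), Real.pi / 2))
        (deriv (fun κ => G (κ, q)) 0) 0 := hd.sub_const _
    have h := normal_velocity (x := q.1) (t := q.2 - Real.pi / 2) hd' ?_ ?_
    · have := hpos _ hq
      rw [Real.sin_sub_pi_div_two, Real.cos_sub_pi_div_two] at h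
      simp only [ambientMetric, parabolicModel]
      have e : ∀ a : ℝ, (0 * a + -Real.sin q.2 ^ 2 * (deriv (fun κ => G (κ, q)) 0).1.im) /
          Real.sin q.2 ^ 2 = -(deriv (fun κ => G (κ, q)) 0).1.im := fun a => by
        field_simp
        ring
      rw [e]
      linear_combination h
    · rw [hG.zero q hq]
      simp [parabolicModel, parabolicStrip, Real.cos_sub_pi_div_two]
    · filter_upwards [hmem] with κ hκ
      obtain ⟨p, hp, hpG⟩ := hκ
      rw [← hpG]
      simpa using hp
  · intro q hq
    refine jacobiOperator_profile isOpen_Ioo Real.hasDerivAt_sin Real.hasDerivAt_cos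
      h1 hpos hq (w₀ := fun q => 1 / 8 * -(4 * q.1 * Real.sin q.2))
      (w₁ := fun q => 1 / 8 * (-2 * Real.cos q.2 - (Real.pi - 2 * q.2) * Real.sin q.2 -
        2 * q.1 ^ 2 * Real.cos q.2))
      (p₀ := 1 / 8 * -(4 * Real.sin q.2)) (c := 1 / 8 * -(4 * q.1 * Real.cos q.2))
      (d := 1 / 8 * -(4 * q.1 * Real.cos q.2))
      (p₁ := 1 / 8 * (4 * Real.sin q.2 - (Real.pi - 2 * q.2) * Real.cos q.2 +
        2 * q.1 ^ 2 * Real.sin q.2))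
      (fun q => ?_) ?_ ?_ ?_
    · refine hasPartials_of_hasDerivAt (by fun_prop) ?_ ?_
      · refine ((((((hasDerivAt_id q.1).pow 2).const_mul 2).mul_const (Real.sin q.2)).const_sub
          ((Real.pi - 2 * q.2) * Real.cos q.2)).const_mul (1 / 8)).congr_deriv ?_
        simp only [id, Nat.cast_ofNat, Nat.add_one_sub_one, pow_one, mul_one]
        ring
      · refine ((((((hasDerivAt_id q.2).const_mul 2).const_sub Real.pi).mul
          (Real.hasDerivAt_cos q.2)).sub
          ((Real.hasDerivAt_sin q.2).const_mul (2 * q.1 ^ 2))).const_mul (1 / 8)).congr_deriv ?_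
        simp
        ring
    · refine hasPartials_of_hasDerivAt (by fun_prop) ?_ ?_
      · refine (((((hasDerivAt_id q.1).const_mul 4).mul_const (Real.sin q.2)).neg).const_mul
          (1 / 8)).congr_deriv ?_
        simp
      · refine ((((Real.hasDerivAt_sin q.2).const_mul (4 * q.1)).neg).const_mul
          (1 / 8)).congr_deriv ?_
        simp
    · refine hasPartials_of_hasDerivAt (by fun_prop) ?_ ?_
      · refine ((((((hasDerivAt_id q.1).pow 2).const_mul 2).mul_const (Real.cos q.2)).const_sub
          (-2 * Real.cos q.2 - (Real.pi - 2 * q.2) * Real.sin q.2)).const_mul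
          (1 / 8)).congr_deriv ?_
        simp only [id, Nat.cast_ofNat, Nat.add_one_sub_one, pow_one, mul_one]
        ring
      · refine (((((Real.hasDerivAt_cos q.2).const_mul (-2)).sub
          ((((hasDerivAt_id q.2).const_mul 2).const_sub Real.pi).mul
            (Real.hasDerivAt_sin q.2))).sub ((Real.hasDerivAt_cos q.2).const_mul
            (2 * q.1 ^ 2))).const_mul (1 / 8)).congr_deriv ?_
        simp
        ring
    · ring

/-! ### The upper half of the parabolic catenoid as a graph over $0<y<1$. -/

theorem isOpen_unitStrip : IsOpen {q : ℝ × ℝ | 0 < q.2 ∧ q.2 < 1} :=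
  (isOpen_lt continuous_const continuous_snd).inter (isOpen_lt continuous_snd continuous_const)

theorem contDiffOn_arccos_snd {U : Set (ℝ × ℝ)} (hU : ∀ q ∈ U, 0 < q.2 ∧ q.2 < 1) :
    ContDiffOn ℝ ∞ (fun q : ℝ × ℝ => Real.arccos q.2) U := fun q hq =>
  (ContDiffAt.comp (g := Real.arccos) q (Real.contDiffAt_arccos (by linarith [(hU q hq).1])
    (hU q hq).2.ne) contDiffAt_snd).contDiffWithinAt

theorem hasPartials_arccos_snd {q : ℝ × ℝ} (hq : 0 < q.2 ∧ q.2 < 1) :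
    HasPartials (fun q : ℝ × ℝ => Real.arccos q.2) q 0 (-(1 / √(1 - q.2 ^ 2))) :=
  ((Real.hasDerivAt_arccos (by linarith [hq.1]) hq.2.ne).comp_hasPartials
    hasPartials_snd).congr_partials (by simp) (by simp)

theorem one_sub_sq_pos {y : ℝ} (hy : 0 < y ∧ y < 1) : 0 < 1 - y ^ 2 := by
  nlinarith [hy.1, hy.2]

theorem hasDerivAt_sqrt_one_sub_sq {y : ℝ} (hy : 0 < y ∧ y < 1) :
    HasDerivAt (fun y : ℝ => √(1 - y ^ 2)) (-y / √(1 - y ^ 2)) y := by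
  refine ((((hasDerivAt_id y).pow 2).const_sub 1).sqrt (by simpa using (one_sub_sq_pos hy).ne')
    ).congr_deriv ?_
  simp
  field_simp

theorem hasDerivAt_neg_inv_sqrt_one_sub_sq {y : ℝ} (hy : 0 < y ∧ y < 1) :
    HasDerivAt (fun y : ℝ => -(1 / √(1 - y ^ 2))) (-y / √(1 - y ^ 2) ^ 3) y := by
  have hS := Real.sqrt_pos.2 (one_sub_sq_pos hy)
  refine (((hasDerivAt_const y (1 : ℝ)).div (hasDerivAt_sqrt_one_sub_sq hy)
    hS.ne').neg).congr_deriv ?_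
  field_simp
  ring

theorem isMinimalImmersionOn_parabolicGraph :
    IsMinimalImmersionOn parabolicGraph {q | 0 < q.2 ∧ q.2 < 1} := by
  refine isMinimalImmersionOn_graph isOpen_unitStrip (u := fun q => Real.arccos q.2)
    (ux := fun _ => 0) (uy := fun q => -(1 / √(1 - q.2 ^ 2))) (uxx := fun _ => 0)
    (uxy := fun _ => 0) (uyy := fun q => -q.2 / √(1 - q.2 ^ 2) ^ 3) (fun q hq => hq.1)
    (contDiffOn_arccos_snd fun q hq => hq) (fun q hq => hasPartials_arccos_snd hq)
    (fun q _ => hasPartials_const 0) (fun q hq => ?_) fun q hq => ?_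
  · exact ((hasDerivAt_neg_inv_sqrt_one_sub_sq hq).comp_hasPartials
      hasPartials_snd).congr_partials (by simp) (by simp)
  · have hy := hq.1
    have hS := Real.sqrt_pos.2 (one_sub_sq_pos hq)
    generalize √(1 - q.2 ^ 2) = S at hS
    field_simp
    ring

theorem hasPartials_parabolicGraph {q : ℝ × ℝ} (hq : 0 < q.2 ∧ q.2 < 1) :
    HasPartials parabolicGraph q ((⟨1, 0⟩ : ℂ), 0) ((⟨0, 1⟩ : ℂ), -(1 / √(1 - q.2 ^ 2))) :=
  hasPartials_fst.mk hasPartials_snd (hasPartials_arccos_snd hq)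

/-- The coordinates $(x,y)$ are orthogonal, with metric
$\operatorname{diag}\big(y^{-2},\,y^{-2}(1-y^2)^{-1}\big)$, so the operator is computed directly and
not transported from the strip. -/
theorem jacobiOperator_parabolicGraph {q : ℝ × ℝ} (hq : 0 < q.2 ∧ q.2 < 1) :
    jacobiOperator parabolicGraph (fun q => (⟨0, -q.2 ^ 2⟩, -√(1 - q.2 ^ 2)))
      (fun q => 1 / 4 * (√(1 - q.2 ^ 2) * Real.arccos q.2 - q.1 ^ 2 * q.2)) q = 0 := by
  have hprod : ∀ q : ℝ × ℝ, 0 < q.2 ∧ q.2 < 1 →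
      √(1 / q.2 ^ 2 * (1 / (q.2 ^ 2 * (1 - q.2 ^ 2)))) = 1 / (q.2 ^ 2 * √(1 - q.2 ^ 2)) := by
    intro q hq
    have hs := one_sub_sq_pos hq
    have hS := Real.sqrt_pos.2 hs
    have hy := hq.1
    rw [Real.sqrt_eq_iff_mul_self_eq (by positivity) (by positivity)]
    have hS2 := Real.sq_sqrt hs.le
    rw [← hS2, Real.sqrt_sq hS.le]
    field_simp
  have hy := hq.1
  have hs := one_sub_sq_pos hq
  have hS := Real.sqrt_pos.2 hs
  have hS2 := Real.sq_sqrt hs.le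
  have hII : secondForm parabolicGraph (⟨0, -q.2 ^ 2⟩, -√(1 - q.2 ^ 2)) q =
      !![-(1 / q.2), 0; 0, 1 / (q.2 * √(1 - q.2 ^ 2) ^ 2)] := by
    have hIy : Complex.I / (q.2 : ℂ) = ⟨0, 1 / q.2⟩ := by
      apply Complex.ext <;> simp [Complex.div_re, Complex.div_im, Complex.normSq_apply]
    rw [secondForm_eq (A := ![fun _ => ((⟨1, 0⟩ : ℂ), 0),
        fun q => ((⟨0, 1⟩ : ℂ), -(1 / √(1 - q.2 ^ 2)))])
      (B := ![![((⟨0, 0⟩ : ℂ), 0), ((⟨0, 0⟩ : ℂ), 0)],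
        ![((⟨0, 0⟩ : ℂ), 0), ((⟨0, 0⟩ : ℂ), -q.2 / √(1 - q.2 ^ 2) ^ 3)]])
      (eventually_of_mem (isOpen_unitStrip.mem_nhds hq) fun q hq => hasPartials_parabolicGraph hq)
      ?_]
    · generalize √(1 - q.2 ^ 2) = S at hS hS2
      ext i j
      fin_cases i <;> fin_cases j <;> simp [ambientMetric, christoffel, parabolicGraph, hIy]
      · field_simp
      · field_simp
        linear_combination hS2
    · intro j
      fin_cases j
      · exact (hasPartials_const 1).mk (hasPartials_const 0) (hasPartials_const 0)
      · exact (hasPartials_const 0).mk (hasPartials_const 1)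
          (((hasDerivAt_neg_inv_sqrt_one_sub_sq hq).comp_hasPartials
            hasPartials_snd).congr_partials (by simp) (by simp))
  have hwy : ∀ q : ℝ × ℝ, 0 < q.2 ∧ q.2 < 1 → HasDerivAt
      (fun y => √(1 - y ^ 2) * Real.arccos y) (-(q.2 * Real.arccos q.2 / √(1 - q.2 ^ 2)) - 1)
      q.2 := by
    intro q hq
    have hS := Real.sqrt_pos.2 (one_sub_sq_pos hq)
    refine ((hasDerivAt_sqrt_one_sub_sq hq).mul (Real.hasDerivAt_arccos (by linarith [hq.1])
      hq.2.ne)).congr_deriv ?_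
    field_simp
    ring
  rw [jacobiOperator_eq (a := fun q => 1 / q.2 ^ 2) (b := fun q => 1 / (q.2 ^ 2 * (1 - q.2 ^ 2)))
    (α := fun q => 1 / √(1 - q.2 ^ 2)) (β := fun q => √(1 - q.2 ^ 2))
    (w₀ := fun q => 1 / 4 * -(2 * q.1 * q.2))
    (w₁ := fun q => 1 / 4 * (-(q.2 * Real.arccos q.2 / √(1 - q.2 ^ 2)) - 1 - q.1 ^ 2))
    (p₀ := 1 / √(1 - q.2 ^ 2) * (1 / 4 * -(2 * q.2)))
    (c := 1 / 4 * -(2 * q.1) / √(1 - q.2 ^ 2) + 1 / 4 * -(2 * q.1 * q.2) * q.2 /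
      √(1 - q.2 ^ 2) ^ 3)
    (d := √(1 - q.2 ^ 2) * (1 / 4 * -(2 * q.1)))
    (p₁ := 1 / 4 * (-Real.arccos q.2 + 2 * q.2 / √(1 - q.2 ^ 2) + q.1 ^ 2 * q.2 / √(1 - q.2 ^ 2)))
    isOpen_unitStrip hq (fun q hq => by have := hq.1; positivity)
    (fun q hq => by have := hq.1; have := one_sub_sq_pos hq; positivity)
    ?_ ?_ ?_ hII ?_ ?_ ?_, hprod q hq]
  · simp only [ambientRicci, parabolicGraph]
    rw [← hS2, Real.sqrt_sq hS.le]
    generalize √(1 - q.2 ^ 2) = S at hS hS2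
    field_simp
    ring
  · intro q hq
    have hy := hq.1
    have hs := one_sub_sq_pos hq
    rw [firstForm_eq (A := ![((⟨1, 0⟩ : ℂ), 0), ((⟨0, 1⟩ : ℂ), -(1 / √(1 - q.2 ^ 2)))])
      (hasPartials_parabolicGraph hq)]
    have hS := Real.sqrt_pos.2 hs
    have hS2 := Real.sq_sqrt hs.le
    rw [← hS2, Real.sqrt_sq hS.le]
    generalize √(1 - q.2 ^ 2) = S at hS hS2
    ext i j
    fin_cases i <;> fin_cases j <;> simp [ambientMetric, parabolicGraph]
    field_simp
    linear_combination hS2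
  · intro q hq
    have hS := Real.sqrt_pos.2 (one_sub_sq_pos hq)
    have := hq.1
    rw [hprod q hq]
    field_simp
  · intro q hq
    have hs := one_sub_sq_pos hq
    have hS := Real.sqrt_pos.2 hs
    have hS2 := Real.sq_sqrt hs.le
    have := hq.1
    rw [hprod q hq]
    generalize √(1 - q.2 ^ 2) = S at hS hS2
    rw [← hS2]
    field_simp
  · intro q hq
    have hS := Real.sqrt_pos.2 (one_sub_sq_pos hq)
    refine hasPartials_of_hasDerivAt ?_ ?_ ?_
    · have := (contDiffOn_arccos_snd (U := {q : ℝ × ℝ | 0 < q.2 ∧ q.2 < 1}) fun q hq => hq).contDiffAt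
        (isOpen_unitStrip.mem_nhds hq) |>.differentiableAt (by simp)
      have h2 : DifferentiableAt ℝ (fun q : ℝ × ℝ => √(1 - q.2 ^ 2)) q :=
        DifferentiableAt.sqrt (by fun_prop) (one_sub_sq_pos hq).ne'
      fun_prop
    · refine (((((hasDerivAt_id q.1).pow 2).mul_const q.2).const_sub
        (√(1 - q.2 ^ 2) * Real.arccos q.2)).const_mul (1 / 4)).congr_deriv ?_
      simp
    · refine (((hwy q hq).sub ((hasDerivAt_id q.2).const_mul (q.1 ^ 2))).const_mul
        (1 / 4)).congr_deriv ?_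
      simp
  · have h1 : HasPartials (fun q : ℝ × ℝ => 1 / √(1 - q.2 ^ 2)) q 0 (q.2 / √(1 - q.2 ^ 2) ^ 3) :=
      (HasDerivAt.comp_hasPartials (g := fun y => 1 / √(1 - y ^ 2))
        ((hasDerivAt_neg_inv_sqrt_one_sub_sq hq).neg.congr_of_eventuallyEq
          (Eventually.of_forall fun y => by simp)) hasPartials_snd).congr_partials (by simp)
        (by simp [neg_div])
    have h2 : HasPartials (fun q : ℝ × ℝ => 1 / 4 * -(2 * q.1 * q.2)) q (1 / 4 * -(2 * q.2))
        (1 / 4 * -(2 * q.1)) := by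
      refine hasPartials_of_hasDerivAt (by fun_prop) ?_ ?_
      · refine (((((hasDerivAt_id q.1).const_mul 2).mul_const q.2).neg).const_mul
          (1 / 4)).congr_deriv ?_
        simp
      · refine ((((hasDerivAt_id q.2).const_mul (2 * q.1)).neg).const_mul
          (1 / 4)).congr_deriv ?_
        simp
    refine (h1.mul h2).congr_partials (by ring) ?_
    field_simp
    ring
  -- Multiplying out the weight first removes the root from the denominator before differentiating.
  · have he : ∀ᶠ q' in 𝓝 q, √(1 - q'.2 ^ 2) *
        (1 / 4 * (-(q'.2 * Real.arccos q'.2 / √(1 - q'.2 ^ 2)) - 1 - q'.1 ^ 2)) =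
        1 / 4 * (-(q'.2 * Real.arccos q'.2) - √(1 - q'.2 ^ 2) * (1 + q'.1 ^ 2)) := by
      refine eventually_of_mem (isOpen_unitStrip.mem_nhds hq) fun q' hq' => ?_
      have hS := Real.sqrt_pos.2 (one_sub_sq_pos hq')
      field_simp
      ring
    refine HasPartials.congr_of_eventuallyEq ?_ he
    refine hasPartials_of_hasDerivAt ?_ ?_ ?_
    · have := (contDiffOn_arccos_snd (U := {q : ℝ × ℝ | 0 < q.2 ∧ q.2 < 1}) fun q hq => hq).contDiffAt
        (isOpen_unitStrip.mem_nhds hq) |>.differentiableAt (by simp)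
      have h2 : DifferentiableAt ℝ (fun q : ℝ × ℝ => √(1 - q.2 ^ 2)) q :=
        DifferentiableAt.sqrt (by fun_prop) hs.ne'
      fun_prop
    · refine ((((((hasDerivAt_id q.1).pow 2).const_add 1).const_mul √(1 - q.2 ^ 2)).const_sub
        (-(q.2 * Real.arccos q.2))).const_mul (1 / 4)).congr_deriv ?_
      simp only [id, Nat.cast_ofNat, Nat.add_one_sub_one, pow_one, mul_one]
      ring
    · refine ((((hasDerivAt_id q.2).mul (Real.hasDerivAt_arccos (by linarith) hq.2.ne)).neg.sub
        ((hasDerivAt_sqrt_one_sub_sq hq).mul_const (1 + q.1 ^ 2))).const_mul (1 / 4)).congr_deriv ?_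
      simp only [id]
      field_simp
      ring

theorem isSmoothDeformation_parabolicGraph :
    IsSmoothDeformation dilatedCatenoid parabolicGraph {q | 0 < q.2 ∧ q.2 < 1}
      fun p => sheet (p.1, (p.2.1, Real.arccos p.2.2)) := by
  refine isSmoothDeformation_sheet.comp_param (φ := fun q => (q.1, Real.arccos q.2))
    isOpen_unitStrip (contDiffOn_fst.prodMk (contDiffOn_arccos_snd fun q hq => hq)) ?_ ?_ ?_
  · rintro q ⟨h0, -⟩
    show |Real.arccos q.2| < Real.pi / 2
    rw [abs_of_nonneg (Real.arccos_nonneg _)]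
    exact Real.arccos_lt_pi_div_two.2 h0
  · rintro q ⟨h0, h1⟩ N hN
    refine image_mem_nhds_of_continuousAt_rightInverse (φ := fun q => (q.1, Real.arccos q.2))
      (θ := fun q => (q.1, Real.cos q.2)) hN (by fun_prop) ?_ ?_
    · exact Prod.ext rfl (Real.cos_arccos (by linarith) h1.le)
    · have hopen : IsOpen {p : ℝ × ℝ | 0 < p.2 ∧ p.2 < Real.pi} :=
        (isOpen_lt continuous_const continuous_snd).inter
          (isOpen_lt continuous_snd continuous_const)
      have hmem : (q.1, Real.arccos q.2) ∈ {p : ℝ × ℝ | 0 < p.2 ∧ p.2 < Real.pi} := by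
        refine ⟨Real.arccos_pos.2 h1, ?_⟩
        show Real.arccos q.2 < Real.pi
        linarith [Real.arccos_lt_pi_div_two.2 h0, Real.pi_pos]
      filter_upwards [hopen.mem_nhds hmem] with p hp
      exact Prod.ext rfl (Real.arccos_cos hp.1.le hp.2.le)
  · rintro q ⟨h0, h1⟩
    simp [parabolicGraph, parabolicStrip, Real.cos_arccos (show -1 ≤ q.2 by linarith) h1.le]

theorem isJacobiField_parabolicGraph :
    IsJacobiFieldOfDeformation dilatedCatenoid parabolicGraph
      (fun q => (⟨0, -q.2 ^ 2⟩, -√(1 - q.2 ^ 2))) {q | 0 < q.2 ∧ q.2 < 1}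
      (fun q => 1 / 4 * (√(1 - q.2 ^ 2) * Real.arccos q.2 - q.1 ^ 2 * q.2)) := by
  refine ⟨isMinimalImmersionOn_parabolicGraph, ?_, ?_, ⟨_, isSmoothDeformation_parabolicGraph⟩, ?_,
    fun q hq => jacobiOperator_parabolicGraph hq⟩
  · refine ContDiffOn.prodMk (contDiff_complex_mk.comp (f := fun q : ℝ × ℝ => ((0 : ℝ), -q.2 ^ 2))
      (by fun_prop)).contDiffOn (ContDiffOn.neg (ContDiffOn.sqrt (by fun_prop) fun q hq => ?_))
    exact (one_sub_sq_pos hq).ne'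
  · intro q hq
    have hs := one_sub_sq_pos hq
    have hS := Real.sqrt_pos.2 hs
    have hS2 := Real.sq_sqrt hs.le
    have hy := hq.1
    refine ⟨?_, fun i => ?_⟩
    · simp only [ambientMetric, parabolicGraph]
      field_simp
      linear_combination q.2 ^ 2 * hS2
    · fin_cases i
      · rw [Fin.mk_zero, (hasPartials_parabolicGraph hq).partialD_zero]
        simp [ambientMetric]
      · rw [Fin.mk_one, (hasPartials_parabolicGraph hq).partialD_one]
        simp only [ambientMetric, parabolicGraph]
        field_simp
        ring
  · intro G hG q hq
    obtain ⟨hd, hmem⟩ := hG.hasDerivAt_and_eventually_mem hq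
    have hcos := Real.cos_arccos (show -1 ≤ q.2 by linarith [hq.1]) hq.2.le
    -- The point over $(x,y)$ is the strip point at $t=\arccos y$, so the same velocity formula
    -- applies with $\sin t=\sqrt{1-y^2}$.
    have h0 : G (0, q) = parabolicStrip (q.1, Real.arccos q.2) := by
      rw [hG.zero q hq, parabolicStrip, parabolicGraph]
      simp only [hcos]
    have h := normal_velocity hd h0 hmem
    rw [hcos, Real.sin_arccos] at h
    have hy := hq.1
    simp only [ambientMetric, parabolicGraph]
    have e : ∀ a : ℝ, (0 * a + -q.2 ^ 2 * (deriv (fun κ => G (κ, q)) 0).1.im) / q.2 ^ 2 =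
        -(deriv (fun κ => G (κ, q)) 0).1.im := fun a => by
      field_simp
      ring
    rw [e]
    linear_combination h

end

theorem mainTheorem2 :
    -- the dilated catenoid is the bigraph of `t_κ` over the dilated domain, which tends
    -- to the strip `0 < y ≤ 1` as `κ → 0`; its half `Φ_κ` is a minimal immersion off the neck
    (∀ κ : ℝ, 0 < κ →
      dilatedCatenoid κ = {p | p.1 ∈ dilatedDomain κ ∧ |p.2| = dilatedTime κ p.1} ∧
      {z : ℂ | 0 < z.im ∧ z.im ≤ 1} ⊆ dilatedDomain κ ∧
      IsMinimalImmersionOn (catenoidGraph κ)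
        {q | (⟨q.1, q.2⟩ : ℂ) ∈ interior (dilatedDomain κ)}) ∧
    (∀ z : ℂ, 1 < z.im → ∀ᶠ κ in 𝓝[>] (0 : ℝ), z ∉ dilatedDomain κ) ∧
    -- convergence to the parabolic catenoid
    (∀ x y : ℝ, 0 < y → y ≤ 1 →
      Tendsto (fun κ => catenoidGraph κ (x, y)) (𝓝[>] 0) (𝓝 (parabolicGraph (x, y)))) ∧
    (∃ G, IsSmoothDeformation dilatedCatenoid parabolicStrip
      {q | |q.2| < Real.pi / 2} G) ∧
    (∀ p : ℂ × ℝ, 0 < p.1.im → p ∉ parabolicStrip '' {q | |q.2| < Real.pi / 2} →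
      ∃ V ∈ 𝓝 p, ∀ᶠ κ in 𝓝[>] (0 : ℝ), Disjoint (dilatedCatenoid κ) V) ∧
    -- the variation field of `Φ_κ` at `κ = 0`, and its normal component
    (∀ x y : ℝ, 0 < y → y < 1 →
      Tendsto (fun κ : ℝ => κ⁻¹ • (catenoidGraph κ (x, y) - parabolicGraph (x, y))) (𝓝[>] 0)
        (𝓝 (0, 1 / 4 * (x ^ 2 * y / √(1 - y ^ 2) - Real.arccos y))) ∧
      ambientMetric (parabolicGraph (x, y)) (⟨0, -y ^ 2⟩, -√(1 - y ^ 2))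
          (0, 1 / 4 * (x ^ 2 * y / √(1 - y ^ 2) - Real.arccos y)) =
        1 / 4 * (√(1 - y ^ 2) * Real.arccos y - x ^ 2 * y)) ∧
    -- the Jacobi field in the parametrization `(x, y, arccos y)` of the upper half
    IsJacobiFieldOfDeformation dilatedCatenoid parabolicGraph
      (fun q => (⟨0, -q.2 ^ 2⟩, -√(1 - q.2 ^ 2)))
      {q | 0 < q.2 ∧ q.2 < 1}
      (fun q => 1 / 4 * (√(1 - q.2 ^ 2) * Real.arccos q.2 - q.1 ^ 2 * q.2)) ∧
    -- the same Jacobi field in the parametrization `(x, cos t, t)` of the whole surface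
    IsJacobiFieldOfDeformation dilatedCatenoid parabolicStrip
      (fun q => (⟨0, -Real.cos q.2 ^ 2⟩, -Real.sin q.2))
      {q | |q.2| < Real.pi / 2}
      (fun q => 1 / 4 * (q.2 * Real.sin q.2 - q.1 ^ 2 * Real.cos q.2)) ∧
    (∀ x t : ℝ, 0 < t → t < Real.pi / 2 →
      parabolicGraph (x, Real.cos t) = parabolicStrip (x, t) ∧
      1 / 4 * (√(1 - Real.cos t ^ 2) * Real.arccos (Real.cos t) - x ^ 2 * Real.cos t) =
        1 / 4 * (t * Real.sin t - x ^ 2 * Real.cos t)) ∧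
    -- the Jacobi field on the model `(x, sin t, t)`, after the vertical translation by `π / 2`
    IsJacobiFieldOfDeformation
      (fun κ => (fun p : ℂ × ℝ => (p.1, p.2 + Real.pi / 2)) '' dilatedCatenoid κ)
      parabolicModel
      (fun q => (⟨0, -Real.sin q.2 ^ 2⟩, Real.cos q.2))
      {q | 0 < q.2 ∧ q.2 < Real.pi}
      (fun q => 1 / 8 * ((Real.pi - 2 * q.2) * Real.cos q.2 - 2 * q.1 ^ 2 * Real.sin q.2)) := by
  refine ⟨fun κ hκ => ⟨dilatedCatenoid_eq_bigraph hκ, strip_subset_dilatedDomain hκ,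
      isMinimalImmersionOn_catenoidGraph hκ⟩,
    fun z hz => eventually_notMem_dilatedDomain hz, fun x y hy hy1 => tendsto_catenoidGraph hy hy1,
    ⟨sheet, isSmoothDeformation_sheet⟩, fun p hy hp => exists_disjoint_nhds hy hp,
    fun x y hy hy1 => ⟨tendsto_slope_catenoidGraph hy hy1, ?_⟩, isJacobiField_parabolicGraph,
    isJacobiField_parabolicStrip, fun x t h0 h1 => ?_, isJacobiField_parabolicModel⟩
  · have hS := Real.sqrt_pos.2 (one_sub_sq_pos ⟨hy, hy1⟩)
    simp only [ambientMetric, Complex.zero_im, Complex.zero_re]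
    field_simp
    ring
  · have hpi := Real.pi_pos
    have hs : √(1 - Real.cos t ^ 2) = Real.sin t := by
      rw [← Real.sin_sq, Real.sqrt_sq (Real.sin_pos_of_pos_of_lt_pi h0 (by linarith)).le]
    have ha : Real.arccos (Real.cos t) = t := Real.arccos_cos h0.le (by linarith)
    rw [hs, ha, parabolicGraph, parabolicStrip, ha]
    exact ⟨rfl, by ring⟩
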